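/- Let $\Omega\subseteq\mathbb R^3$ be open (a coordinate domain) and let $\gamma$ be a smooth Riemannian metric on $\Omega$, with Levi-Civita connection $\nabla$ and Ricci tensor $R$. Indices are moved with $\gamma$; put $s=\operatorname{tr}R^2$, $t=\operatorname{tr}R^3$, $P=6R^2-s\,\gamma$, and $V=\big[P(\mathrm d s^{-2/3},\mathrm d s^{-2/3})\big]^{1/2}$. For a smooth function $U$ on $\Omega$ consider the static metric $g=-e^{2U}\mathrm dT^2+\gamma$ on $\mathbb R\times\Omega$, and let $u=e^{-U}\partial_T$. Call $U$ a *static vacuum potential* of $\gamma$ if $g$ is Ricci-flat. Let $Q=E+iB$ be the endomorphism of the complexified rest space $u^\perp$ formed with the electric part $E$ and the magnetic part $B$ of the Weyl tensor of $g$ with respect to $u$. The metric $g$ is of Petrov–Bel type D at an event if $Q$ is there diagonalizable with eigenvalues $\alpha,\alpha,-2\alpha$ and $\alpha\neq0$; $\alpha$ is the Weyl eigenvalue. If the unit vector $e\in u^\perp$ spans the eigenspace of $-2\alpha$, the timelike principal plane is $\operatorname{span}(u,e)$, and the spacelike principal plane is its orthogonal complement. A type D static vacuum metric is of class A at an event if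 the gradient of $\alpha$ there is a non-zero vector of the timelike principal plane, of class B if that gradient lies on the spacelike principal plane, and of class C if it lies on neither plane. We say that $\gamma$ is *the spatial metric of a static vacuum A-metric or C-metric* if it has a static vacuum potential $U$ such that $g$ is of type D, and of class A or class C, at every event of $\mathbb R\times\Omega$; such a $U$ is called an *A/C potential* of $\gamma$. **Theorem.** The metric $\gamma$ is the spatial metric of a static vacuum A-metric or C-metric if and only if, at every point of $\Omega$, $$\operatorname{tr}R=0,\qquad 6t^2=s^3,\qquad P(\mathrm d s)\neq0,\qquad R=\frac1V\,\nabla\mathrm dV .$$ In this case $V>0$ on $\Omega$, and every function $U$ with $e^U=c\,V$ on $\Omega$ for some constant $c>0$ is an A/C potential of $\gamma$; in particular $U=\ln V$ is one. If moreover $\Omega$ is connected, the potential is unique up to an additive constant: every static vacuum potential $U$ of $\gamma$ satisfies $e^U=c\,V$ on $\Omega$ for some constant $c>0$. -/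

import Mathlib

open scoped ContDiff Matrix

noncomputable section

namespace StaticVacuum

/-! ### Coordinate tensor calculus on open subsets of `ℝⁿ`

A (pseudo-Riemannian) metric is given by the matrix of its components `g x i j` at the point `x`
in the coordinates of `Fin n → ℝ`. -/

/-- The partial derivative `∂ᵢ f` at `x` of a real or complex function. -/
def pd {n : ℕ} {F : Type*} [NormedAddCommGroup F] [NormedSpace ℝ F]
    (i : Fin n) (f : (Fin n → ℝ) → F) (x : Fin n → ℝ) : F :=
  fderiv ℝ f x (Pi.single i 1)

/-- The Christoffel symbol `Γᵏᵢⱼ` of the Levi-Civita connection of `g`. -/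
def christoffel {n : ℕ} (g : (Fin n → ℝ) → Matrix (Fin n) (Fin n) ℝ)
    (k i j : Fin n) (x : Fin n → ℝ) : ℝ :=
  (1 / 2 : ℝ) * ∑ l, (g x)⁻¹ k l *
    (pd i (fun y => g y j l) x + pd j (fun y => g y i l) x - pd l (fun y => g y i j) x)

/-- The curvature tensor `Rᵏₗᵢⱼ = ∂ᵢ Γᵏⱼₗ - ∂ⱼ Γᵏᵢₗ + Γᵏᵢₘ Γᵐⱼₗ - Γᵏⱼₘ Γᵐᵢₗ`. -/
def riemann {n : ℕ} (g : (Fin n → ℝ) → Matrix (Fin n) (Fin n) ℝ)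
    (k l i j : Fin n) (x : Fin n → ℝ) : ℝ :=
  pd i (christoffel g k j l) x - pd j (christoffel g k i l) x
    + ∑ m, (christoffel g k i m x * christoffel g m j l x
        - christoffel g k j m x * christoffel g m i l x)

/-- The curvature tensor with all indices down, `Rₖₗᵢⱼ`. -/
def riemannLow {n : ℕ} (g : (Fin n → ℝ) → Matrix (Fin n) (Fin n) ℝ)
    (k l i j : Fin n) (x : Fin n → ℝ) : ℝ :=
  ∑ m, g x k m * riemann g m l i j x

/-- The Ricci tensor `Rᵢⱼ = Rᵏᵢₖⱼ` (positive on round spheres). -/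
def ricci {n : ℕ} (g : (Fin n → ℝ) → Matrix (Fin n) (Fin n) ℝ)
    (x : Fin n → ℝ) : Matrix (Fin n) (Fin n) ℝ :=
  Matrix.of fun i j => ∑ k, riemann g k i k j x

/-- The scalar curvature. -/
def scalarCurv {n : ℕ} (g : (Fin n → ℝ) → Matrix (Fin n) (Fin n) ℝ) (x : Fin n → ℝ) : ℝ :=
  ((g x)⁻¹ * ricci g x).trace

/-- The covariant Hessian `∇df`, that is `∂ᵢ∂ⱼ f - Γᵏᵢⱼ ∂ₖ f`. -/
def hessian {n : ℕ} (g : (Fin n → ℝ) → Matrix (Fin n) (Fin n) ℝ)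
    (f : (Fin n → ℝ) → ℝ) (x : Fin n → ℝ) : Matrix (Fin n) (Fin n) ℝ :=
  Matrix.of fun i j => pd i (pd j f) x - ∑ k, christoffel g k i j x * pd k f x

/-- `g` is a smooth Riemannian metric on `Ω`. -/
structure IsRiemannianMetricOn {n : ℕ} (g : (Fin n → ℝ) → Matrix (Fin n) (Fin n) ℝ)
    (Ω : Set (Fin n → ℝ)) : Prop where
  smooth : ∀ i j, ContDiffOn ℝ ∞ (fun x => g x i j) Ω
  posDef : ∀ x ∈ Ω, (g x).PosDef

/-! ### The Weyl tensor of a space-time and its Petrov type D form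

`g` is a Lorentzian metric of signature `(-,+,+,+)` on an open set of `ℝ⁴`, and `u` a unit timelike
vector at the point `x`. -/

/-- The Weyl tensor `W_{abcd}` in dimension four. -/
def weyl (g : (Fin 4 → ℝ) → Matrix (Fin 4) (Fin 4) ℝ) (a b c d : Fin 4) (x : Fin 4 → ℝ) : ℝ :=
  riemannLow g a b c d x
    - (1 / 2 : ℝ) * (g x a c * ricci g x b d - g x a d * ricci g x b c
        + g x b d * ricci g x a c - g x b c * ricci g x a d)
    + (scalarCurv g x / 6) * (g x a c * g x b d - g x a d * g x b c)

/-- The volume form `η_{abcd}`: `√|det g|` times the Levi-Civita symbol, the latter written as the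
determinant of the identity matrix with its rows taken in the order `a, b, c, d`. -/
def volForm (g : (Fin 4 → ℝ) → Matrix (Fin 4) (Fin 4) ℝ) (a b c d : Fin 4) (x : Fin 4 → ℝ) : ℝ :=
  Real.sqrt |(g x).det| * ((1 : Matrix (Fin 4) (Fin 4) ℝ).submatrix ![a, b, c, d] id).det

/-- The dual Weyl tensor `*W_{abcd} = ½ η_{abef} W^{ef}_{cd}`. -/
def dualWeyl (g : (Fin 4 → ℝ) → Matrix (Fin 4) (Fin 4) ℝ) (a b c d : Fin 4) (x : Fin 4 → ℝ) : ℝ :=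
  (1 / 2 : ℝ) * ∑ e, ∑ f, ∑ p, ∑ q,
    volForm g a b e f x * (g x)⁻¹ e p * (g x)⁻¹ f q * weyl g p q c d x

/-- The electric part `E_{ab} = W_{acbd} uᶜ uᵈ` of the Weyl tensor with respect to `u`. -/
def electric (g : (Fin 4 → ℝ) → Matrix (Fin 4) (Fin 4) ℝ) (u x : Fin 4 → ℝ) :
    Matrix (Fin 4) (Fin 4) ℝ :=
  Matrix.of fun a b => ∑ c, ∑ d, weyl g a c b d x * u c * u d

/-- The magnetic part `B_{ab} = *W_{acbd} uᶜ uᵈ` of the Weyl tensor with respect to `u`. -/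
def magnetic (g : (Fin 4 → ℝ) → Matrix (Fin 4) (Fin 4) ℝ) (u x : Fin 4 → ℝ) :
    Matrix (Fin 4) (Fin 4) ℝ :=
  Matrix.of fun a b => ∑ c, ∑ d, dualWeyl g a c b d x * u c * u d

/-- The complex Weyl endomorphism `Qᵃ_b = g^{ac}(E_{cb} + i B_{cb})`. It annihilates `u` and maps
the (complexified) rest space of `u` to itself. -/
def weylEndo (g : (Fin 4 → ℝ) → Matrix (Fin 4) (Fin 4) ℝ) (u x : Fin 4 → ℝ) :
    Matrix (Fin 4) (Fin 4) ℂ :=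
  ((g x)⁻¹ * electric g u x).map Complex.ofReal
    + Complex.I • ((g x)⁻¹ * magnetic g u x).map Complex.ofReal

/-- The orthogonal projector `hᵃ_b = δᵃ_b + uᵃ u_b` on the rest space of the unit timelike `u`. -/
def restProj (g : (Fin 4 → ℝ) → Matrix (Fin 4) (Fin 4) ℝ) (u x : Fin 4 → ℝ) :
    Matrix (Fin 4) (Fin 4) ℂ :=
  (1 + Matrix.vecMulVec u (g x *ᵥ u)).map Complex.ofReal

/-- The Weyl tensor of `g` is of Petrov-Bel type D at `x`, with double eigenvalue `α`: on the rest
space of the unit timelike vector `u` the trace-free endomorphism `Q` is diagonalizable with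
eigenvalues `α, α, -2α`, where `α ≠ 0`. -/
def IsTypeDAt (g : (Fin 4 → ℝ) → Matrix (Fin 4) (Fin 4) ℝ) (u x : Fin 4 → ℝ) (α : ℂ) : Prop :=
  α ≠ 0 ∧
    (weylEndo g u x - α • restProj g u x) * (weylEndo g u x + (2 * α) • restProj g u x) = 0

/-- `e` is a unit vector of the rest space of `u` that spans the eigenspace of the simple eigenvalue
`-2α` of `Q`. The timelike principal plane of the type D Weyl tensor is then spanned by `u` and `e`,
and the spacelike principal plane is its orthogonal complement. -/
def IsPrincipalDir (g : (Fin 4 → ℝ) → Matrix (Fin 4) (Fin 4) ℝ) (u x : Fin 4 → ℝ) (α : ℂ)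
    (e : Fin 4 → ℝ) : Prop :=
  u ⬝ᵥ (g x *ᵥ e) = 0 ∧ e ⬝ᵥ (g x *ᵥ e) = 1 ∧
    weylEndo g u x *ᵥ (fun a => (e a : ℂ)) = (-2 * α) • (fun a => (e a : ℂ))

/-- The gradient of the function `α` at `x` lies on the plane spanned by `u` and `e`: it is
orthogonal to every vector that is orthogonal to that plane. -/
def GradInTimelikePlane (g : (Fin 4 → ℝ) → Matrix (Fin 4) (Fin 4) ℝ) (u e : Fin 4 → ℝ)
    (α : (Fin 4 → ℝ) → ℂ) (x : Fin 4 → ℝ) : Prop :=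
  ∀ v : Fin 4 → ℝ, u ⬝ᵥ (g x *ᵥ v) = 0 → e ⬝ᵥ (g x *ᵥ v) = 0 → fderiv ℝ α x v = 0

/-- The gradient of the function `α` at `x` lies on the plane orthogonal to `u` and `e`. -/
def GradInSpacelikePlane (u e : Fin 4 → ℝ) (α : (Fin 4 → ℝ) → ℂ) (x : Fin 4 → ℝ) : Prop :=
  fderiv ℝ α x u = 0 ∧ fderiv ℝ α x e = 0

/-- Class A at `x`: the gradient of the Weyl eigenvalue is a non-zero vector of the timelike
principal plane. -/
def IsClassA (g : (Fin 4 → ℝ) → Matrix (Fin 4) (Fin 4) ℝ) (u e : Fin 4 → ℝ)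
    (α : (Fin 4 → ℝ) → ℂ) (x : Fin 4 → ℝ) : Prop :=
  GradInTimelikePlane g u e α x ∧ fderiv ℝ α x ≠ 0

/-- Class C at `x`: the gradient of the Weyl eigenvalue lies on neither principal plane. (In the
remaining class B it lies on the spacelike one.) -/
def IsClassC (g : (Fin 4 → ℝ) → Matrix (Fin 4) (Fin 4) ℝ) (u e : Fin 4 → ℝ)
    (α : (Fin 4 → ℝ) → ℂ) (x : Fin 4 → ℝ) : Prop :=
  ¬ GradInTimelikePlane g u e α x ∧ ¬ GradInSpacelikePlane u e α x

/-! ### Static space-times -/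

/-- The spatial coordinates of an event; coordinate `0` is the static time `T`. -/
def space (X : Fin 4 → ℝ) : Fin 3 → ℝ := fun i => X i.succ

/-- The static metric `-e^{2U} dT² + γ_{ij} dxⁱ dxʲ`. -/
def staticMetric (γ : (Fin 3 → ℝ) → Matrix (Fin 3) (Fin 3) ℝ) (U : (Fin 3 → ℝ) → ℝ)
    (X : Fin 4 → ℝ) : Matrix (Fin 4) (Fin 4) ℝ :=
  Matrix.of fun a b =>
    Fin.cases (Fin.cases (-Real.exp (2 * U (space X))) (fun _ => 0) b)
      (fun i => Fin.cases 0 (fun j => γ (space X) i j) b) a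

/-- The unit vector `e^{-U} ∂_T` of the static observer. -/
def staticObserver (U : (Fin 3 → ℝ) → ℝ) (X : Fin 4 → ℝ) : Fin 4 → ℝ :=
  Pi.single 0 (Real.exp (-U (space X)))

/-- `U` is a smooth potential on `Ω` for which the static metric `-e^{2U} dT² + γ` on `ℝ × Ω` is a
solution of the vacuum Einstein equations. -/
structure IsStaticVacuumPotential (Ω : Set (Fin 3 → ℝ))
    (γ : (Fin 3 → ℝ) → Matrix (Fin 3) (Fin 3) ℝ) (U : (Fin 3 → ℝ) → ℝ) : Prop where
  smooth : ContDiffOn ℝ ∞ U Ω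
  vacuum : ∀ X : Fin 4 → ℝ, space X ∈ Ω → ricci (staticMetric γ U) X = 0

/-- The static metric `-e^{2U} dT² + γ` on `ℝ × Ω` is a vacuum solution, of Petrov-Bel type D with
Weyl eigenvalue `α`, and of class A or class C at each event. -/
def IsACPotential (Ω : Set (Fin 3 → ℝ)) (γ : (Fin 3 → ℝ) → Matrix (Fin 3) (Fin 3) ℝ)
    (U : (Fin 3 → ℝ) → ℝ) : Prop :=
  IsStaticVacuumPotential Ω γ U ∧
  ∃ (α : (Fin 4 → ℝ) → ℂ) (e : (Fin 4 → ℝ) → (Fin 4 → ℝ)),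
    ∀ X : Fin 4 → ℝ, space X ∈ Ω →
      IsTypeDAt (staticMetric γ U) (staticObserver U X) X (α X) ∧
      IsPrincipalDir (staticMetric γ U) (staticObserver U X) X (α X) (e X) ∧
      (IsClassA (staticMetric γ U) (staticObserver U X) (e X) α X ∨
        IsClassC (staticMetric γ U) (staticObserver U X) (e X) α X)

/-- `γ` is the spatial metric of a static vacuum A-metric or C-metric. -/
def IsSpatialMetricOfAC (Ω : Set (Fin 3 → ℝ))
    (γ : (Fin 3 → ℝ) → Matrix (Fin 3) (Fin 3) ℝ) : Prop :=
  ∃ U : (Fin 3 → ℝ) → ℝ, IsACPotential Ω γ U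

/-! ### Ricci concomitants of a 3-metric -/

/-- The Ricci endomorphism `Rⁱⱼ`. -/
def ricciEndo (γ : (Fin 3 → ℝ) → Matrix (Fin 3) (Fin 3) ℝ) (x : Fin 3 → ℝ) :
    Matrix (Fin 3) (Fin 3) ℝ :=
  (γ x)⁻¹ * ricci γ x

/-- `s = tr R²`. -/
def sInv (γ : (Fin 3 → ℝ) → Matrix (Fin 3) (Fin 3) ℝ) (x : Fin 3 → ℝ) : ℝ :=
  (ricciEndo γ x ^ 2).trace

/-- `t = tr R³`. -/
def tInv (γ : (Fin 3 → ℝ) → Matrix (Fin 3) (Fin 3) ℝ) (x : Fin 3 → ℝ) : ℝ :=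
  (ricciEndo γ x ^ 3).trace

/-- `P = 6 R² - s γ` with both indices raised, as a bilinear form on covectors. -/
def PUp (γ : (Fin 3 → ℝ) → Matrix (Fin 3) (Fin 3) ℝ) (x : Fin 3 → ℝ) :
    Matrix (Fin 3) (Fin 3) ℝ :=
  ((6 : ℝ) • ricciEndo γ x ^ 2 - sInv γ x • (1 : Matrix (Fin 3) (Fin 3) ℝ)) * (γ x)⁻¹

/-- The components `∂ᵢ f` of the differential of `f`. -/
def diff (f : (Fin 3 → ℝ) → ℝ) (x : Fin 3 → ℝ) : Fin 3 → ℝ := fun i => pd i f x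

/-- `V = [P(d s^{-2/3}, d s^{-2/3})]^{1/2}`. -/
def V (γ : (Fin 3 → ℝ) → Matrix (Fin 3) (Fin 3) ℝ) (x : Fin 3 → ℝ) : ℝ :=
  Real.sqrt (diff (fun y => sInv γ y ^ (-(2 / 3) : ℝ)) x ⬝ᵥ
    (PUp γ x *ᵥ diff (fun y => sInv γ y ^ (-(2 / 3) : ℝ)) x))

end StaticVacuum

end

/-! For $-e^{2U}dT^2+\gamma$ the vacuum equations read $R=\nabla dU+dU\otimes dU$ and
$\operatorname{tr}R=0$ (`ricci_static_eq_zero_iff`). A static metric has no magnetic Weyl part, and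
in vacuum its electric part is $R$ itself, so $Q$ is the Ricci endomorphism of $\gamma$
(`weylEndo_static`). Type D therefore means $R=\alpha(\gamma-3e\otimes e)$ with a unit covector $e$
and $\alpha\ne0$. For a trace-free self-adjoint endomorphism this is $6t^2=s^3$, $s\neq0$, and then
$\alpha=-t/s$ and $s=6\alpha^2$ (`exists_axis_of_discriminant`, `invariants_of_typeD`). Moreover
$P=18\alpha^2E\otimes E$, where $E$ is $e$ with its index raised. Since $\alpha$ does not depend on
$T$, class A or C says exactly that $E(\alpha)\ne0$, that is, $P(ds)\ne0$
(`isClassA_or_isClassC_iff`, `IsAxisAt.PUp_diff_ne_zero_iff`).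

The remaining point is that $V$ is the lapse $e^U$ up to a constant. Put $n=dU$, $\nu=E(U)$,
$\mu=-E(\alpha)/(3\alpha)$. In dimension three $R$ determines the whole curvature, so the Ricci
identities are explicit. The identity for $dU$, whose covariant derivative is given by the vacuum
equations, yields $d\alpha=E(\alpha)e-3\alpha(n-\nu e)$ and
$\nabla_ke_i=-n_ie_k+(\nu-\mu)e_ke_i+\mu\gamma_{ki}$ (`axis_derivatives`). The identity for $e$ then
yields $d\mu=\mu(\nu-\mu)e$ (`axis_second_derivatives`). Now $V^2=48\,s^{-1/3}\mu^2$, and these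
formulas give $dV^2=2V^2\,dU$ (`pd_VSq`).

Hence $dV=V\,dU$ for every vacuum potential $U$. This gives $\nabla dV=VR$ and, on a connected
domain, $e^U=cV$. Conversely, if $R=V^{-1}\nabla dV$ and $\operatorname{tr}R=0$, then $U=\ln
V+\text{const}$ solves the vacuum equations, and the conditions on $s$, $t$, $P$ give the type and
the class. -/

namespace StaticVacuum

/-! ### Partial derivatives and smoothness on open sets -/

section Calculus

variable {n : ℕ} {f g : (Fin n → ℝ) → ℝ} {x : Fin n → ℝ} {Ω : Set (Fin n → ℝ)}

theorem pd_congr (h : f =ᶠ[nhds x] g) (i : Fin n) : pd i f x = pd i g x := by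
  rw [pd, pd, h.fderiv_eq]

theorem pd_congr_on (hΩ : IsOpen Ω) (hx : x ∈ Ω) (h : ∀ y ∈ Ω, f y = g y) (i : Fin n) :
    pd i f x = pd i g x :=
  pd_congr (Filter.eventuallyEq_of_mem (hΩ.mem_nhds hx) h) i

theorem pd_const (i : Fin n) (c : ℝ) : pd i (fun _ => c) x = 0 := by
  simp [pd]

theorem pd_add (hf : DifferentiableAt ℝ f x) (hg : DifferentiableAt ℝ g x) (i : Fin n) :
    pd i (fun y => f y + g y) x = pd i f x + pd i g x := by
  simp [pd, fderiv_fun_add hf hg]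

theorem pd_sub (hf : DifferentiableAt ℝ f x) (hg : DifferentiableAt ℝ g x) (i : Fin n) :
    pd i (fun y => f y - g y) x = pd i f x - pd i g x := by
  simp [pd, fderiv_fun_sub hf hg]

theorem pd_mul (hf : DifferentiableAt ℝ f x) (hg : DifferentiableAt ℝ g x) (i : Fin n) :
    pd i (fun y => f y * g y) x = pd i f x * g x + f x * pd i g x := by
  simp [pd, fderiv_fun_mul hf hg]; ring

theorem pd_const_mul (c : ℝ) (hf : DifferentiableAt ℝ f x) (i : Fin n) :
    pd i (fun y => c * f y) x = c * pd i f x := by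
  simp [pd, fderiv_const_mul hf]

theorem pd_sum {ι : Type*} (s : Finset ι) {F : ι → (Fin n → ℝ) → ℝ}
    (hF : ∀ m ∈ s, DifferentiableAt ℝ (F m) x) (i : Fin n) :
    pd i (fun y => ∑ m ∈ s, F m y) x = ∑ m ∈ s, pd i (F m) x := by
  simp [pd, fderiv_fun_sum hF]

theorem pd_comp {φ : ℝ → ℝ} {φ' : ℝ} (hφ : HasDerivAt φ φ' (f x)) (hf : DifferentiableAt ℝ f x)
    (i : Fin n) : pd i (fun y => φ (f y)) x = φ' * pd i f x := by
  have := (hφ.comp_hasFDerivAt x hf.hasFDerivAt).fderiv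
  simp only [pd]
  change (fderiv ℝ (φ ∘ f) x) _ = _
  rw [this]; simp

theorem differentiableAt_of_smooth (hΩ : IsOpen Ω) (hf : ContDiffOn ℝ ∞ f Ω) (hx : x ∈ Ω) :
    DifferentiableAt ℝ f x :=
  (hf.differentiableOn (by simp)).differentiableAt (hΩ.mem_nhds hx)

theorem smooth_pd (hΩ : IsOpen Ω) (hf : ContDiffOn ℝ ∞ f Ω) (i : Fin n) :
    ContDiffOn ℝ ∞ (pd i f) Ω :=
  (hf.fderiv_of_isOpen hΩ (m := ∞) (by simp)).clm_apply contDiffOn_const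

theorem pd_comm (hΩ : IsOpen Ω) (hf : ContDiffOn ℝ ∞ f Ω) (hx : x ∈ Ω) (i j : Fin n) :
    pd i (pd j f) x = pd j (pd i f) x := by
  have hf' : DifferentiableAt ℝ (fderiv ℝ f) x :=
    ((hf.fderiv_of_isOpen hΩ (m := ∞) (by simp)).differentiableOn (by simp)).differentiableAt
      (hΩ.mem_nhds hx)
  have key : ∀ a b : Fin n, pd a (pd b f) x
      = fderiv ℝ (fderiv ℝ f) x (Pi.single a 1) (Pi.single b 1) := by
    intro a b
    have h1 : pd b f = fun y => fderiv ℝ f y (Pi.single b 1) := rfl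
    rw [h1, pd, fderiv_clm_apply hf' (differentiableAt_const _)]
    simp
  rw [key, key]
  exact ((hf.contDiffAt (hΩ.mem_nhds hx)).isSymmSndFDerivAt
    (by simp only [minSmoothness_of_isRCLikeNormedField]; exact WithTop.coe_le_coe.2 (le_top : (2 : ℕ∞) ≤ ⊤))) _ _

theorem smooth_det {m : ℕ} {M : (Fin n → ℝ) → Matrix (Fin m) (Fin m) ℝ}
    (hM : ∀ i j, ContDiffOn ℝ ∞ (fun y => M y i j) Ω) :
    ContDiffOn ℝ ∞ (fun y => (M y).det) Ω := by
  simp only [Matrix.det_apply]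
  refine ContDiffOn.sum fun σ _ => ContDiffOn.const_smul _ ?_
  exact contDiffOn_prod fun i _ => hM _ _

/-- Cramer's rule writes each entry as a quotient of two determinants, which are polynomial in the
entries of the matrix. -/
theorem smooth_inv {m : ℕ} {M : (Fin n → ℝ) → Matrix (Fin m) (Fin m) ℝ}
    (hM : ∀ i j, ContDiffOn ℝ ∞ (fun y => M y i j) Ω) (hdet : ∀ y ∈ Ω, (M y).det ≠ 0)
    (i j : Fin m) : ContDiffOn ℝ ∞ (fun y => (M y)⁻¹ i j) Ω := by
  have h1 : ∀ y, (M y)⁻¹ i j = (M y).det⁻¹ * ((M y).updateRow j (Pi.single i 1)).det := by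
    intro y
    rw [Matrix.inv_def, Matrix.smul_apply, Matrix.adjugate_apply, Ring.inverse_eq_inv', smul_eq_mul]
  simp only [h1]
  refine ((smooth_det hM).inv hdet).mul (smooth_det fun a b => ?_)
  by_cases h : a = j
  · subst h; simpa using contDiffOn_const
  · simpa [Matrix.updateRow_ne h] using hM a b

end Calculus

/-! ### Symmetries of the curvature of a Riemannian metric -/

section Metric

variable {n : ℕ} {g : (Fin n → ℝ) → Matrix (Fin n) (Fin n) ℝ} {x : Fin n → ℝ}
  {Ω : Set (Fin n → ℝ)}

namespace IsRiemannianMetricOn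

theorem det_ne_zero (hg : IsRiemannianMetricOn g Ω) (hx : x ∈ Ω) : (g x).det ≠ 0 :=
  (hg.posDef x hx).det_pos.ne'

theorem symm (hg : IsRiemannianMetricOn g Ω) (hx : x ∈ Ω) (i j : Fin n) : g x i j = g x j i := by
  simpa using (hg.posDef x hx).isHermitian.apply j i

theorem inv_symm (hg : IsRiemannianMetricOn g Ω) (hx : x ∈ Ω) (i j : Fin n) :
    (g x)⁻¹ i j = (g x)⁻¹ j i := by
  simpa using (hg.posDef x hx).inv.isHermitian.apply j i

theorem mul_inv (hg : IsRiemannianMetricOn g Ω) (hx : x ∈ Ω) : g x * (g x)⁻¹ = 1 :=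
  Matrix.mul_nonsing_inv _ (hg.det_ne_zero hx).isUnit

theorem inv_mul (hg : IsRiemannianMetricOn g Ω) (hx : x ∈ Ω) : (g x)⁻¹ * g x = 1 :=
  Matrix.nonsing_inv_mul _ (hg.det_ne_zero hx).isUnit

theorem smooth_inverse (hg : IsRiemannianMetricOn g Ω) (i j : Fin n) :
    ContDiffOn ℝ ∞ (fun y => (g y)⁻¹ i j) Ω :=
  smooth_inv hg.smooth (fun _ hy => hg.det_ne_zero hy) i j

theorem smooth_christoffel (hΩ : IsOpen Ω) (hg : IsRiemannianMetricOn g Ω) (k i j : Fin n) :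
    ContDiffOn ℝ ∞ (christoffel g k i j) Ω := by
  unfold christoffel
  refine contDiffOn_const.mul (ContDiffOn.sum fun l _ => (hg.smooth_inverse k l).mul ?_)
  exact ((smooth_pd hΩ (hg.smooth _ _) _).add (smooth_pd hΩ (hg.smooth _ _) _)).sub
    (smooth_pd hΩ (hg.smooth _ _) _)

theorem smooth_riemann (hΩ : IsOpen Ω) (hg : IsRiemannianMetricOn g Ω) (k l i j : Fin n) :
    ContDiffOn ℝ ∞ (riemann g k l i j) Ω := by
  unfold riemann
  have hc := hg.smooth_christoffel hΩ
  exact ((smooth_pd hΩ (hc _ _ _) _).sub (smooth_pd hΩ (hc _ _ _) _)).add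
    (ContDiffOn.sum fun m _ => ((hc _ _ _).mul (hc _ _ _)).sub ((hc _ _ _).mul (hc _ _ _)))

theorem smooth_ricci (hΩ : IsOpen Ω) (hg : IsRiemannianMetricOn g Ω) (i j : Fin n) :
    ContDiffOn ℝ ∞ (fun y => ricci g y i j) Ω := by
  simp only [ricci, Matrix.of_apply]
  exact ContDiffOn.sum fun k _ => hg.smooth_riemann hΩ k i k j

theorem christoffel_symm (hΩ : IsOpen Ω) (hg : IsRiemannianMetricOn g Ω) (hx : x ∈ Ω)
    (k i j : Fin n) : christoffel g k i j x = christoffel g k j i x := by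
  unfold christoffel
  congr 1
  refine Finset.sum_congr rfl fun l _ => ?_
  rw [pd_congr_on hΩ hx (fun y hy => hg.symm hy i j) l]
  ring

/-- The Christoffel symbols with all indices down. -/
theorem sum_metric_christoffel (hg : IsRiemannianMetricOn g Ω) (hx : x ∈ Ω) (l i j : Fin n) :
    ∑ m, g x l m * christoffel g m i j x
      = (1 / 2 : ℝ) * (pd i (fun y => g y j l) x + pd j (fun y => g y i l) x
          - pd l (fun y => g y i j) x) := by
  set F : Fin n → ℝ := fun p => (1 / 2 : ℝ) * (pd i (fun y => g y j p) x
    + pd j (fun y => g y i p) x - pd p (fun y => g y i j) x) with hF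
  have h1 : (fun m => christoffel g m i j x) = (g x)⁻¹ *ᵥ F := by
    funext m
    simp only [christoffel, Matrix.mulVec, dotProduct, hF, Finset.mul_sum]
    exact Finset.sum_congr rfl fun p _ => by ring
  have h2 : g x *ᵥ (fun m => christoffel g m i j x) = F := by
    rw [h1, Matrix.mulVec_mulVec, hg.mul_inv hx, Matrix.one_mulVec]
  exact congrFun h2 l

/-- This is $\nabla g=0$ in coordinates. In the sum of two lowered Christoffel symbols all
derivatives of the metric cancel except the one wanted. -/
theorem pd_metric (hΩ : IsOpen Ω) (hg : IsRiemannianMetricOn g Ω) (hx : x ∈ Ω) (k i j : Fin n) :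
    pd k (fun y => g y i j) x
      = ∑ m, (christoffel g m k i x * g x m j + christoffel g m k j x * g x i m) := by
  have h1 := hg.sum_metric_christoffel hx j k i
  have h2 := hg.sum_metric_christoffel hx i k j
  have h3 := pd_congr_on hΩ hx (fun y hy => hg.symm hy i j) k
  rw [Finset.sum_add_distrib]
  have e1 : ∑ m, christoffel g m k i x * g x m j = ∑ m, g x j m * christoffel g m k i x :=
    Finset.sum_congr rfl fun m _ => by rw [hg.symm hx j m]; ring
  have e2 : ∑ m, christoffel g m k j x * g x i m = ∑ m, g x i m * christoffel g m k j x :=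
    Finset.sum_congr rfl fun m _ => by ring
  rw [e1, e2, h1, h2]
  linarith

theorem riemann_antisymm (k l i j : Fin n) : riemann g k l i j x = -riemann g k l j i x := by
  simp only [riemann, Finset.sum_sub_distrib]; ring

theorem riemann_bianchi (hΩ : IsOpen Ω) (hg : IsRiemannianMetricOn g Ω) (hx : x ∈ Ω)
    (k l i j : Fin n) :
    riemann g k l i j x + riemann g k i j l x + riemann g k j l i x = 0 := by
  have hs : ∀ a b c d : Fin n, pd d (christoffel g a b c) x = pd d (christoffel g a c b) x :=
    fun a b c d => pd_congr_on hΩ hx (fun y hy => hg.christoffel_symm hΩ hy a b c) d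
  have hc := hg.christoffel_symm hΩ hx
  simp only [riemann, Finset.sum_sub_distrib]
  rw [hs k j l i, hs k i l j, hs k j i l]
  simp only [fun m => hc m j l, fun m => hc m i l, fun m => hc m j i]
  ring

theorem riemannLow_antisymm_right (k l i j : Fin n) :
    riemannLow g k l i j x = -riemannLow g k l j i x := by
  simp only [riemannLow, ← Finset.sum_neg_distrib]
  exact Finset.sum_congr rfl fun m _ => by rw [riemann_antisymm m l i j]; ring

theorem riemannLow_bianchi (hΩ : IsOpen Ω) (hg : IsRiemannianMetricOn g Ω) (hx : x ∈ Ω)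
    (k l i j : Fin n) :
    riemannLow g k l i j x + riemannLow g k i j l x + riemannLow g k j l i x = 0 := by
  simp only [riemannLow, ← Finset.sum_add_distrib, ← mul_add]
  exact Finset.sum_eq_zero fun m _ => by rw [hg.riemann_bianchi hΩ hx m l i j, mul_zero]

/-- The antisymmetry is the commutation of the second partial derivatives of $g_{kl}$, once these
are expanded by $\nabla g=0$. -/
theorem riemannLow_antisymm_left (hΩ : IsOpen Ω) (hg : IsRiemannianMetricOn g Ω) (hx : x ∈ Ω)
    (k l i j : Fin n) : riemannLow g k l i j x = -riemannLow g l k i j x := by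
  have hdc : ∀ a b c, DifferentiableAt ℝ (christoffel g a b c) x := fun a b c =>
    differentiableAt_of_smooth hΩ (hg.smooth_christoffel hΩ a b c) hx
  have hdg : ∀ a b, DifferentiableAt ℝ (fun y => g y a b) x := fun a b =>
    differentiableAt_of_smooth hΩ (hg.smooth a b) hx
  have key : ∀ a b : Fin n, pd a (pd b (fun y => g y k l)) x
      = ∑ m, (pd a (christoffel g m b k) x * g x m l + pd a (christoffel g m b l) x * g x k m)
        + ∑ m, ∑ p, (christoffel g m b k x * (christoffel g p a m x * g x p l
              + christoffel g p a l x * g x m p)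
            + christoffel g m b l x * (christoffel g p a k x * g x p m
              + christoffel g p a m x * g x k p)) := by
    intro a b
    have hd : ∀ m ∈ Finset.univ, DifferentiableAt ℝ (fun y => christoffel g m b k y * g y m l
        + christoffel g m b l y * g y k m) x :=
      fun m _ => ((hdc _ _ _).mul (hdg _ _)).add ((hdc _ _ _).mul (hdg _ _))
    rw [pd_congr_on hΩ hx (fun y hy => hg.pd_metric hΩ hy b k l) a, pd_sum _ hd,
      ← Finset.sum_add_distrib]
    refine Finset.sum_congr rfl fun m _ => ?_
    rw [pd_add ((hdc _ _ _).fun_mul (hdg _ _)) ((hdc _ _ _).fun_mul (hdg _ _)),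
      pd_mul (hdc _ _ _) (hdg _ _), pd_mul (hdc _ _ _) (hdg _ _), hg.pd_metric hΩ hx a m l,
      hg.pd_metric hΩ hx a k m]
    simp only [mul_add, Finset.sum_add_distrib, Finset.mul_sum]
    ring
  have hcomm := pd_comm hΩ (hg.smooth k l) hx i j
  rw [key i j, key j i] at hcomm
  have low : ∀ a b : Fin n, riemannLow g a b i j x
      = ∑ m, (pd i (christoffel g m j b) x * g x m a - pd j (christoffel g m i b) x * g x m a)
        + ∑ m, ∑ p, (christoffel g m j b x * (christoffel g p i m x * g x p a)
            - christoffel g m i b x * (christoffel g p j m x * g x p a)) := by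
    intro a b
    rw [Finset.sum_comm (f := fun m p => christoffel g m j b x * (christoffel g p i m x * g x p a)
            - christoffel g m i b x * (christoffel g p j m x * g x p a)),
      ← Finset.sum_add_distrib]
    simp only [riemannLow, riemann]
    refine Finset.sum_congr rfl fun m _ => ?_
    rw [mul_add, Finset.mul_sum, hg.symm hx m a]
    congr 1
    · ring
    · exact Finset.sum_congr rfl fun p _ => by ring
  rw [low k l, low l k]
  -- The cross terms, with one Christoffel symbol acting on $k$ and one on $l$, occur in both orders
  -- of differentiation and differ only in the naming of the summation indices.
  have sw : ∑ m, ∑ p, christoffel g m j k x * (christoffel g p i l x * g x m p)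
      = ∑ m, ∑ p, christoffel g m i l x * (christoffel g p j k x * g x p m) := by
    rw [Finset.sum_comm]
    exact Finset.sum_congr rfl fun m _ => Finset.sum_congr rfl fun p _ => by ring
  have sw' : ∑ m, ∑ p, christoffel g m i k x * (christoffel g p j l x * g x m p)
      = ∑ m, ∑ p, christoffel g m j l x * (christoffel g p i k x * g x p m) := by
    rw [Finset.sum_comm]
    exact Finset.sum_congr rfl fun m _ => Finset.sum_congr rfl fun p _ => by ring
  simp only [mul_add, Finset.sum_add_distrib, Finset.sum_sub_distrib] at hcomm ⊢
  simp only [fun m => hg.symm hx k m] at hcomm ⊢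
  linarith

/-- The octahedron argument: four first Bianchi identities, combined through the two antisymmetries.
-/
theorem riemannLow_pair_symm (hΩ : IsOpen Ω) (hg : IsRiemannianMetricOn g Ω) (hx : x ∈ Ω)
    (k l i j : Fin n) : riemannLow g k l i j x = riemannLow g i j k l x := by
  have hb := hg.riemannLow_bianchi hΩ hx
  have ha := hg.riemannLow_antisymm_left hΩ hx
  have hr := fun a b c d => riemannLow_antisymm_right (g := g) (x := x) a b c d
  linarith [hb k l i j, hb l k i j, hb i j k l, hb j i k l, ha k l i j, ha i j k l,
    ha k i j l, ha k j l i, ha l i j k, ha l j k i, hr k i j l, hr i k j l, hr k j l i,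
    hr j k l i, hr l i k j, hr l j i k, hr l i j k, hr l j k i, hr i l j k, hr j l k i,
    hr i k l j, hr i l k j, hr j k i l, hr j l i k, ha i k l j, ha i l j k, ha j k l i, ha j l i k]

theorem riemann_eq_sum_low (hg : IsRiemannianMetricOn g Ω) (hx : x ∈ Ω) (k l i j : Fin n) :
    riemann g k l i j x = ∑ m, (g x)⁻¹ k m * riemannLow g m l i j x := by
  have h : (fun m => riemannLow g m l i j x) = g x *ᵥ (fun m => riemann g m l i j x) := by
    funext m; simp [riemannLow, Matrix.mulVec, dotProduct]
  have h2 : (g x)⁻¹ *ᵥ (fun m => riemannLow g m l i j x) = fun m => riemann g m l i j x := by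
    rw [h, Matrix.mulVec_mulVec, hg.inv_mul hx, Matrix.one_mulVec]
  exact (congrFun h2 k).symm

theorem ricci_eq_sum_low (hg : IsRiemannianMetricOn g Ω) (hx : x ∈ Ω) (i j : Fin n) :
    ricci g x i j = ∑ k, ∑ m, (g x)⁻¹ k m * riemannLow g m i k j x := by
  simp only [ricci, Matrix.of_apply]
  exact Finset.sum_congr rfl fun k _ => hg.riemann_eq_sum_low hx k i k j

theorem ricci_symm (hΩ : IsOpen Ω) (hg : IsRiemannianMetricOn g Ω) (hx : x ∈ Ω) (i j : Fin n) :
    ricci g x i j = ricci g x j i := by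
  rw [hg.ricci_eq_sum_low hx, hg.ricci_eq_sum_low hx, Finset.sum_comm]
  refine Finset.sum_congr rfl fun k _ => Finset.sum_congr rfl fun m _ => ?_
  rw [hg.inv_symm hx, hg.riemannLow_pair_symm hΩ hx]

end IsRiemannianMetricOn

end Metric

/-! ### Covariant derivatives and the Ricci identity -/

section Covariant

variable {n : ℕ}

/-- The covariant derivative `∇ₖ wᵢ` of a covector field. -/
noncomputable def cov (g : (Fin n → ℝ) → Matrix (Fin n) (Fin n) ℝ) (w : Fin n → (Fin n → ℝ) → ℝ)
    (k i : Fin n) (x : Fin n → ℝ) : ℝ :=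
  pd k (w i) x - ∑ m, christoffel g m k i x * w m x

/-- The covariant derivative `∇ₖ Tⱼᵢ` of a covariant two-tensor field. -/
noncomputable def cov2 (g : (Fin n → ℝ) → Matrix (Fin n) (Fin n) ℝ) (T : Fin n → Fin n → (Fin n → ℝ) → ℝ)
    (k j i : Fin n) (x : Fin n → ℝ) : ℝ :=
  pd k (T j i) x - ∑ m, (christoffel g m k j x * T m i x + christoffel g m k i x * T j m x)

variable {g : (Fin n → ℝ) → Matrix (Fin n) (Fin n) ℝ} {x : Fin n → ℝ} {Ω : Set (Fin n → ℝ)}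

theorem cov2_congr_on (hΩ : IsOpen Ω) (hx : x ∈ Ω) {T T' : Fin n → Fin n → (Fin n → ℝ) → ℝ}
    (h : ∀ j i, ∀ y ∈ Ω, T j i y = T' j i y) (k j i : Fin n) :
    cov2 g T k j i x = cov2 g T' k j i x := by
  simp only [cov2]
  rw [pd_congr_on hΩ hx (h j i) k]
  simp only [fun a b => h a b x hx]

theorem cov2_add {T T' : Fin n → Fin n → (Fin n → ℝ) → ℝ}
    (hT : ∀ j i, DifferentiableAt ℝ (T j i) x) (hT' : ∀ j i, DifferentiableAt ℝ (T' j i) x)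
    (k j i : Fin n) :
    cov2 g (fun j i y => T j i y + T' j i y) k j i x = cov2 g T k j i x + cov2 g T' k j i x := by
  simp only [cov2]
  rw [pd_add (hT j i) (hT' j i)]
  simp only [mul_add, Finset.sum_add_distrib]
  ring

/-- The Leibniz rule. With `cov2_add` and `IsRiemannianMetricOn.cov2_metric` it differentiates all
two-tensors needed below, which are sums of terms $f\gamma$ and $f\,a\otimes b$. -/
theorem cov2_outer {f : (Fin n → ℝ) → ℝ} {a b : Fin n → (Fin n → ℝ) → ℝ}
    (hf : DifferentiableAt ℝ f x) (ha : ∀ i, DifferentiableAt ℝ (a i) x)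
    (hb : ∀ i, DifferentiableAt ℝ (b i) x) (k j i : Fin n) :
    cov2 g (fun j i y => f y * (a j y * b i y)) k j i x
      = pd k f x * (a j x * b i x) + f x * (cov g a k j x * b i x + a j x * cov g b k i x) := by
  simp only [cov2, cov]
  rw [pd_mul hf ((ha j).fun_mul (hb i)), pd_mul (ha j) (hb i)]
  simp only [Finset.sum_add_distrib, sub_mul, mul_sub, mul_add, Finset.mul_sum, Finset.sum_mul]
  have e1 : ∑ m, christoffel g m k j x * (f x * (a m x * b i x))
      = ∑ m, f x * (christoffel g m k j x * a m x * b i x) :=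
    Finset.sum_congr rfl fun m _ => by ring
  have e2 : ∑ m, christoffel g m k i x * (f x * (a j x * b m x))
      = ∑ m, f x * (a j x * (christoffel g m k i x * b m x)) :=
    Finset.sum_congr rfl fun m _ => by ring
  rw [e1, e2]
  ring

theorem IsRiemannianMetricOn.cov2_metric (hΩ : IsOpen Ω) (hg : IsRiemannianMetricOn g Ω)
    (hx : x ∈ Ω) {f : (Fin n → ℝ) → ℝ} (hf : DifferentiableAt ℝ f x) (k j i : Fin n) :
    cov2 g (fun j i y => f y * g y j i) k j i x = pd k f x * g x j i := by
  simp only [cov2]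
  rw [pd_mul hf (differentiableAt_of_smooth hΩ (hg.smooth j i) hx), hg.pd_metric hΩ hx,
    Finset.mul_sum]
  have e : ∑ m, (christoffel g m k j x * (f x * g x m i) + christoffel g m k i x * (f x * g x j m))
      = ∑ m, f x * (christoffel g m k j x * g x m i + christoffel g m k i x * g x j m) :=
    Finset.sum_congr rfl fun m _ => by ring
  rw [e]; ring

/-- The Ricci identity for covector fields. -/
theorem IsRiemannianMetricOn.ricci_identity (hΩ : IsOpen Ω) (hg : IsRiemannianMetricOn g Ω)
    (hx : x ∈ Ω) {w : Fin n → (Fin n → ℝ) → ℝ} (hw : ∀ i, ContDiffOn ℝ ∞ (w i) Ω)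
    (k j i : Fin n) :
    cov2 g (cov g w) k j i x - cov2 g (cov g w) j k i x = -∑ m, riemann g m i k j x * w m x := by
  have hdc : ∀ a b c, DifferentiableAt ℝ (christoffel g a b c) x := fun a b c =>
    differentiableAt_of_smooth hΩ (hg.smooth_christoffel hΩ a b c) hx
  have hdw : ∀ a, DifferentiableAt ℝ (w a) x := fun a =>
    differentiableAt_of_smooth hΩ (hw a) hx
  have hdp : ∀ a b, DifferentiableAt ℝ (pd b (w a)) x := fun a b =>
    differentiableAt_of_smooth hΩ (smooth_pd hΩ (hw a) b) hx
  have key : ∀ a b : Fin n, pd a (cov g w b i) x = pd a (pd b (w i)) x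
      - ∑ m, (pd a (christoffel g m b i) x * w m x + christoffel g m b i x * pd a (w m) x) := by
    intro a b
    have h1 : cov g w b i = fun y => pd b (w i) y - ∑ m, christoffel g m b i y * w m y := rfl
    rw [h1, pd_sub (hdp i b) (DifferentiableAt.fun_sum fun m _ => (hdc m b i).fun_mul (hdw m)),
      pd_sum _ (fun m _ => (hdc m b i).fun_mul (hdw m))]
    congr 1
    exact Finset.sum_congr rfl fun m _ => pd_mul (hdc m b i) (hdw m) a
  simp only [cov2, key, pd_comm hΩ (hw i) hx k j, fun m => hg.christoffel_symm hΩ hx m j k, cov,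
    riemann, Finset.sum_add_distrib, mul_sub, Finset.mul_sum, Finset.sum_sub_distrib, add_mul,
    sub_mul, Finset.sum_mul]
  have e1 : ∀ a b : Fin n, ∑ m, ∑ p, christoffel g m a i x * (christoffel g p b m x * w p x)
      = ∑ m, ∑ p, christoffel g m b p x * christoffel g p a i x * w m x := by
    intro a b
    rw [Finset.sum_comm]
    exact Finset.sum_congr rfl fun m _ => Finset.sum_congr rfl fun p _ => by ring
  rw [e1, e1]
  ring

theorem IsRiemannianMetricOn.mono {Ω' : Set (Fin n → ℝ)} (hg : IsRiemannianMetricOn g Ω)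
    (h : Ω' ⊆ Ω) : IsRiemannianMetricOn g Ω' :=
  ⟨fun i j => (hg.smooth i j).mono h, fun y hy => hg.posDef y (h hy)⟩

end Covariant

/-! ### Curvature in dimension three -/

section Dimension3

theorem eq_zero_of_antisymm {T : Fin 3 → Fin 3 → ℝ} (h : ∀ i j, T i j = -T j i)
    (h01 : T 0 1 = 0) (h02 : T 0 2 = 0) (h12 : T 1 2 = 0) (i j : Fin 3) : T i j = 0 := by
  fin_cases i <;> fin_cases j <;> simp only [Fin.zero_eta, Fin.mk_one, Fin.reduceFinMk]
  · linarith [h 0 0]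
  · exact h01
  · exact h02
  · linarith [h 1 0]
  · linarith [h 1 1]
  · exact h12
  · linarith [h 2 0]
  · linarith [h 2 1]
  · linarith [h 2 2]

/-- In dimension three an algebraic curvature tensor with vanishing scalar curvature is determined
by its Ricci tensor. -/
theorem algebraic_curvature_dim_three {g H : Matrix (Fin 3) (Fin 3) ℝ}
    {R : Fin 3 → Fin 3 → Fin 3 → Fin 3 → ℝ} {Ric : Fin 3 → Fin 3 → ℝ}
    (hH : ∀ i j, H i j = H j i) (hdet : H.det ≠ 0) (hg : ∀ i j, H.adjugate i j = H.det * g i j)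
    (h1 : ∀ k l i j, R k l i j = -R l k i j) (h2 : ∀ k l i j, R k l i j = -R k l j i)
    (h3 : ∀ k l i j, R k l i j = R i j k l)
    (hRic : ∀ i j, Ric i j = ∑ k, ∑ m, H k m * R m i k j)
    (hS : ∑ i, ∑ j, H i j * Ric i j = 0) (k l i j : Fin 3) :
    R k l i j = g k i * Ric l j - g k j * Ric l i + g l j * Ric k i - g l i * Ric k j := by
  have z1 : ∀ a b c, R a a b c = 0 := fun a b c => by linarith [h1 a a b c]
  have z2 : ∀ a b c, R a b c c = 0 := fun a b c => by linarith [h2 a b c c]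
  have a1 : ∀ b c, R 1 0 b c = -R 0 1 b c := fun b c => h1 1 0 b c
  have a2 : ∀ b c, R 2 0 b c = -R 0 2 b c := fun b c => h1 2 0 b c
  have a3 : ∀ b c, R 2 1 b c = -R 1 2 b c := fun b c => h1 2 1 b c
  have b1 : ∀ b c, R b c 1 0 = -R b c 0 1 := fun b c => h2 b c 1 0
  have b2 : ∀ b c, R b c 2 0 = -R b c 0 2 := fun b c => h2 b c 2 0
  have b3 : ∀ b c, R b c 2 1 = -R b c 1 2 := fun b c => h2 b c 2 1
  have c1 : R 0 2 0 1 = R 0 1 0 2 := h3 _ _ _ _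
  have c2 : R 1 2 0 1 = R 0 1 1 2 := h3 _ _ _ _
  have c3 : R 1 2 0 2 = R 0 2 1 2 := h3 _ _ _ _
  have H1 : H 1 0 = H 0 1 := hH _ _
  have H2 : H 2 0 = H 0 2 := hH _ _
  have H3 : H 2 1 = H 1 2 := hH _ _
  simp only [hRic, Fin.sum_univ_three, z1, z2, a1, a2, a3, b1, b2, b3, c1, c2, c3, H1, H2, H3]
    at hS
  -- `T` is the defect of the formula multiplied by $\det H$. With the adjugate of $H$ in place of
  -- $g$ it is polynomial in $H$ and $R$.
  obtain ⟨T, hT⟩ : ∃ T : Fin 3 → Fin 3 → Fin 3 → Fin 3 → ℝ, ∀ k l i j, T k l i j =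
      H.det * R k l i j - (H.adjugate k i * Ric l j - H.adjugate k j * Ric l i
        + H.adjugate l j * Ric k i - H.adjugate l i * Ric k j) := ⟨_, fun _ _ _ _ => rfl⟩
  have t1 : ∀ k l i j, T k l i j = -T l k i j := fun k l i j => by
    rw [hT, hT, h1 k l i j]; ring
  have t2 : ∀ k l i j, T k l i j = -T k l j i := fun k l i j => by
    rw [hT, hT, h2 k l i j]; ring
  suffices hT0 : T k l i j = 0 by
    have := hT k l i j
    simp only [hg] at this
    apply mul_left_cancel₀ hdet
    linarith
  refine eq_zero_of_antisymm (T := T k l) (t2 k l) ?_ ?_ ?_ i j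
  · refine eq_zero_of_antisymm (T := fun k l => T k l 0 1) (fun i j => t1 i j 0 1) ?_ ?_ ?_ k l <;>
    simp only [hT, hRic, Fin.sum_univ_three, Matrix.adjugate_fin_three, Matrix.det_fin_three,
        Matrix.of_apply, Matrix.cons_val, z1, z2, a1, a2, a3, b1, b2, b3,
        c1, c2, c3, H1, H2, H3]
    -- Without the assumption on the scalar curvature $S$ the formula has the further term $-\tfrac
    -- S2(g_{ki}g_{lj}-g_{kj}g_{li})$. The two-rowed minors of the adjugate are $\pm\det H$ times
    -- entries of $H$, so each component of `T` is $\mp\tfrac S2$ times one entry of $H$.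
    · linear_combination (-H 2 2 / 2) * hS
    · linear_combination (H 1 2 / 2) * hS
    · linear_combination (-H 0 2 / 2) * hS
  · refine eq_zero_of_antisymm (T := fun k l => T k l 0 2) (fun i j => t1 i j 0 2) ?_ ?_ ?_ k l <;>
    simp only [hT, hRic, Fin.sum_univ_three, Matrix.adjugate_fin_three, Matrix.det_fin_three,
        Matrix.of_apply, Matrix.cons_val, z1, z2, a1, a2, a3, b1, b2,
        c1, c2, c3, H1, H2, H3]
    · linear_combination (H 1 2 / 2) * hS
    · linear_combination (-H 1 1 / 2) * hS
    · linear_combination (H 0 1 / 2) * hS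
  · refine eq_zero_of_antisymm (T := fun k l => T k l 1 2) (fun i j => t1 i j 1 2) ?_ ?_ ?_ k l <;>
    simp only [hT, hRic, Fin.sum_univ_three, Matrix.adjugate_fin_three, Matrix.det_fin_three,
        Matrix.of_apply, Matrix.cons_val, z1, z2, a1, a2, a3, b3,
        c1, c2, c3, H1, H2, H3]
    · linear_combination (-H 0 2 / 2) * hS
    · linear_combination (H 0 1 / 2) * hS
    · linear_combination (-H 0 0 / 2) * hS

theorem IsRiemannianMetricOn.riemannLow_dim_three {Ω : Set (Fin 3 → ℝ)}
    {γ : (Fin 3 → ℝ) → Matrix (Fin 3) (Fin 3) ℝ} {x : Fin 3 → ℝ} (hΩ : IsOpen Ω)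
    (hγ : IsRiemannianMetricOn γ Ω) (hx : x ∈ Ω) (htr : (ricciEndo γ x).trace = 0)
    (k l i j : Fin 3) :
    riemannLow γ k l i j x = γ x k i * ricci γ x l j - γ x k j * ricci γ x l i
      + γ x l j * ricci γ x k i - γ x l i * ricci γ x k j := by
  have hdet : ((γ x)⁻¹).det ≠ 0 := (hγ.posDef x hx).inv.det_pos.ne'
  refine algebraic_curvature_dim_three (R := fun a b c d => riemannLow γ a b c d x)
    (H := (γ x)⁻¹) (hγ.inv_symm hx) hdet ?_ (hγ.riemannLow_antisymm_left hΩ hx)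
    riemannLow_antisymm_right (hγ.riemannLow_pair_symm hΩ hx)
    (fun i j => hγ.ricci_eq_sum_low hx i j) ?_ k l i j
  · intro i j
    have h := Matrix.nonsing_inv_nonsing_inv (γ x) (hγ.det_ne_zero hx).isUnit
    rw [Matrix.inv_def (γ x)⁻¹, Ring.inverse_eq_inv'] at h
    have h2 := congrFun (congrFun h i) j
    rw [Matrix.smul_apply, smul_eq_mul] at h2
    rw [← h2, mul_inv_cancel_left₀ hdet]
  · rw [← htr, ricciEndo, Matrix.trace]
    refine Finset.sum_congr rfl fun i _ => ?_
    rw [Matrix.diag_apply, Matrix.mul_apply]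
    exact Finset.sum_congr rfl fun j _ => by rw [hγ.ricci_symm hΩ hx i j]

end Dimension3

/-! ### The static metric and functions of the spatial coordinates -/

section StaticMetric

variable {γ : (Fin 3 → ℝ) → Matrix (Fin 3) (Fin 3) ℝ} {U : (Fin 3 → ℝ) → ℝ} {Ω : Set (Fin 3 → ℝ)}
  {X : Fin 4 → ℝ}

/-- The projection of an event to its spatial coordinates, as a continuous linear map. -/
noncomputable def spaceCLM : (Fin 4 → ℝ) →L[ℝ] (Fin 3 → ℝ) :=
  ContinuousLinearMap.pi fun i => ContinuousLinearMap.proj i.succ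

theorem continuous_space : Continuous space := spaceCLM.continuous

theorem space_single_zero (c : ℝ) : space (Pi.single 0 c) = 0 := by
  funext i; simp [space]

theorem space_single_succ (i : Fin 3) (c : ℝ) :
    space (Pi.single i.succ c) = Pi.single i c := by
  funext j
  by_cases h : j = i
  · subst h; simp [space]
  · have : j.succ ≠ i.succ := fun h' => h (Fin.succ_injective _ h')
    simp [space, h, this]

theorem fderiv_comp_space {F : Type*} [NormedAddCommGroup F] [NormedSpace ℝ F]
    {f : (Fin 3 → ℝ) → F} (hf : DifferentiableAt ℝ f (space X)) (v : Fin 4 → ℝ) :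
    fderiv ℝ (fun Y => f (space Y)) X v = fderiv ℝ f (space X) (space v) := by
  have h : HasFDerivAt (fun Y => f (space Y)) ((fderiv ℝ f (space X)).comp spaceCLM) X :=
    HasFDerivAt.comp (f := fun Y => space Y) X hf.hasFDerivAt spaceCLM.hasFDerivAt
  rw [h.fderiv]; rfl

theorem pd_zero_comp_space {f : (Fin 3 → ℝ) → ℝ} (hf : DifferentiableAt ℝ f (space X)) :
    pd 0 (fun Y : Fin 4 → ℝ => f (space Y)) X = 0 := by
  rw [pd, fderiv_comp_space hf, space_single_zero, map_zero]

theorem pd_succ_comp_space {f : (Fin 3 → ℝ) → ℝ} (hf : DifferentiableAt ℝ f (space X))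
    (i : Fin 3) : pd i.succ (fun Y : Fin 4 → ℝ => f (space Y)) X = pd i f (space X) := by
  rw [pd, fderiv_comp_space hf, space_single_succ]; rfl

theorem eventually_space_mem (hΩ : IsOpen Ω) (hX : space X ∈ Ω) :
    ∀ᶠ Y in nhds X, space Y ∈ Ω :=
  continuous_space.continuousAt.eventually (hΩ.mem_nhds hX)

/-- Nothing is known outside $\Omega$, so agreement with a function of space is required over
$\Omega$ only; openness makes this enough for derivatives. The time derivative is zero, which is the
source of all vanishing components below. -/
theorem pd_static (hΩ : IsOpen Ω) (hX : space X ∈ Ω) {F : (Fin 4 → ℝ) → ℝ}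
    {f : (Fin 3 → ℝ) → ℝ} (hF : ∀ Y, space Y ∈ Ω → F Y = f (space Y))
    (hf : ContDiffOn ℝ ∞ f Ω) (a : Fin 4) :
    pd a F X = Fin.cases 0 (fun i => pd i f (space X)) a := by
  have h : F =ᶠ[nhds X] fun Y => f (space Y) :=
    (eventually_space_mem hΩ hX).mono fun Y hY => hF Y hY
  rw [pd_congr h]
  have hd := differentiableAt_of_smooth hΩ hf hX
  cases a using Fin.cases with
  | zero => exact pd_zero_comp_space hd
  | succ i => exact pd_succ_comp_space hd i

theorem staticMetric_zero_zero : staticMetric γ U X 0 0 = -Real.exp (2 * U (space X)) := rfl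
theorem staticMetric_zero_succ (i : Fin 3) : staticMetric γ U X 0 i.succ = 0 := rfl
theorem staticMetric_succ_zero (i : Fin 3) : staticMetric γ U X i.succ 0 = 0 := rfl
theorem staticMetric_succ_succ (i j : Fin 3) :
    staticMetric γ U X i.succ j.succ = γ (space X) i j := rfl

theorem staticMetric_inv (hdet : (γ (space X)).det ≠ 0) :
    (staticMetric γ U X)⁻¹ = Matrix.of fun a b =>
      Fin.cases (Fin.cases (-Real.exp (-(2 * U (space X)))) (fun _ => 0) b)
        (fun i => Fin.cases 0 (fun j => (γ (space X))⁻¹ i j) b) a := by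
  apply Matrix.inv_eq_right_inv
  have h := Matrix.mul_nonsing_inv (γ (space X)) hdet.isUnit
  ext a b
  cases a using Fin.cases with
  | zero =>
    cases b using Fin.cases with
    | zero =>
      simp [Matrix.mul_apply, Fin.sum_univ_succ (n := 3), staticMetric, ← Real.exp_add]
    | succ j =>
      simp [Matrix.mul_apply, Fin.sum_univ_succ (n := 3), staticMetric, (Fin.succ_ne_zero j).symm]
  | succ i =>
    cases b using Fin.cases with
    | zero => simp [Matrix.mul_apply, Fin.sum_univ_succ (n := 3), staticMetric]
    | succ j =>
      have h2 := congrFun (congrFun h i) j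
      rw [Matrix.mul_apply] at h2
      rw [Matrix.mul_apply, Fin.sum_univ_succ]
      simpa [staticMetric, Matrix.one_apply] using h2

/-- The components `∂ᵢ U` with the index raised. -/
noncomputable def gradUp (γ : (Fin 3 → ℝ) → Matrix (Fin 3) (Fin 3) ℝ) (U : (Fin 3 → ℝ) → ℝ)
    (k : Fin 3) (x : Fin 3 → ℝ) : ℝ := ∑ l, (γ x)⁻¹ k l * pd l U x

/-- `∇dU + dU ⊗ dU`, which is `e^{-U} ∇d e^U`. -/
noncomputable def lapse (γ : (Fin 3 → ℝ) → Matrix (Fin 3) (Fin 3) ℝ) (U : (Fin 3 → ℝ) → ℝ)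
    (x : Fin 3 → ℝ) : Matrix (Fin 3) (Fin 3) ℝ :=
  Matrix.of fun i j => hessian γ U x i j + pd i U x * pd j U x


/-! ### Christoffel symbols of the static metric -/

theorem pd_staticMetric_zero_zero
    (hΩ : IsOpen Ω) (hU : ContDiffOn ℝ ∞ U Ω)
    (hX : space X ∈ Ω) (a : Fin 4) :
    pd a (fun Y => staticMetric γ U Y 0 0) X
      = Fin.cases 0 (fun i => -(2 * Real.exp (2 * U (space X)) * pd i U (space X))) a := by
  have hs : ContDiffOn ℝ ∞ (fun y => -Real.exp (2 * U y)) Ω :=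
    (contDiffOn_const.mul hU).exp.neg
  rw [pd_static hΩ hX (F := fun Y => staticMetric γ U Y 0 0)
    (f := fun y => -Real.exp (2 * U y)) (fun _ _ => rfl) hs]
  congr 1
  funext i
  have hd : HasDerivAt (fun t => -Real.exp (2 * t)) (-(2 * Real.exp (2 * U (space X))))
      (U (space X)) := by
    have := (((hasDerivAt_id (U (space X))).const_mul 2).exp).fun_neg
    simpa [mul_comm] using this
  rw [pd_comp hd (differentiableAt_of_smooth hΩ hU hX)]
  ring

theorem pd_staticMetric_succ_succ
    (hΩ : IsOpen Ω) (hγ : IsRiemannianMetricOn γ Ω) (hX : space X ∈ Ω) (a : Fin 4) (i j : Fin 3) :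
    pd a (fun Y => staticMetric γ U Y i.succ j.succ) X
      = Fin.cases 0 (fun k => pd k (fun y => γ y i j) (space X)) a :=
  pd_static hΩ hX (f := fun y => γ y i j) (fun _ _ => rfl) (hγ.smooth i j) a

theorem christoffel_static_000
    (hΩ : IsOpen Ω) (hγ : IsRiemannianMetricOn γ Ω) (hU : ContDiffOn ℝ ∞ U Ω)
    (hX : space X ∈ Ω) : christoffel (staticMetric γ U) 0 0 0 X = 0 := by
  simp only [christoffel, Fin.sum_univ_succ (n := 3), staticMetric_inv (hγ.det_ne_zero hX),
    Matrix.of_apply, Fin.cases_zero, Fin.cases_succ, pd_staticMetric_zero_zero hΩ hU hX]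
  simp

theorem christoffel_static_00s
    (hΩ : IsOpen Ω) (hγ : IsRiemannianMetricOn γ Ω) (hU : ContDiffOn ℝ ∞ U Ω)
    (hX : space X ∈ Ω) (i : Fin 3) :
    christoffel (staticMetric γ U) 0 0 i.succ X = pd i U (space X) := by
  simp only [christoffel, Fin.sum_univ_succ (n := 3), staticMetric_inv (hγ.det_ne_zero hX),
    Matrix.of_apply, Fin.cases_zero, Fin.cases_succ, pd_staticMetric_zero_zero hΩ hU hX,
    staticMetric_succ_zero, staticMetric_zero_succ, pd_const]
  rw [Real.exp_neg]
  have := (Real.exp_pos (2 * U (space X))).ne'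
  simp only [zero_mul, Finset.sum_const_zero]
  field_simp
  ring

theorem christoffel_static_0s0
    (hΩ : IsOpen Ω) (hγ : IsRiemannianMetricOn γ Ω) (hU : ContDiffOn ℝ ∞ U Ω)
    (hX : space X ∈ Ω) (i : Fin 3) :
    christoffel (staticMetric γ U) 0 i.succ 0 X = pd i U (space X) := by
  simp only [christoffel, Fin.sum_univ_succ (n := 3), staticMetric_inv (hγ.det_ne_zero hX),
    Matrix.of_apply, Fin.cases_zero, Fin.cases_succ, pd_staticMetric_zero_zero hΩ hU hX,
    staticMetric_succ_zero, staticMetric_zero_succ, pd_const]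
  rw [Real.exp_neg]
  have := (Real.exp_pos (2 * U (space X))).ne'
  simp only [zero_mul, Finset.sum_const_zero]
  field_simp
  ring

theorem christoffel_static_0ss
    (hΩ : IsOpen Ω) (hγ : IsRiemannianMetricOn γ Ω)
    (hX : space X ∈ Ω) (i j : Fin 3) :
    christoffel (staticMetric γ U) 0 i.succ j.succ X = 0 := by
  simp only [christoffel, Fin.sum_univ_succ (n := 3), staticMetric_inv (hγ.det_ne_zero hX),
    Matrix.of_apply, Fin.cases_zero, Fin.cases_succ, pd_staticMetric_succ_succ hΩ hγ hX,
    staticMetric_succ_zero, pd_const]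
  simp

theorem christoffel_static_s00
    (hΩ : IsOpen Ω) (hγ : IsRiemannianMetricOn γ Ω) (hU : ContDiffOn ℝ ∞ U Ω)
    (hX : space X ∈ Ω) (k : Fin 3) :
    christoffel (staticMetric γ U) k.succ 0 0 X
      = Real.exp (2 * U (space X)) * gradUp γ U k (space X) := by
  simp only [christoffel, Fin.sum_univ_succ (n := 3), staticMetric_inv (hγ.det_ne_zero hX),
    Matrix.of_apply, Fin.cases_zero, Fin.cases_succ, pd_staticMetric_zero_zero hΩ hU hX,
    staticMetric_zero_succ, pd_const, gradUp, Finset.mul_sum, zero_mul,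
    zero_add]
  exact Finset.sum_congr rfl fun l _ => by ring

theorem christoffel_static_s0s
    (hΩ : IsOpen Ω) (hγ : IsRiemannianMetricOn γ Ω)
    (hX : space X ∈ Ω) (k i : Fin 3) :
    christoffel (staticMetric γ U) k.succ 0 i.succ X = 0 := by
  simp only [christoffel, Fin.sum_univ_succ (n := 3), staticMetric_inv (hγ.det_ne_zero hX),
    Matrix.of_apply, Fin.cases_zero, Fin.cases_succ, pd_staticMetric_succ_succ hΩ hγ hX,
    staticMetric_succ_zero, staticMetric_zero_succ, pd_const]
  simp

theorem christoffel_static_ss0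
    (hΩ : IsOpen Ω) (hγ : IsRiemannianMetricOn γ Ω)
    (hX : space X ∈ Ω) (k i : Fin 3) :
    christoffel (staticMetric γ U) k.succ i.succ 0 X = 0 := by
  simp only [christoffel, Fin.sum_univ_succ (n := 3), staticMetric_inv (hγ.det_ne_zero hX),
    Matrix.of_apply, Fin.cases_zero, Fin.cases_succ, pd_staticMetric_succ_succ hΩ hγ hX,
    staticMetric_succ_zero, staticMetric_zero_succ, pd_const]
  simp

theorem christoffel_static_sss
    (hΩ : IsOpen Ω) (hγ : IsRiemannianMetricOn γ Ω)
    (hX : space X ∈ Ω) (k i j : Fin 3) :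
    christoffel (staticMetric γ U) k.succ i.succ j.succ X = christoffel γ k i j (space X) := by
  simp only [christoffel, Fin.sum_univ_succ (n := 3), staticMetric_inv (hγ.det_ne_zero hX),
    Matrix.of_apply, Fin.cases_zero, Fin.cases_succ, pd_staticMetric_succ_succ hΩ hγ hX,
    zero_mul, zero_add]


theorem smooth_gradUp
    (hΩ : IsOpen Ω) (hγ : IsRiemannianMetricOn γ Ω) (hU : ContDiffOn ℝ ∞ U Ω) (k : Fin 3) : ContDiffOn ℝ ∞ (gradUp γ U k) Ω :=
  ContDiffOn.sum fun l _ => (hγ.smooth_inverse k l).mul (smooth_pd hΩ hU l)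

theorem sum_metric_gradUp
    (hγ : IsRiemannianMetricOn γ Ω) {x : Fin 3 → ℝ} (hx : x ∈ Ω) (p : Fin 3) :
    ∑ k, γ x p k * gradUp γ U k x = pd p U x := by
  have h : (fun k => gradUp γ U k x) = (γ x)⁻¹ *ᵥ (fun l => pd l U x) := rfl
  have h2 : γ x *ᵥ (fun k => gradUp γ U k x) = fun l => pd l U x := by
    rw [h, Matrix.mulVec_mulVec, hγ.mul_inv hx, Matrix.one_mulVec]
  exact congrFun h2 p

/-- Lowering an index commutes with $\nabla$. The proof differentiates $\gamma_{pk}U^k=\partial_pU$,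
so that no derivative of the inverse metric has to be computed. -/
theorem sum_metric_cov_gradUp
    (hΩ : IsOpen Ω) (hγ : IsRiemannianMetricOn γ Ω) (hU : ContDiffOn ℝ ∞ U Ω) {x : Fin 3 → ℝ} (hx : x ∈ Ω) (p l : Fin 3) :
    ∑ k, γ x p k * (pd l (gradUp γ U k) x + ∑ m, christoffel γ k l m x * gradUp γ U m x)
      = hessian γ U x l p := by
  have hdg : ∀ a b, DifferentiableAt ℝ (fun y => γ y a b) x := fun a b =>
    differentiableAt_of_smooth hΩ (hγ.smooth a b) hx
  have hdU : ∀ k, DifferentiableAt ℝ (gradUp γ U k) x := fun k =>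
    differentiableAt_of_smooth hΩ (smooth_gradUp hΩ hγ hU k) hx
  have h1 : pd l (pd p U) x = ∑ k, (pd l (fun y => γ y p k) x * gradUp γ U k x
      + γ x p k * pd l (gradUp γ U k) x) := by
    rw [← pd_congr_on hΩ hx (fun y hy => sum_metric_gradUp hγ hy p) l,
      pd_sum _ fun k _ => (hdg p k).fun_mul (hdU k)]
    exact Finset.sum_congr rfl fun k _ => pd_mul (hdg p k) (hdU k) l
  simp only [hessian, Matrix.of_apply]
  rw [h1]
  simp only [hγ.pd_metric hΩ hx, Finset.sum_add_distrib, mul_add, add_mul, Finset.sum_mul,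
    Finset.mul_sum]
  have e1 : ∑ k, ∑ m, christoffel γ m l p x * γ x m k * gradUp γ U k x
      = ∑ m, christoffel γ m l p x * pd m U x := by
    rw [Finset.sum_comm]
    refine Finset.sum_congr rfl fun m _ => ?_
    rw [← sum_metric_gradUp hγ hx m, Finset.mul_sum]
    exact Finset.sum_congr rfl fun k _ => by ring
  have e2 : ∑ k, ∑ m, christoffel γ m l k x * γ x p m * gradUp γ U k x
      = ∑ k, ∑ m, γ x p k * (christoffel γ k l m x * gradUp γ U m x) := by
    rw [Finset.sum_comm]
    exact Finset.sum_congr rfl fun m _ => Finset.sum_congr rfl fun k _ => by ring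
  rw [e1, e2]; ring


/-! ### Curvature and Ricci tensor of the static metric -/

theorem pd_christoffel_static_000
    (hΩ : IsOpen Ω) (hγ : IsRiemannianMetricOn γ Ω) (hU : ContDiffOn ℝ ∞ U Ω)
    (hX : space X ∈ Ω) (a : Fin 4) :
    pd a (christoffel (staticMetric γ U) 0 0 0) X = 0 := by
  rw [pd_static hΩ hX (f := fun _ => 0)
    (fun _ hY => christoffel_static_000 hΩ hγ hU hY) contDiffOn_const]
  cases a using Fin.cases <;> simp [pd_const]

theorem pd_christoffel_static_0s0
    (hΩ : IsOpen Ω) (hγ : IsRiemannianMetricOn γ Ω) (hU : ContDiffOn ℝ ∞ U Ω)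
    (hX : space X ∈ Ω) (a : Fin 4) (i : Fin 3) :
    pd a (christoffel (staticMetric γ U) 0 i.succ 0) X
      = Fin.cases 0 (fun j => pd j (pd i U) (space X)) a :=
  pd_static hΩ hX (fun _ hY => christoffel_static_0s0 hΩ hγ hU hY i) (smooth_pd hΩ hU i) a

theorem pd_christoffel_static_00s
    (hΩ : IsOpen Ω) (hγ : IsRiemannianMetricOn γ Ω) (hU : ContDiffOn ℝ ∞ U Ω)
    (hX : space X ∈ Ω) (a : Fin 4) (i : Fin 3) :
    pd a (christoffel (staticMetric γ U) 0 0 i.succ) X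
      = Fin.cases 0 (fun j => pd j (pd i U) (space X)) a :=
  pd_static hΩ hX (fun _ hY => christoffel_static_00s hΩ hγ hU hY i) (smooth_pd hΩ hU i) a

theorem pd_christoffel_static_0ss
    (hΩ : IsOpen Ω) (hγ : IsRiemannianMetricOn γ Ω)
    (hX : space X ∈ Ω) (a : Fin 4) (i j : Fin 3) :
    pd a (christoffel (staticMetric γ U) 0 i.succ j.succ) X = 0 := by
  rw [pd_static hΩ hX (f := fun _ => 0)
    (fun _ hY => christoffel_static_0ss hΩ hγ hY i j) contDiffOn_const]
  cases a using Fin.cases <;> simp [pd_const]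

theorem pd_christoffel_static_s00
    (hΩ : IsOpen Ω) (hγ : IsRiemannianMetricOn γ Ω) (hU : ContDiffOn ℝ ∞ U Ω)
    (hX : space X ∈ Ω) (a : Fin 4) (k : Fin 3) :
    pd a (christoffel (staticMetric γ U) k.succ 0 0) X
      = Fin.cases 0 (fun l => Real.exp (2 * U (space X)) *
          (2 * pd l U (space X) * gradUp γ U k (space X) + pd l (gradUp γ U k) (space X))) a := by
  have hs := smooth_gradUp hΩ hγ hU k
  have he : ContDiffOn ℝ ∞ (fun y => Real.exp (2 * U y)) Ω := (contDiffOn_const.mul hU).exp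
  rw [pd_static hΩ hX (f := fun y => Real.exp (2 * U y) * gradUp γ U k y)
    (fun _ hY => christoffel_static_s00 hΩ hγ hU hY k) (he.mul hs)]
  congr 1
  funext l
  have hd : HasDerivAt (fun t => Real.exp (2 * t)) (2 * Real.exp (2 * U (space X)))
      (U (space X)) := by
    have := (((hasDerivAt_id (U (space X))).const_mul 2).exp)
    simpa [mul_comm] using this
  rw [pd_mul (differentiableAt_of_smooth hΩ he hX) (differentiableAt_of_smooth hΩ hs hX),
    pd_comp hd (differentiableAt_of_smooth hΩ hU hX)]
  ring

theorem pd_christoffel_static_s0s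
    (hΩ : IsOpen Ω) (hγ : IsRiemannianMetricOn γ Ω)
    (hX : space X ∈ Ω) (a : Fin 4) (k i : Fin 3) :
    pd a (christoffel (staticMetric γ U) k.succ 0 i.succ) X = 0 := by
  rw [pd_static hΩ hX (f := fun _ => 0)
    (fun _ hY => christoffel_static_s0s hΩ hγ hY k i) contDiffOn_const]
  cases a using Fin.cases <;> simp [pd_const]

theorem pd_christoffel_static_ss0
    (hΩ : IsOpen Ω) (hγ : IsRiemannianMetricOn γ Ω)
    (hX : space X ∈ Ω) (a : Fin 4) (k i : Fin 3) :
    pd a (christoffel (staticMetric γ U) k.succ i.succ 0) X = 0 := by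
  rw [pd_static hΩ hX (f := fun _ => 0)
    (fun _ hY => christoffel_static_ss0 hΩ hγ hY k i) contDiffOn_const]
  cases a using Fin.cases <;> simp [pd_const]

theorem pd_christoffel_static_sss
    (hΩ : IsOpen Ω) (hγ : IsRiemannianMetricOn γ Ω)
    (hX : space X ∈ Ω) (a : Fin 4) (k i j : Fin 3) :
    pd a (christoffel (staticMetric γ U) k.succ i.succ j.succ) X
      = Fin.cases 0 (fun l => pd l (christoffel γ k i j) (space X)) a :=
  pd_static hΩ hX (fun _ hY => christoffel_static_sss hΩ hγ hY k i j)
    (hγ.smooth_christoffel hΩ k i j) a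

theorem riemann_static_s0s0
    (hΩ : IsOpen Ω) (hγ : IsRiemannianMetricOn γ Ω) (hU : ContDiffOn ℝ ∞ U Ω)
    (hX : space X ∈ Ω) (k l : Fin 3) :
    riemann (staticMetric γ U) k.succ 0 l.succ 0 X = Real.exp (2 * U (space X)) *
      (pd l (gradUp γ U k) (space X)
        + ∑ m, christoffel γ k l m (space X) * gradUp γ U m (space X)
        + gradUp γ U k (space X) * pd l U (space X)) := by
  simp only [riemann, Fin.sum_univ_succ (n := 3), pd_christoffel_static_s00 hΩ hγ hU hX,
    pd_christoffel_static_ss0 hΩ hγ hX, christoffel_static_s00 hΩ hγ hU hX,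
    christoffel_static_ss0 hΩ hγ hX, christoffel_static_sss hΩ hγ hX,
    christoffel_static_s0s hΩ hγ hX, christoffel_static_0s0 hΩ hγ hU hX,
    christoffel_static_000 hΩ hγ hU hX, Fin.cases_succ, zero_mul, sub_zero, mul_add,
    Finset.mul_sum]
  have : ∀ m, christoffel γ k l m (space X) * (Real.exp (2 * U (space X)) * gradUp γ U m (space X))
      = Real.exp (2 * U (space X)) * (christoffel γ k l m (space X) * gradUp γ U m (space X)) :=
    fun m => by ring
  simp only [this]
  ring

theorem riemann_static_0s0s
    (hΩ : IsOpen Ω) (hγ : IsRiemannianMetricOn γ Ω) (hU : ContDiffOn ℝ ∞ U Ω)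
    (hX : space X ∈ Ω) (i j : Fin 3) :
    riemann (staticMetric γ U) 0 i.succ 0 j.succ X = -lapse γ U (space X) j i := by
  simp only [riemann, Fin.sum_univ_succ (n := 3), pd_christoffel_static_0ss hΩ hγ hX,
    pd_christoffel_static_00s hΩ hγ hU hX, christoffel_static_0ss hΩ hγ hX,
    christoffel_static_s0s hΩ hγ hX, christoffel_static_sss hΩ hγ hX,
    christoffel_static_00s hΩ hγ hU hX, christoffel_static_0s0 hΩ hγ hU hX,
    christoffel_static_000 hΩ hγ hU hX, Fin.cases_succ, lapse, hessian, Matrix.of_apply]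
  have : ∀ m, pd m U (space X) * christoffel γ m j i (space X)
      = christoffel γ m j i (space X) * pd m U (space X) := fun m => by ring
  simp only [this, mul_zero, sub_zero]
  ring

theorem riemann_static_ssss
    (hΩ : IsOpen Ω) (hγ : IsRiemannianMetricOn γ Ω)
    (hX : space X ∈ Ω) (k l i j : Fin 3) :
    riemann (staticMetric γ U) k.succ l.succ i.succ j.succ X = riemann γ k l i j (space X) := by
  simp only [riemann, Fin.sum_univ_succ (n := 3), pd_christoffel_static_sss hΩ hγ hX,
    christoffel_static_0ss hΩ hγ hX, christoffel_static_sss hΩ hγ hX,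
    Fin.cases_succ, mul_zero, sub_zero, zero_add]

theorem riemann_static_000s
    (hΩ : IsOpen Ω) (hγ : IsRiemannianMetricOn γ Ω) (hU : ContDiffOn ℝ ∞ U Ω)
    (hX : space X ∈ Ω) (j : Fin 3) :
    riemann (staticMetric γ U) 0 0 0 j.succ X = 0 := by
  simp only [riemann, Fin.sum_univ_succ (n := 3), pd_christoffel_static_000 hΩ hγ hU hX,
    pd_christoffel_static_0s0 hΩ hγ hU hX, christoffel_static_0ss hΩ hγ hX,
    christoffel_static_000 hΩ hγ hU hX, christoffel_static_ss0 hΩ hγ hX, Fin.cases_zero]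
  simp

theorem riemann_static_s0ss
    (hΩ : IsOpen Ω) (hγ : IsRiemannianMetricOn γ Ω)
    (hX : space X ∈ Ω) (k i j : Fin 3) :
    riemann (staticMetric γ U) k.succ 0 i.succ j.succ X = 0 := by
  simp only [riemann, Fin.sum_univ_succ (n := 3), pd_christoffel_static_ss0 hΩ hγ hX,
    christoffel_static_ss0 hΩ hγ hX]
  simp

theorem riemann_static_sss0
    (hΩ : IsOpen Ω) (hγ : IsRiemannianMetricOn γ Ω)
    (hX : space X ∈ Ω) (k l i : Fin 3) :
    riemann (staticMetric γ U) k.succ l.succ i.succ 0 X = 0 := by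
  simp only [riemann, Fin.sum_univ_succ (n := 3), pd_christoffel_static_s0s hΩ hγ hX,
    pd_christoffel_static_sss hΩ hγ hX, christoffel_static_ss0 hΩ hγ hX,
    christoffel_static_s0s hΩ hγ hX, christoffel_static_0ss hΩ hγ hX, Fin.cases_zero]
  simp

/-- This block carries all the influence of $U$ on the curvature: it gives both the correction to
the spatial Ricci tensor and the electric part of the Weyl tensor. -/
theorem riemannLow_static_s0s0
    (hΩ : IsOpen Ω) (hγ : IsRiemannianMetricOn γ Ω) (hU : ContDiffOn ℝ ∞ U Ω)
    (hX : space X ∈ Ω) (p l : Fin 3) :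
    riemannLow (staticMetric γ U) p.succ 0 l.succ 0 X
      = Real.exp (2 * U (space X)) * lapse γ U (space X) l p := by
  simp only [riemannLow, Fin.sum_univ_succ (n := 3), staticMetric_succ_zero,
    staticMetric_succ_succ, riemann_static_s0s0 hΩ hγ hU hX, lapse, Matrix.of_apply, zero_mul,
    zero_add]
  rw [← sum_metric_cov_gradUp hΩ hγ hU hX, ← sum_metric_gradUp hγ hX p, Finset.mul_sum,
    ← Finset.sum_add_distrib, Finset.mul_sum]
  exact Finset.sum_congr rfl fun k _ => by ring

theorem riemann_static_s0s0_eq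
    (hΩ : IsOpen Ω) (hγ : IsRiemannianMetricOn γ Ω) (hU : ContDiffOn ℝ ∞ U Ω)
    (hX : space X ∈ Ω) (k l : Fin 3) :
    riemann (staticMetric γ U) k.succ 0 l.succ 0 X
      = Real.exp (2 * U (space X)) * ∑ p, (γ (space X))⁻¹ k p * lapse γ U (space X) l p := by
  have h : γ (space X) *ᵥ (fun m => riemann (staticMetric γ U) m.succ 0 l.succ 0 X)
      = fun p => Real.exp (2 * U (space X)) * lapse γ U (space X) l p := by
    funext p
    rw [← riemannLow_static_s0s0 hΩ hγ hU hX]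
    simp only [riemannLow, Fin.sum_univ_succ (n := 3), staticMetric_succ_zero,
      staticMetric_succ_succ, zero_mul, zero_add, Matrix.mulVec, dotProduct]
  have h2 := congrArg ((γ (space X))⁻¹ *ᵥ ·) h
  simp only [Matrix.mulVec_mulVec, hγ.inv_mul hX, Matrix.one_mulVec] at h2
  have h3 := congrFun h2 k
  simp only [Matrix.mulVec, dotProduct] at h3
  rw [h3, Finset.mul_sum]
  exact Finset.sum_congr rfl fun p _ => by ring

theorem lapse_symm
    (hΩ : IsOpen Ω) (hγ : IsRiemannianMetricOn γ Ω) (hU : ContDiffOn ℝ ∞ U Ω) {x : Fin 3 → ℝ} (hx : x ∈ Ω) (i j : Fin 3) :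
    lapse γ U x i j = lapse γ U x j i := by
  simp only [lapse, hessian, Matrix.of_apply, pd_comm hΩ hU hx i j,
    fun k => hγ.christoffel_symm hΩ hx k i j]
  ring

theorem ricci_static_succ_succ
    (hΩ : IsOpen Ω) (hγ : IsRiemannianMetricOn γ Ω) (hU : ContDiffOn ℝ ∞ U Ω)
    (hX : space X ∈ Ω) (i j : Fin 3) :
    ricci (staticMetric γ U) X i.succ j.succ = ricci γ (space X) i j - lapse γ U (space X) i j := by
  simp only [ricci, Matrix.of_apply, Fin.sum_univ_succ (n := 3), riemann_static_0s0s hΩ hγ hU hX,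
    riemann_static_ssss hΩ hγ hX, lapse_symm hΩ hγ hU hX j i]
  ring

theorem ricci_static_zero_zero
    (hΩ : IsOpen Ω) (hγ : IsRiemannianMetricOn γ Ω) (hU : ContDiffOn ℝ ∞ U Ω)
    (hX : space X ∈ Ω) :
    ricci (staticMetric γ U) X 0 0
      = Real.exp (2 * U (space X)) * ((γ (space X))⁻¹ * lapse γ U (space X)).trace := by
  have h0 : riemann (staticMetric γ U) 0 0 0 0 X = 0 := by
    linarith [IsRiemannianMetricOn.riemann_antisymm (g := staticMetric γ U) (x := X) 0 0 0 0]
  simp only [ricci, Matrix.of_apply, Fin.sum_univ_succ (n := 3), h0,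
    riemann_static_s0s0_eq hΩ hγ hU hX, zero_add, ← Finset.mul_sum, Matrix.trace,
    Matrix.diag_apply, Matrix.mul_apply]
  congr 1
  exact Finset.sum_congr rfl fun k _ => Finset.sum_congr rfl fun p _ => by
    rw [lapse_symm hΩ hγ hU hX]

theorem ricci_static_zero_succ
    (hΩ : IsOpen Ω) (hγ : IsRiemannianMetricOn γ Ω) (hU : ContDiffOn ℝ ∞ U Ω)
    (hX : space X ∈ Ω) (j : Fin 3) : ricci (staticMetric γ U) X 0 j.succ = 0 := by
  simp only [ricci, Matrix.of_apply, Fin.sum_univ_succ (n := 3), riemann_static_000s hΩ hγ hU hX,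
    riemann_static_s0ss hΩ hγ hX]
  simp

theorem ricci_static_succ_zero
    (hΩ : IsOpen Ω) (hγ : IsRiemannianMetricOn γ Ω)
    (hX : space X ∈ Ω) (i : Fin 3) : ricci (staticMetric γ U) X i.succ 0 = 0 := by
  have h0 : riemann (staticMetric γ U) 0 i.succ 0 0 X = 0 := by
    linarith [IsRiemannianMetricOn.riemann_antisymm (g := staticMetric γ U) (x := X) 0 i.succ 0 0]
  simp only [ricci, Matrix.of_apply, Fin.sum_univ_succ (n := 3), h0,
    riemann_static_sss0 hΩ hγ hX]
  simp

/-- The vacuum equations of the static metric. -/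
theorem ricci_static_eq_zero_iff
    (hΩ : IsOpen Ω) (hγ : IsRiemannianMetricOn γ Ω) (hU : ContDiffOn ℝ ∞ U Ω)
    (hX : space X ∈ Ω) :
    ricci (staticMetric γ U) X = 0 ↔
      ricci γ (space X) = lapse γ U (space X) ∧ (ricciEndo γ (space X)).trace = 0 := by
  constructor
  · intro h
    have h1 : ricci γ (space X) = lapse γ U (space X) := by
      ext i j
      have := ricci_static_succ_succ hΩ hγ hU hX i j
      rw [h, Matrix.zero_apply] at this
      linarith
    refine ⟨h1, ?_⟩
    have := ricci_static_zero_zero hΩ hγ hU hX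
    rw [h, Matrix.zero_apply] at this
    -- The time-time equation says that $\nabla dU+dU\otimes dU$ is trace-free, and this tensor has
    -- just been identified with the Ricci tensor of $\gamma$.
    rw [ricciEndo, h1]
    exact (mul_eq_zero.1 this.symm).resolve_left (Real.exp_pos _).ne'
  · rintro ⟨h1, h2⟩
    rw [ricciEndo, h1] at h2
    ext a b
    cases a using Fin.cases with
    | zero =>
      cases b using Fin.cases with
      | zero => rw [ricci_static_zero_zero hΩ hγ hU hX, h2]; simp
      | succ j => exact ricci_static_zero_succ hΩ hγ hU hX j
    | succ i =>
      cases b using Fin.cases with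
      | zero => exact ricci_static_succ_zero hΩ hγ hX i
      | succ j => rw [ricci_static_succ_succ hΩ hγ hU hX, h1]; simp

end StaticMetric

/-! ### The Weyl tensor of a static vacuum metric -/

section WeylStatic

theorem riemannLow_self {n : ℕ} (g : (Fin n → ℝ) → Matrix (Fin n) (Fin n) ℝ) (x : Fin n → ℝ)
    (k l i : Fin n) : riemannLow g k l i i x = 0 := by
  linarith [IsRiemannianMetricOn.riemannLow_antisymm_right (g := g) (x := x) k l i i]

/-- The endomorphism of `ℂ⁴` that annihilates the time axis and restricts to `M` on space. -/
def embed (M : Matrix (Fin 3) (Fin 3) ℂ) : Matrix (Fin 4) (Fin 4) ℂ :=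
  Matrix.of fun a b => Fin.cases 0 (fun i => Fin.cases 0 (fun j => M i j) b) a

theorem embed_zero_left (M : Matrix (Fin 3) (Fin 3) ℂ) (b : Fin 4) : embed M 0 b = 0 := rfl

theorem embed_succ_zero (M : Matrix (Fin 3) (Fin 3) ℂ) (i : Fin 3) : embed M i.succ 0 = 0 := rfl

theorem embed_succ_succ (M : Matrix (Fin 3) (Fin 3) ℂ) (i j : Fin 3) :
    embed M i.succ j.succ = M i j := rfl

theorem ext_embed {A : Matrix (Fin 4) (Fin 4) ℂ} {M : Matrix (Fin 3) (Fin 3) ℂ}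
    (h0 : ∀ b, A 0 b = 0) (h1 : ∀ i : Fin 3, A i.succ 0 = 0)
    (h2 : ∀ i j : Fin 3, A i.succ j.succ = M i j) : A = embed M := by
  ext a b
  cases a using Fin.cases with
  | zero => exact h0 b
  | succ i =>
    cases b using Fin.cases with
    | zero => exact h1 i
    | succ j => exact h2 i j

theorem embed_mul (M N : Matrix (Fin 3) (Fin 3) ℂ) : embed M * embed N = embed (M * N) :=
  ext_embed (fun b => by simp [Matrix.mul_apply, embed_zero_left])
    (fun i => by simp [Matrix.mul_apply, Fin.sum_univ_succ (n := 3), embed_zero_left,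
      embed_succ_zero])
    (fun i j => by simp [Matrix.mul_apply, Fin.sum_univ_succ (n := 3), embed_zero_left,
      embed_succ_zero, embed_succ_succ])

theorem embed_add (M N : Matrix (Fin 3) (Fin 3) ℂ) : embed M + embed N = embed (M + N) :=
  ext_embed (fun b => by simp [embed_zero_left]) (fun i => by simp [embed_succ_zero])
    (fun i j => by simp [embed_succ_succ])

theorem embed_smul (c : ℂ) (M : Matrix (Fin 3) (Fin 3) ℂ) : c • embed M = embed (c • M) :=
  ext_embed (fun b => by simp [embed_zero_left]) (fun i => by simp [embed_succ_zero])
    (fun i j => by simp [embed_succ_succ])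

theorem embed_sub (M N : Matrix (Fin 3) (Fin 3) ℂ) : embed M - embed N = embed (M - N) :=
  ext_embed (fun b => by simp [embed_zero_left]) (fun i => by simp [embed_succ_zero])
    (fun i j => by simp [embed_succ_succ])

theorem embed_eq_zero_iff (M : Matrix (Fin 3) (Fin 3) ℂ) : embed M = 0 ↔ M = 0 := by
  constructor
  · intro h
    ext i j
    rw [← embed_succ_succ M, h]; rfl
  · rintro rfl
    exact (ext_embed (A := 0) (fun _ => rfl) (fun _ => rfl) (fun _ _ => rfl)).symm

variable {γ : (Fin 3 → ℝ) → Matrix (Fin 3) (Fin 3) ℝ} {U : (Fin 3 → ℝ) → ℝ} {Ω : Set (Fin 3 → ℝ)}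
  {X : Fin 4 → ℝ}

theorem staticObserver_zero : staticObserver U X 0 = Real.exp (-U (space X)) := by
  simp [staticObserver]

theorem staticObserver_succ (i : Fin 3) : staticObserver U X i.succ = 0 := by
  simp [staticObserver]

theorem weyl_eq_riemannLow {g : (Fin 4 → ℝ) → Matrix (Fin 4) (Fin 4) ℝ} (h : ricci g X = 0)
    (a b c d : Fin 4) : weyl g a b c d X = riemannLow g a b c d X := by
  simp [weyl, scalarCurv, h]

/-- In vacuum the Weyl tensor is the Riemann tensor. The two factors $e^{-U}$ of the observer cancel
the $e^{2U}$ in $R_{i0j0}$, and what remains equals the Ricci tensor by the field equation. -/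
theorem electric_static_of_vacuum
    (hΩ : IsOpen Ω) (hγ : IsRiemannianMetricOn γ Ω) (hU : ContDiffOn ℝ ∞ U Ω)
    (hX : space X ∈ Ω) (hv : ricci (staticMetric γ U) X = 0) (i j : Fin 3) :
    electric (staticMetric γ U) (staticObserver U X) X i.succ j.succ = ricci γ (space X) i j := by
  simp only [electric, Matrix.of_apply, Fin.sum_univ_succ (n := 3), staticObserver_zero,
    staticObserver_succ, weyl_eq_riemannLow hv, riemannLow_static_s0s0 hΩ hγ hU hX]
  rw [((ricci_static_eq_zero_iff hΩ hγ hU hX).1 hv).1, lapse_symm hΩ hγ hU hX j i]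
  have : Real.exp (2 * U (space X)) * Real.exp (-U (space X)) * Real.exp (-U (space X)) = 1 := by
    rw [← Real.exp_add, ← Real.exp_add, ← Real.exp_zero]; ring_nf
  simp only [mul_zero, zero_mul, Finset.sum_const_zero, add_zero]
  linear_combination lapse γ U (space X) i j * this

theorem electric_static_zero_left
    (hΩ : IsOpen Ω) (hγ : IsRiemannianMetricOn γ Ω) (hU : ContDiffOn ℝ ∞ U Ω)
    (hX : space X ∈ Ω) (hv : ricci (staticMetric γ U) X = 0) (b : Fin 4) :
    electric (staticMetric γ U) (staticObserver U X) X 0 b = 0 := by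
  have h : riemannLow (staticMetric γ U) 0 0 b 0 X = 0 := by
    rw [IsRiemannianMetricOn.riemannLow_antisymm_right, neg_eq_zero]
    cases b using Fin.cases with
    | zero => exact riemannLow_self _ _ _ _ _
    | succ j => simp [riemannLow, Fin.sum_univ_succ (n := 3), staticMetric_zero_succ,
        riemann_static_000s hΩ hγ hU hX]
  simp [electric, Fin.sum_univ_succ (n := 3), staticObserver_succ, weyl_eq_riemannLow hv, h]

theorem electric_static_succ_zero (hv : ricci (staticMetric γ U) X = 0) (i : Fin 3) :
    electric (staticMetric γ U) (staticObserver U X) X i.succ 0 = 0 := by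
  have h : riemannLow (staticMetric γ U) i.succ 0 0 0 X = 0 := riemannLow_self _ _ _ _ _
  simp [electric, Fin.sum_univ_succ (n := 3), staticObserver_succ, weyl_eq_riemannLow hv, h]

/-- Contraction with the observer puts a time index into the volume form, so its other indices must
be spatial. The Weyl components left have exactly one or three spatial indices in such a way that
they vanish: those of the form $W_{pqb0}$ with $p,q$ spatial are zero by staticity or by
antisymmetry. -/
theorem magnetic_static_of_vacuum
    (hΩ : IsOpen Ω) (hγ : IsRiemannianMetricOn γ Ω)
    (hX : space X ∈ Ω) (hv : ricci (staticMetric γ U) X = 0) :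
    magnetic (staticMetric γ U) (staticObserver U X) X = 0 := by
  have hlow : ∀ (p q : Fin 3) (b : Fin 4),
      riemannLow (staticMetric γ U) p.succ q.succ b 0 X = 0 := by
    intro p q b
    cases b using Fin.cases with
    | zero => exact riemannLow_self _ _ _ _ _
    | succ j => simp [riemannLow, Fin.sum_univ_succ (n := 3), staticMetric_succ_zero,
        riemann_static_sss0 hΩ hγ hX]
  have hvol : ∀ a e f : Fin 4, e = 0 ∨ f = 0 → volForm (staticMetric γ U) a 0 e f X = 0 := by
    intro a e f h
    rw [volForm]
    refine mul_eq_zero_of_right _ ?_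
    rcases h with rfl | rfl
    · exact Matrix.det_zero_of_row_eq (i := 1) (j := 2) (by decide) rfl
    · exact Matrix.det_zero_of_row_eq (i := 1) (j := 3) (by decide) rfl
  have hdual : ∀ a b : Fin 4, dualWeyl (staticMetric γ U) a 0 b 0 X = 0 := by
    intro a b
    rw [dualWeyl]
    refine mul_eq_zero_of_right _ (Finset.sum_eq_zero fun e _ => Finset.sum_eq_zero fun f _ =>
      Finset.sum_eq_zero fun p _ => Finset.sum_eq_zero fun q _ => ?_)
    rw [staticMetric_inv (hγ.det_ne_zero hX), weyl_eq_riemannLow hv]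
    cases e using Fin.cases with
    | zero => simp [hvol a 0 f (Or.inl rfl)]
    | succ e =>
      cases f using Fin.cases with
      | zero => simp [hvol a e.succ 0 (Or.inr rfl)]
      | succ f =>
        cases p using Fin.cases with
        | zero => simp
        | succ p =>
          cases q using Fin.cases with
          | zero => simp
          | succ q => rw [hlow, mul_zero]
  ext a b
  simp [magnetic, Fin.sum_univ_succ (n := 3), staticObserver_succ, hdual]

/-- This reduces the Petrov type and the principal direction to linear algebra of a real matrix of
order three. -/
theorem weylEndo_static
    (hΩ : IsOpen Ω) (hγ : IsRiemannianMetricOn γ Ω) (hU : ContDiffOn ℝ ∞ U Ω)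
    (hX : space X ∈ Ω) (hv : ricci (staticMetric γ U) X = 0) :
    weylEndo (staticMetric γ U) (staticObserver U X) X
      = embed ((ricciEndo γ (space X)).map Complex.ofReal) := by
  rw [weylEndo, magnetic_static_of_vacuum hΩ hγ hX hv, staticMetric_inv (hγ.det_ne_zero hX)]
  have hz : ∀ A : Matrix (Fin 4) (Fin 4) ℝ, Complex.I • (A * 0).map Complex.ofReal = 0 := by
    intro A
    rw [Matrix.mul_zero]; ext; simp
  rw [hz, add_zero]
  refine ext_embed (fun b => ?_) (fun i => ?_) (fun i j => ?_)
  · simp [Matrix.mul_apply, Fin.sum_univ_succ (n := 3), electric_static_zero_left hΩ hγ hU hX hv]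
  · simp [Matrix.mul_apply, Fin.sum_univ_succ (n := 3), electric_static_succ_zero hv]
  · simp [ricciEndo, Matrix.mul_apply, Fin.sum_univ_succ (n := 3),
      electric_static_of_vacuum hΩ hγ hU hX hv]

theorem staticMetric_mulVec_zero (v : Fin 4 → ℝ) :
    (staticMetric γ U X *ᵥ v) 0 = -Real.exp (2 * U (space X)) * v 0 := by
  simp [Matrix.mulVec, dotProduct, Fin.sum_univ_succ (n := 3), staticMetric_zero_zero,
    staticMetric_zero_succ]

theorem staticMetric_mulVec_succ (v : Fin 4 → ℝ) (i : Fin 3) :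
    (staticMetric γ U X *ᵥ v) i.succ = (γ (space X) *ᵥ space v) i := by
  simp [Matrix.mulVec, dotProduct, Fin.sum_univ_succ (n := 3), staticMetric_succ_zero,
    staticMetric_succ_succ, space]

theorem staticObserver_dotProduct (v : Fin 4 → ℝ) :
    staticObserver U X ⬝ᵥ (staticMetric γ U X *ᵥ v) = -Real.exp (U (space X)) * v 0 := by
  rw [dotProduct, Fin.sum_univ_succ, staticObserver_zero, staticMetric_mulVec_zero]
  have : Real.exp (-U (space X)) * Real.exp (2 * U (space X)) = Real.exp (U (space X)) := by
    rw [← Real.exp_add]; ring_nf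
  simp only [staticObserver_succ, zero_mul, Finset.sum_const_zero, add_zero]
  linear_combination -v 0 * this

theorem dotProduct_staticMetric {v w : Fin 4 → ℝ} (h : v 0 = 0) :
    v ⬝ᵥ (staticMetric γ U X *ᵥ w) = space v ⬝ᵥ (γ (space X) *ᵥ space w) := by
  rw [dotProduct, Fin.sum_univ_succ, h, zero_mul, zero_add]
  simp only [staticMetric_mulVec_succ]
  rfl

theorem restProj_static : restProj (staticMetric γ U) (staticObserver U X) X = embed 1 := by
  have h0 : Real.exp (-U (space X)) * (Real.exp (2 * U (space X)) * Real.exp (-U (space X))) = 1 := by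
    rw [← Real.exp_add, ← Real.exp_add, ← Real.exp_zero]; ring_nf
  have hs : space (staticObserver U X) = 0 := space_single_zero _
  refine ext_embed (fun b => ?_) (fun i => ?_) (fun i j => ?_)
  · cases b using Fin.cases with
    | zero =>
      simp [restProj, Matrix.vecMulVec_apply, staticObserver_zero, staticMetric_mulVec_zero,
        -Complex.ofReal_exp, h0]
    | succ j =>
      simp [restProj, Matrix.vecMulVec_apply, staticMetric_mulVec_succ, hs,
        (Fin.succ_ne_zero j).symm]
  · simp [restProj, Matrix.vecMulVec_apply, staticObserver_succ]
  · simp [restProj, Matrix.vecMulVec_apply, staticObserver_succ, Matrix.one_apply, apply_ite]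

theorem isTypeDAt_static_iff
    (hΩ : IsOpen Ω) (hγ : IsRiemannianMetricOn γ Ω) (hU : ContDiffOn ℝ ∞ U Ω)
    (hX : space X ∈ Ω) (hv : ricci (staticMetric γ U) X = 0) (α : ℂ) :
    IsTypeDAt (staticMetric γ U) (staticObserver U X) X α ↔
      α ≠ 0 ∧ ((ricciEndo γ (space X)).map Complex.ofReal - α • (1 : Matrix (Fin 3) (Fin 3) ℂ)) *
        ((ricciEndo γ (space X)).map Complex.ofReal + (2 * α) • (1 : Matrix (Fin 3) (Fin 3) ℂ))
          = 0 := by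
  rw [IsTypeDAt, weylEndo_static hΩ hγ hU hX hv, restProj_static, embed_smul, embed_smul,
    embed_sub, embed_add, embed_mul, embed_eq_zero_iff]

theorem isPrincipalDir_static_iff
    (hΩ : IsOpen Ω) (hγ : IsRiemannianMetricOn γ Ω) (hU : ContDiffOn ℝ ∞ U Ω)
    (hX : space X ∈ Ω) (hv : ricci (staticMetric γ U) X = 0) (α : ℝ) (e : Fin 4 → ℝ) :
    IsPrincipalDir (staticMetric γ U) (staticObserver U X) X α e ↔
      e 0 = 0 ∧ space e ⬝ᵥ (γ (space X) *ᵥ space e) = 1 ∧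
        ricciEndo γ (space X) *ᵥ space e = (-2 * α) • space e := by
  rw [IsPrincipalDir, weylEndo_static hΩ hγ hU hX hv, staticObserver_dotProduct]
  have h1 : -Real.exp (U (space X)) * e 0 = 0 ↔ e 0 = 0 := by simp
  rw [h1]
  refine and_congr_right fun h0 => ?_
  rw [dotProduct_staticMetric h0]
  refine and_congr_right fun _ => ?_
  have key : ∀ i : Fin 3, (embed ((ricciEndo γ (space X)).map Complex.ofReal) *ᵥ
      fun a => (e a : ℂ)) i.succ = ((ricciEndo γ (space X) *ᵥ space e) i : ℝ) := by
    intro i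
    simp [Matrix.mulVec, dotProduct, Fin.sum_univ_succ (n := 3), embed_succ_zero, embed_succ_succ,
      space]
  constructor
  · intro h
    funext i
    have := congrFun h i.succ
    rw [key] at this
    apply Complex.ofReal_injective
    rw [this]
    simp [space]
  · intro h
    funext a
    cases a using Fin.cases with
    | zero => simp [Matrix.mulVec, dotProduct, embed_zero_left, h0]
    | succ i =>
      rw [key, h]
      simp [space]

end WeylStatic

/-! ### Self-adjoint endomorphisms with a double eigenvalue -/

section Algebra

variable {G K : Matrix (Fin 3) (Fin 3) ℝ}

theorem transpose_eq_of_posDef (hG : G.PosDef) : Gᵀ = G := by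
  simpa [Matrix.IsHermitian] using hG.isHermitian.eq

/-- A self-adjoint endomorphism of square zero vanishes: the hypothesis makes $Kv$ null for the
positive form $G^{-1}$. -/
theorem eq_zero_of_selfAdjoint_sq (hG : G.PosDef) (hK : Kᵀ = K) (h : K * G⁻¹ * K = 0) : K = 0 := by
  have hv : ∀ v, K *ᵥ v = 0 := by
    intro v
    by_contra hne
    have hpos := hG.inv.dotProduct_mulVec_pos hne
    have : star (K *ᵥ v) ⬝ᵥ (G⁻¹ *ᵥ (K *ᵥ v)) = v ⬝ᵥ ((K * G⁻¹ * K) *ᵥ v) := by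
      rw [star_trivial, ← Matrix.mulVec_mulVec, ← Matrix.mulVec_mulVec, Matrix.dotProduct_mulVec v,
        ← Matrix.mulVec_transpose, hK]
    rw [this, h] at hpos
    simp at hpos
  ext i j
  simpa using congrFun (hv (Pi.single j 1)) i

/-- $G^{-1}K$ is an orthogonal projector of trace one, so its image is a line; a non-zero vector
$Kv$, normalised, spans it as a covector. -/
theorem exists_eq_vecMulVec_self (hG : G.PosDef) (hK : Kᵀ = K) (h : K * G⁻¹ * K = K)
    (htr : (G⁻¹ * K).trace = 1) :
    ∃ e : Fin 3 → ℝ, K = Matrix.vecMulVec e e ∧ e ⬝ᵥ (G⁻¹ *ᵥ e) = 1 := by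
  have hne : K ≠ 0 := by rintro rfl; simp at htr
  obtain ⟨v, hv⟩ : ∃ v, K *ᵥ v ≠ 0 := by
    by_contra! hall
    refine hne (Matrix.ext fun i j => ?_)
    simpa using congrFun (hall (Pi.single j 1)) i
  have hquad : (K *ᵥ v) ⬝ᵥ (G⁻¹ *ᵥ (K *ᵥ v)) = v ⬝ᵥ (K *ᵥ v) := by
    conv_rhs => rw [← h]
    rw [← Matrix.mulVec_mulVec, ← Matrix.mulVec_mulVec, Matrix.dotProduct_mulVec v,
        ← Matrix.mulVec_transpose, hK]
  have hpos : 0 < v ⬝ᵥ (K *ᵥ v) := by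
    rw [← hquad]; simpa using hG.inv.dotProduct_mulVec_pos hv
  set q := v ⬝ᵥ (K *ᵥ v) with hq
  set e : Fin 3 → ℝ := (Real.sqrt q)⁻¹ • (K *ᵥ v) with he
  have hsq : (Real.sqrt q)⁻¹ * (Real.sqrt q)⁻¹ = q⁻¹ := by
    rw [← mul_inv, Real.mul_self_sqrt hpos.le]
  have hunit : e ⬝ᵥ (G⁻¹ *ᵥ e) = 1 := by
    rw [he, Matrix.mulVec_smul, smul_dotProduct, dotProduct_smul, hquad, smul_eq_mul, smul_eq_mul,
      ← mul_assoc, hsq, inv_mul_cancel₀ hpos.ne']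
  have hKe : K *ᵥ (G⁻¹ *ᵥ e) = e := by
    rw [he, Matrix.mulVec_smul, Matrix.mulVec_smul, Matrix.mulVec_mulVec, Matrix.mulVec_mulVec,
      h]
  refine ⟨e, ?_, hunit⟩
  set E := G⁻¹ *ᵥ e with hE
  have hGs : (G⁻¹)ᵀ = G⁻¹ := transpose_eq_of_posDef hG.inv
  have heG : e ᵥ* G⁻¹ = E := by rw [← Matrix.mulVec_transpose, hGs]
  have hEK : E ᵥ* K = e := by rw [← Matrix.mulVec_transpose, hK, hKe]
  -- Since $e$ lies in the image of $K$, removing $e\otimes e$ leaves an idempotent. Its trace is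
  -- zero, and over $\mathbb R$ such an idempotent vanishes.
  have hidem : (G⁻¹ * (K - Matrix.vecMulVec e e)) * (G⁻¹ * (K - Matrix.vecMulVec e e))
      = G⁻¹ * (K - Matrix.vecMulVec e e) := by
    have h1 : G⁻¹ * K * (G⁻¹ * K) = G⁻¹ * K := by
      rw [Matrix.mul_assoc, ← Matrix.mul_assoc K, h]
    have h2 : (G⁻¹ * K) *ᵥ E = E := by rw [← Matrix.mulVec_mulVec, hKe]
    have h3 : e ᵥ* (G⁻¹ * K) = e := by rw [← Matrix.vecMul_vecMul, heG, hEK]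
    rw [Matrix.mul_sub, Matrix.mul_vecMulVec, ← hE, Matrix.mul_sub, Matrix.sub_mul, Matrix.sub_mul,
      h1, Matrix.vecMulVec_mul, h3, Matrix.mul_vecMulVec, h2, Matrix.vecMulVec_mul_vecMulVec, hunit,
      one_smul]
    abel
  have htr0 : (G⁻¹ * (K - Matrix.vecMulVec e e)).trace = 0 := by
    rw [Matrix.mul_sub, Matrix.trace_sub, htr, Matrix.mul_vecMulVec, Matrix.trace_vecMulVec,
      dotProduct_comm, hunit, sub_self]
  have hz : G⁻¹ * (K - Matrix.vecMulVec e e) = 0 := by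
    apply (Matrix.toLin' (R := ℝ)).injective
    rw [map_zero]
    refine LinearMap.IsIdempotentElem.eq_zero_of_trace_eq_zero ?_ ?_
    · rw [IsIdempotentElem, Module.End.mul_eq_comp, ← Matrix.toLin'_mul, hidem]
    · rw [Matrix.trace_toLin'_eq, htr0]
  have hu : IsUnit G.det := hG.det_pos.ne'.isUnit
  have := congrArg (G * ·) hz
  simp only [Matrix.mul_zero, Matrix.mul_nonsing_inv_cancel_left G _ hu] at this
  exact sub_eq_zero.1 this

/-- The Cayley-Hamilton theorem for trace-free matrices of order three. -/
theorem cayley_hamilton_of_trace_zero (A : Matrix (Fin 3) (Fin 3) ℝ) (h : A.trace = 0) :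
    A ^ 3 = ((A ^ 2).trace / 2) • A + ((A ^ 3).trace / 3) • (1 : Matrix (Fin 3) (Fin 3) ℝ) := by
  have h22 : A 2 2 = -A 0 0 - A 1 1 := by
    rw [Matrix.trace_fin_three] at h; linarith
  ext i j
  fin_cases i <;> fin_cases j <;>
    simp [pow_succ, Matrix.mul_apply, Fin.sum_univ_three, Matrix.trace_fin_three, h22] <;> ring

/-- With $s=6\alpha^2$ and $t=-6\alpha^3$ the Cayley–Hamilton equation is
$(A-\alpha)^2(A+2\alpha)=0$. Self-adjointness removes the repeated factor, and
$(\alpha-A)/(3\alpha)$ is then the projector on the simple eigenspace. -/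
theorem exists_axis_of_discriminant (hG : G.PosDef) (hK : Kᵀ = K)
    (htr : (G⁻¹ * K).trace = 0) {s t α : ℝ} (hs : ((G⁻¹ * K) ^ 2).trace = s)
    (ht : ((G⁻¹ * K) ^ 3).trace = t) (hst : 6 * t ^ 2 = s ^ 3) (hs0 : s ≠ 0) (hα : α = -t / s) :
    α ≠ 0 ∧ ∃ e : Fin 3 → ℝ,
      K = α • (G - (3 : ℝ) • Matrix.vecMulVec e e) ∧ e ⬝ᵥ (G⁻¹ *ᵥ e) = 1 := by
  have hu : IsUnit G.det := hG.det_pos.ne'.isUnit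
  have hs6 : s = 6 * α ^ 2 := by
    rw [hα]; field_simp; linarith
  have ht6 : t = -6 * α ^ 3 := by
    have : t = -(α * s) := by rw [hα]; field_simp
    rw [this, hs6]; ring
  have hα0 : α ≠ 0 := by rintro rfl; exact hs0 (by simpa using hs6)
  refine ⟨hα0, ?_⟩
  set A := G⁻¹ * K with hA
  have hGA : G * A = K := Matrix.mul_nonsing_inv_cancel_left G K hu
  have hCH : A ^ 3 = (3 * α ^ 2) • A - (2 * α ^ 3) • (1 : Matrix (Fin 3) (Fin 3) ℝ) := by
    rw [cayley_hamilton_of_trace_zero A htr, hs, ht, hs6, ht6, sub_eq_add_neg, ← neg_smul]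
    congr 2 <;> ring
  -- This is $G(A-\alpha)(A+2\alpha)$. The endomorphism $(A-\alpha)(A+2\alpha)$ is self-adjoint, and
  -- its square contains the characteristic polynomial as a factor.
  have hL : K * A + α • K - (2 * α ^ 2) • G = 0 := by
    apply eq_zero_of_selfAdjoint_sq hG
    · have hGt : Gᵀ = G := transpose_eq_of_posDef hG
      have hGs : (G⁻¹)ᵀ = G⁻¹ := transpose_eq_of_posDef hG.inv
      simp only [Matrix.transpose_sub, Matrix.transpose_add, Matrix.transpose_smul,
        Matrix.transpose_mul, hA, hK, hGt, hGs, Matrix.mul_assoc]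
    · have e1 : K * A + α • K - (2 * α ^ 2) • G
          = G * (A ^ 2 + α • A - (2 * α ^ 2) • (1 : Matrix (Fin 3) (Fin 3) ℝ)) := by
        rw [Matrix.mul_sub, Matrix.mul_add, Matrix.mul_smul, Matrix.mul_smul, Matrix.mul_one, hGA,
          pow_two A, ← Matrix.mul_assoc G A A, hGA]
      have e2 : (A ^ 2 + α • A - (2 * α ^ 2) • (1 : Matrix (Fin 3) (Fin 3) ℝ)) ^ 2 = 0 := by
        have e3 : (A ^ 2 + α • A - (2 * α ^ 2) • (1 : Matrix (Fin 3) (Fin 3) ℝ)) ^ 2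
            = A * A ^ 3 + (2 * α) • A ^ 3 - (3 * α ^ 2) • A ^ 2 - (4 * α ^ 3) • A
              + (4 * α ^ 4) • (1 : Matrix (Fin 3) (Fin 3) ℝ) := by
          simp only [pow_succ, pow_zero, one_mul, mul_add, mul_sub, add_mul, sub_mul,
            smul_mul_assoc, mul_smul_comm, smul_smul, mul_one, smul_add, smul_sub, mul_assoc]
          module
        rw [e3, hCH]
        simp only [mul_sub, mul_smul_comm, mul_one, smul_sub, smul_smul, pow_two A]
        module
      rw [e1, Matrix.mul_assoc _ G⁻¹, Matrix.nonsing_inv_mul_cancel_left G _ hu,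
        Matrix.mul_assoc, ← pow_two, e2, Matrix.mul_zero]
  have hKA : K * A = (2 * α ^ 2) • G - α • K := by
    rw [eq_sub_iff_add_eq]; exact sub_eq_zero.1 hL
  obtain ⟨e, he, hunit⟩ := exists_eq_vecMulVec_self (K := (3 * α)⁻¹ • (α • G - K)) hG
    (by
      have hGt : Gᵀ = G := transpose_eq_of_posDef hG
      simp [hK, hGt])
    (by
      have e1 : (α • G - K) * G⁻¹ * (α • G - K) = (3 * α) • (α • G - K) := by
        rw [Matrix.mul_assoc, Matrix.mul_sub, Matrix.mul_smul, Matrix.nonsing_inv_mul G hu, ← hA,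
          Matrix.sub_mul, Matrix.mul_sub, Matrix.mul_sub, hKA]
        simp only [Matrix.smul_mul, Matrix.mul_smul, Matrix.mul_one, hGA]
        module
      rw [Matrix.smul_mul, Matrix.smul_mul, Matrix.mul_smul, e1, smul_smul (3 * α)⁻¹ (3 * α),
        inv_mul_cancel₀ (by simpa using hα0), one_smul])
    (by
      rw [Matrix.mul_smul, Matrix.mul_sub, Matrix.mul_smul, Matrix.nonsing_inv_mul G hu, ← hA]
      simp only [Matrix.trace_smul, Matrix.trace_sub, Matrix.trace_one, htr, smul_eq_mul,
        Fintype.card_fin]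
      field_simp
      ring)
  refine ⟨e, ?_, hunit⟩
  rw [← he, smul_smul, smul_sub, smul_smul, smul_sub]
  have h3 : α * (3 * (3 * α)⁻¹) = 1 := by field_simp
  rw [h3]
  module

variable {e : Fin 3 → ℝ} {α : ℝ}

/-- The powers of the Ricci endomorphism of type D. -/
theorem powers_of_axis (hG : G.PosDef) (hK : K = α • (G - (3 : ℝ) • Matrix.vecMulVec e e))
    (he : e ⬝ᵥ (G⁻¹ *ᵥ e) = 1) :
    G⁻¹ * K = α • (1 - (3 : ℝ) • Matrix.vecMulVec (G⁻¹ *ᵥ e) e) ∧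
    (G⁻¹ * K) ^ 2 = α ^ 2 • (1 + (3 : ℝ) • Matrix.vecMulVec (G⁻¹ *ᵥ e) e) := by
  have hu : IsUnit G.det := hG.det_pos.ne'.isUnit
  have h1 : G⁻¹ * K = α • (1 - (3 : ℝ) • Matrix.vecMulVec (G⁻¹ *ᵥ e) e) := by
    rw [hK, Matrix.mul_smul, Matrix.mul_sub, Matrix.mul_smul, Matrix.nonsing_inv_mul G hu,
      Matrix.mul_vecMulVec]
  have hp : Matrix.vecMulVec (G⁻¹ *ᵥ e) e * Matrix.vecMulVec (G⁻¹ *ᵥ e) e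
      = Matrix.vecMulVec (G⁻¹ *ᵥ e) e := by
    rw [Matrix.vecMulVec_mul_vecMulVec, he, one_smul]
  refine ⟨h1, ?_⟩
  rw [h1, smul_pow, pow_two (1 - _)]
  simp only [mul_sub, sub_mul, mul_one, one_mul, smul_mul_assoc, mul_smul_comm, hp]
  module

theorem invariants_of_axis (hG : G.PosDef) (hK : K = α • (G - (3 : ℝ) • Matrix.vecMulVec e e))
    (he : e ⬝ᵥ (G⁻¹ *ᵥ e) = 1) :
    ((G⁻¹ * K) ^ 2).trace = 6 * α ^ 2 ∧
    ((6 : ℝ) • (G⁻¹ * K) ^ 2 - (6 * α ^ 2) • (1 : Matrix (Fin 3) (Fin 3) ℝ)) * G⁻¹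
      = (18 * α ^ 2) • Matrix.vecMulVec (G⁻¹ *ᵥ e) (G⁻¹ *ᵥ e) := by
  obtain ⟨-, h2⟩ := powers_of_axis hG hK he
  have hGs : (G⁻¹)ᵀ = G⁻¹ := transpose_eq_of_posDef hG.inv
  constructor
  · rw [h2]
    simp only [Matrix.trace_smul, Matrix.trace_add, Matrix.trace_one, Matrix.trace_vecMulVec,
      dotProduct_comm _ e, he, smul_eq_mul, Fintype.card_fin]
    push_cast; ring
  · have h3 : (6 : ℝ) • (G⁻¹ * K) ^ 2 - (6 * α ^ 2) • (1 : Matrix (Fin 3) (Fin 3) ℝ)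
        = (18 * α ^ 2) • Matrix.vecMulVec (G⁻¹ *ᵥ e) e := by
      rw [h2]; module
    rw [h3, Matrix.smul_mul, Matrix.vecMulVec_mul, ← Matrix.mulVec_transpose, hGs]

theorem typeD_of_axis (hG : G.PosDef) (hK : K = α • (G - (3 : ℝ) • Matrix.vecMulVec e e))
    (he : e ⬝ᵥ (G⁻¹ *ᵥ e) = 1) :
    ((G⁻¹ * K).map Complex.ofReal - (α : ℂ) • (1 : Matrix (Fin 3) (Fin 3) ℂ)) *
      ((G⁻¹ * K).map Complex.ofReal + (2 * (α : ℂ)) • (1 : Matrix (Fin 3) (Fin 3) ℂ)) = 0 := by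
  obtain ⟨h1, h2⟩ := powers_of_axis hG hK he
  have hr : (G⁻¹ * K - α • 1) * (G⁻¹ * K + (2 * α) • 1) = 0 := by
    have : (G⁻¹ * K - α • 1) * (G⁻¹ * K + (2 * α) • 1)
        = (G⁻¹ * K) ^ 2 + α • (G⁻¹ * K) - (2 * α ^ 2) • 1 := by
      generalize G⁻¹ * K = A
      simp only [mul_add, sub_mul, mul_one, one_mul, smul_mul_assoc, mul_smul_comm, pow_two]
      module
    rw [this, h2, h1]; module
  have hm := congrArg (fun M : Matrix (Fin 3) (Fin 3) ℝ => M.map Complex.ofRealHom) hr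
  simp only [Matrix.map_mul] at hm
  have e1 : (G⁻¹ * K - α • 1).map Complex.ofRealHom
      = (G⁻¹ * K).map Complex.ofReal - (α : ℂ) • (1 : Matrix (Fin 3) (Fin 3) ℂ) := by
    ext i j
    by_cases hij : i = j <;> simp [hij]
  have e2 : (G⁻¹ * K + (2 * α) • 1).map Complex.ofRealHom
      = (G⁻¹ * K).map Complex.ofReal + (2 * (α : ℂ)) • (1 : Matrix (Fin 3) (Fin 3) ℂ) := by
    ext i j
    by_cases hij : i = j <;> simp [hij]
  rw [e1, e2] at hm
  rw [hm]; ext; simp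

/-- A trace-free real matrix of type D has a real double eigenvalue, determined by its traces. -/
theorem invariants_of_typeD {A : Matrix (Fin 3) (Fin 3) ℝ} {α : ℂ} (htr : A.trace = 0) (hα : α ≠ 0)
    (h : (A.map Complex.ofReal - α • (1 : Matrix (Fin 3) (Fin 3) ℂ)) *
      (A.map Complex.ofReal + (2 * α) • (1 : Matrix (Fin 3) (Fin 3) ℂ)) = 0) :
    6 * (A ^ 3).trace ^ 2 = (A ^ 2).trace ^ 3 ∧ (A ^ 2).trace ≠ 0 ∧
      α = ((-(A ^ 3).trace / (A ^ 2).trace : ℝ) : ℂ) := by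
  set B : Matrix (Fin 3) (Fin 3) ℂ := A.map Complex.ofReal with hB
  have tr : ∀ M : Matrix (Fin 3) (Fin 3) ℝ, (M.map Complex.ofReal).trace = (M.trace : ℂ) := by
    intro M; simp [Matrix.trace_fin_three]
  have hpow : ∀ k : ℕ, B ^ k = (A ^ k).map Complex.ofReal := by
    intro k
    have := (Complex.ofRealHom.mapMatrix (m := Fin 3)).map_pow A k
    exact this.symm
  -- The quadratic equation makes every power of $B$ affine in $B$. As $\operatorname{tr}B=0$, it
  -- follows that $\operatorname{tr}B^2=6\alpha^2$ and $\operatorname{tr}B^3=-6\alpha^3$, whence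
  -- $\alpha$ is a quotient of real traces.
  have h2 : B ^ 2 = (2 * α ^ 2) • (1 : Matrix (Fin 3) (Fin 3) ℂ) - α • B := by
    have : (B - α • (1 : Matrix (Fin 3) (Fin 3) ℂ)) * (B + (2 * α) • 1)
        = B ^ 2 + α • B - (2 * α ^ 2) • 1 := by
      simp only [mul_add, sub_mul, mul_one, one_mul, smul_mul_assoc, mul_smul_comm, pow_two]
      module
    rw [this] at h
    rw [eq_sub_iff_add_eq]; exact sub_eq_zero.1 h
  have h3 : B ^ 3 = (3 * α ^ 2) • B - (2 * α ^ 3) • (1 : Matrix (Fin 3) (Fin 3) ℂ) := by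
    rw [pow_succ, h2, sub_mul, smul_mul_assoc, smul_mul_assoc, one_mul, ← pow_two, h2]
    module
  have hBtr : B.trace = 0 := by rw [hB, tr, htr, Complex.ofReal_zero]
  have hs : ((A ^ 2).trace : ℂ) = 6 * α ^ 2 := by
    rw [← tr, ← hpow, h2]
    simp only [Matrix.trace_sub, Matrix.trace_smul, Matrix.trace_one, hBtr, Fintype.card_fin,
      smul_eq_mul]
    push_cast; ring
  have ht : ((A ^ 3).trace : ℂ) = -6 * α ^ 3 := by
    rw [← tr, ← hpow, h3]
    simp only [Matrix.trace_sub, Matrix.trace_smul, Matrix.trace_one, hBtr, Fintype.card_fin,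
      smul_eq_mul]
    push_cast; ring
  refine ⟨?_, ?_, ?_⟩
  · apply Complex.ofReal_injective
    push_cast
    rw [hs, ht]; ring
  · intro h0
    rw [h0, Complex.ofReal_zero] at hs
    exact hα (by simpa using hs.symm)
  · push_cast
    rw [hs, ht]
    field_simp

end Algebra

/-! ### Pointwise consequences of the Ricci identities -/

section AxisAlgebra

variable {g H : Matrix (Fin 3) (Fin 3) ℝ} {e E : Fin 3 → ℝ}

/-- Two contractions suffice. The metric trace over $k,i$ gives $-2m_j+(q\cdot E)e_j-q_j=0$.
Contraction with $E^iE^k$ gives $(m\cdot E)e_j-m_j+(q\cdot E)e_j-q_j=0$. Their difference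
$m_j+(m\cdot E)e_j=0$ no longer contains $q$, and a contraction with $E$ gives $m\cdot E=0$. -/
theorem eq_zero_of_axis_identity
    (hδ : ∀ k j, H 0 k * g j 0 + H 1 k * g j 1 + H 2 k * g j 2 = if k = j then 1 else 0)
    (hE : ∀ k, H 0 k * e 0 + H 1 k * e 1 + H 2 k * e 2 = E k)
    (hgE : ∀ j, g j 0 * E 0 + g j 1 * E 1 + g j 2 * E 2 = e j)
    (hu : e 0 * E 0 + e 1 * E 1 + e 2 * E 2 = 1) {m q : Fin 3 → ℝ}
    (h : ∀ k j i, m k * g j i - m j * g k i + e i * (q k * e j - q j * e k) = 0) (j : Fin 3) :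
    m j = 0 := by
  have t : ∀ j, -2 * m j + (q 0 * E 0 + q 1 * E 1 + q 2 * E 2) * e j - q j = 0 := by
    intro j
    have h3 : m 0 * (if (0 : Fin 3) = j then (1 : ℝ) else 0)
        + m 1 * (if (1 : Fin 3) = j then (1 : ℝ) else 0)
        + m 2 * (if (2 : Fin 3) = j then (1 : ℝ) else 0) = m j := by
      fin_cases j <;> simp
    have d0 : H 0 0 * g 0 0 + H 1 0 * g 0 1 + H 2 0 * g 0 2 = 1 := by simpa using hδ 0 0
    have d1 : H 0 1 * g 1 0 + H 1 1 * g 1 1 + H 2 1 * g 1 2 = 1 := by simpa using hδ 1 1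
    have d2 : H 0 2 * g 2 0 + H 1 2 * g 2 1 + H 2 2 * g 2 2 = 1 := by simpa using hδ 2 2
    linear_combination H 0 0 * h 0 j 0 + H 0 1 * h 1 j 0 + H 0 2 * h 2 j 0
      + H 1 0 * h 0 j 1 + H 1 1 * h 1 j 1 + H 1 2 * h 2 j 1
      + H 2 0 * h 0 j 2 + H 2 1 * h 1 j 2 + H 2 2 * h 2 j 2
      - m 0 * hδ 0 j - m 1 * hδ 1 j - m 2 * hδ 2 j - h3 + m j * (d0 + d1 + d2)
      - e j * (q 0 * hE 0 + q 1 * hE 1 + q 2 * hE 2)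
      + q j * (e 0 * hE 0 + e 1 * hE 1 + e 2 * hE 2) + q j * hu
  have c1 : ∀ k j, m k * e j - m j * e k + (q k * e j - q j * e k) = 0 := by
    intro k j
    linear_combination E 0 * h k j 0 + E 1 * h k j 1 + E 2 * h k j 2 - m k * hgE j + m j * hgE k
      - (q k * e j - q j * e k) * hu
  have c : ∀ j, (m 0 * E 0 + m 1 * E 1 + m 2 * E 2) * e j - m j
      + ((q 0 * E 0 + q 1 * E 1 + q 2 * E 2) * e j - q j) = 0 := by
    intro j
    linear_combination E 0 * c1 0 j + E 1 * c1 1 j + E 2 * c1 2 j + (m j + q j) * hu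
  have d : ∀ j, m j + (m 0 * E 0 + m 1 * E 1 + m 2 * E 2) * e j = 0 := fun j => by
    linear_combination c j - t j
  have hm : m 0 * E 0 + m 1 * E 1 + m 2 * E 2 = 0 := by
    have : 2 * (m 0 * E 0 + m 1 * E 1 + m 2 * E 2) = 0 := by
      linear_combination E 0 * d 0 + E 1 * d 1 + E 2 * d 2
        - (m 0 * E 0 + m 1 * E 1 + m 2 * E 2) * hu
    linarith
  have := d j
  rw [hm] at this
  linarith

/-- The content of the Ricci identity for the gradient `n` of the potential. -/
theorem axis_derivatives {D : Fin 3 → Fin 3 → ℝ} {a n : Fin 3 → ℝ} {α β μ ν : ℝ}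
    (hg : ∀ i j, g i j = g j i)
    (hδ : ∀ k j, H 0 k * g j 0 + H 1 k * g j 1 + H 2 k * g j 2 = if k = j then 1 else 0)
    (hE : ∀ k, H 0 k * e 0 + H 1 k * e 1 + H 2 k * e 2 = E k)
    (hgE : ∀ j, g j 0 * E 0 + g j 1 * E 1 + g j 2 * E 2 = e j)
    (hu : e 0 * E 0 + e 1 * E 1 + e 2 * E 2 = 1)
    (hD : ∀ k, D k 0 * E 0 + D k 1 * E 1 + D k 2 * E 2 = 0)
    (hν : E 0 * n 0 + E 1 * n 1 + E 2 * n 2 = ν) (hβ : E 0 * a 0 + E 1 * a 1 + E 2 * a 2 = β)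
    (hμ : 3 * α * μ = -β) (hα : α ≠ 0)
    (h : ∀ k j i, a k * g j i - 3 * a k * (e j * e i) - 3 * α * (D k j * e i + e j * D k i)
      - (a j * g k i - 3 * a j * (e k * e i) - 3 * α * (D j k * e i + e k * D j i))
      = -α * (3 * n k * (g i j - 2 * (e i * e j)) - 3 * n j * (g i k - 2 * (e i * e k))
        - 3 * ν * (g i j * e k - g i k * e j))) :
    (∀ i, a i = β * e i - 3 * α * (n i - ν * e i)) ∧
    (∀ k i, D k i = -n i * e k + (ν - μ) * (e k * e i) + μ * g k i) := by
  -- Here $a=d\alpha$, $n=dU$, $D=\nabla e$, and $b=\nabla_Ee$ is the acceleration of the axis.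
  obtain ⟨b, hb⟩ : ∃ b : Fin 3 → ℝ, ∀ k, b k = E 0 * D 0 k + E 1 * D 1 k + E 2 * D 2 k :=
    ⟨_, fun _ => rfl⟩
  have hgE' : ∀ j, E 0 * g 0 j + E 1 * g 1 j + E 2 * g 2 j = e j := fun j => by
    rw [hg 0 j, hg 1 j, hg 2 j]; linear_combination hgE j
  have hbE : b 0 * E 0 + b 1 * E 1 + b 2 * E 2 = 0 := by
    rw [hb, hb, hb]; linear_combination E 0 * hD 0 + E 1 * hD 1 + E 2 * hD 2
  -- Contraction of the Ricci identity with $E^j$; a further contraction with $E^i$ gives `hB`.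
  -- Eliminating $a$ between the two leaves $D$ in terms of $b$.
  have hA : ∀ k i, -2 * a k * e i - 3 * α * D k i - β * g k i + 3 * β * (e k * e i)
      + 3 * α * (b k * e i + e k * b i) = 3 * α * (n k * e i) - 3 * α * ν * (e i * e k) := by
    intro k i
    linear_combination E 0 * h k 0 i + E 1 * h k 1 i + E 2 * h k 2 i
      + (-a k + 3 * α * ν * e k - 3 * α * n k) * hgE' i
      + (3 * a k * e i + 3 * α * D k i + 6 * α * n k * e i - 3 * α * ν * g i k) * hu
      + 3 * α * e i * hD k
      + (g k i - 3 * e k * e i) * hβ + (-6 * α * e i * e k + 3 * α * g i k) * hν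
      + 3 * α * e i * hb k + 3 * α * e k * hb i
      + 3 * α * (n k - ν * e k) * (E 0 * hg 0 i + E 1 * hg 1 i + E 2 * hg 2 i)
  have hB : ∀ k, 3 * α * b k = 2 * a k - 2 * β * e k + 3 * α * n k - 3 * α * ν * e k := by
    intro k
    linear_combination E 0 * hA k 0 + E 1 * hA k 1 + E 2 * hA k 2
      + (2 * a k - 3 * β * e k - 3 * α * b k + 3 * α * n k - 3 * α * ν * e k) * hu
      + 3 * α * hD k + β * hgE k - 3 * α * e k * hbE
  have hC : ∀ k i, 3 * α * D k i = -β * g k i + β * (e k * e i) + 3 * α * (e k * b i) := by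
    intro k i
    linear_combination -hA k i + e i * hB k
  -- After $D$ is eliminated the rest of the Ricci identity has the shape treated above, with
  -- $m=a-\beta e+3\alpha(n-\nu e)$. The vanishing of $m$ is the formula for $d\alpha$, and it turns
  -- `hB` into $b=-(n-\nu e)$.
  have hY : ∀ k j i, (a k - β * e k + 3 * α * (n k - ν * e k)) * g j i
      - (a j - β * e j + 3 * α * (n j - ν * e j)) * g k i
      + e i * ((-3 * a k + 3 * α * b k - 6 * α * n k) * e j
        - (-3 * a j + 3 * α * b j - 6 * α * n j) * e k) = 0 := by
    intro k j i
    linear_combination h k j i + e i * hC k j + e j * hC k i - e i * hC j k - e k * hC j i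
      + 3 * α * (n k - ν * e k) * hg j i - 3 * α * (n j - ν * e j) * hg k i - β * e i * hg k j
  have hz := eq_zero_of_axis_identity hδ hE hgE hu hY
  have ha : ∀ i, a i = β * e i - 3 * α * (n i - ν * e i) := fun i => by
    linear_combination hz i
  refine ⟨ha, fun k i => ?_⟩
  apply mul_left_cancel₀ (mul_ne_zero three_ne_zero hα)
  linear_combination hC k i + e k * hB i + 2 * e k * ha i + (e k * e i - g k i) * hμ

/-- The content of the Ricci identity for the axis covector `e`. -/
theorem axis_second_derivatives {D : Fin 3 → Fin 3 → ℝ} {n dl dm : Fin 3 → ℝ} {α lam μ : ℝ}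
    (hg : ∀ i j, g i j = g j i)
    (hδ : ∀ k j, H 0 k * g j 0 + H 1 k * g j 1 + H 2 k * g j 2 = if k = j then 1 else 0)
    (hE : ∀ k, H 0 k * e 0 + H 1 k * e 1 + H 2 k * e 2 = E k)
    (hgE : ∀ j, g j 0 * E 0 + g j 1 * E 1 + g j 2 * E 2 = e j)
    (hu : e 0 * E 0 + e 1 * E 1 + e 2 * E 2 = 1)
    (hD : ∀ k i, D k i = -n i * e k + lam * (e k * e i) + μ * g k i)
    {N : Fin 3 → Fin 3 → ℝ} (hN : ∀ j i, N j i = α * g j i - 3 * α * (e j * e i) - n j * n i)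
    (h : ∀ k j i, (-(D k j * n i + e j * N k i) + dl k * (e j * e i)
        + lam * (D k j * e i + e j * D k i) + dm k * g j i)
      - (-(D j k * n i + e k * N j i) + dl j * (e k * e i)
        + lam * (D j k * e i + e k * D j i) + dm j * g k i)
      = -α * ((e k * (2 * g i j - 3 * (e i * e j)) - e j * (2 * g i k - 3 * (e i * e k)))
        - 3 * (g i j * e k - g i k * e j))) (i : Fin 3) :
    dm i = μ * lam * e i := by
  -- The unknown differential $d\lambda$ of $\lambda=\nu-\mu$ enters only through $q$, about which
  -- nothing need be known.
  have hz := eq_zero_of_axis_identity (m := fun k => dm k - μ * lam * e k)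
    (q := fun k => dl k + lam * n k) hδ hE hgE hu (fun k j i => by
      have := h k j i
      simp only [hD, hN] at this
      linear_combination this + α * e k * hg i j - α * e j * hg i k
        + (μ * n i - μ * lam * e i) * hg k j) i
  linear_combination hz

end AxisAlgebra

/-! ### Derivatives of the axis field -/

section AxisField

variable {γ : (Fin 3 → ℝ) → Matrix (Fin 3) (Fin 3) ℝ} {Ω : Set (Fin 3 → ℝ)} {x : Fin 3 → ℝ}

/-- The components of a covector field with the index raised. -/
noncomputable def raise (γ : (Fin 3 → ℝ) → Matrix (Fin 3) (Fin 3) ℝ)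
    (w : Fin 3 → (Fin 3 → ℝ) → ℝ) (k : Fin 3) (x : Fin 3 → ℝ) : ℝ :=
  ∑ l, (γ x)⁻¹ k l * w l x

/-- A smooth unit covector field `e` on `Ω` with `R = α (γ - 3 e ⊗ e)`. -/
structure IsAxisField (γ : (Fin 3 → ℝ) → Matrix (Fin 3) (Fin 3) ℝ) (Ω : Set (Fin 3 → ℝ))
    (α : (Fin 3 → ℝ) → ℝ) (e : Fin 3 → (Fin 3 → ℝ) → ℝ) : Prop where
  smooth_eig : ContDiffOn ℝ ∞ α Ω
  smooth : ∀ i, ContDiffOn ℝ ∞ (e i) Ω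
  eig_ne_zero : ∀ y ∈ Ω, α y ≠ 0
  ricci_eq : ∀ y ∈ Ω, ∀ i j, ricci γ y i j = α y * γ y i j - 3 * α y * (e i y * e j y)
  unit : ∀ y ∈ Ω, ∑ i, e i y * raise γ e i y = 1
  trace_eq_zero : ∀ y ∈ Ω, (ricciEndo γ y).trace = 0

theorem IsRiemannianMetricOn.sum_metric_raise (hγ : IsRiemannianMetricOn γ Ω) (hx : x ∈ Ω)
    (w : Fin 3 → (Fin 3 → ℝ) → ℝ) (p : Fin 3) : ∑ k, γ x p k * raise γ w k x = w p x := by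
  have h : (fun k => raise γ w k x) = (γ x)⁻¹ *ᵥ (fun l => w l x) := rfl
  have h2 : γ x *ᵥ (fun k => raise γ w k x) = fun l => w l x := by
    rw [h, Matrix.mulVec_mulVec, hγ.mul_inv hx, Matrix.one_mulVec]
  exact congrFun h2 p

theorem IsRiemannianMetricOn.smooth_raise (hγ : IsRiemannianMetricOn γ Ω)
    {w : Fin 3 → (Fin 3 → ℝ) → ℝ} (hw : ∀ i, ContDiffOn ℝ ∞ (w i) Ω) (k : Fin 3) :
    ContDiffOn ℝ ∞ (raise γ w k) Ω :=
  ContDiffOn.sum fun l _ => (hγ.smooth_inverse k l).mul (hw l)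

namespace IsAxisField

variable {α : (Fin 3 → ℝ) → ℝ} {e : Fin 3 → (Fin 3 → ℝ) → ℝ}

/-- The sum is half the derivative of $|e|^2=1$. -/
theorem sum_cov_mul_raise (hΩ : IsOpen Ω) (hγ : IsRiemannianMetricOn γ Ω)
    (he : IsAxisField γ Ω α e) (hx : x ∈ Ω) (k : Fin 3) :
    ∑ i, cov γ e k i x * raise γ e i x = 0 := by
  have hde : ∀ i, DifferentiableAt ℝ (e i) x := fun i =>
    differentiableAt_of_smooth hΩ (he.smooth i) hx
  have hdE : ∀ i, DifferentiableAt ℝ (raise γ e i) x := fun i =>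
    differentiableAt_of_smooth hΩ (hγ.smooth_raise he.smooth i) hx
  have hdg : ∀ i j, DifferentiableAt ℝ (fun y => γ y i j) x := fun i j =>
    differentiableAt_of_smooth hΩ (hγ.smooth i j) hx
  have h1 : ∑ i, (pd k (e i) x * raise γ e i x + e i x * pd k (raise γ e i) x) = 0 := by
    rw [← pd_const k (1 : ℝ) (x := x), ← pd_congr_on hΩ hx he.unit k,
      pd_sum _ fun i _ => (hde i).fun_mul (hdE i)]
    exact Finset.sum_congr rfl fun i _ => (pd_mul (hde i) (hdE i) k).symm
  -- The derivatives of the raised components enter through $e=\gamma E$, which avoids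
  -- differentiating the inverse metric; they cancel in the end.
  have h2 : ∀ i, pd k (e i) x = ∑ j, (pd k (fun y => γ y i j) x * raise γ e j x
      + γ x i j * pd k (raise γ e j) x) := by
    intro i
    rw [← pd_congr_on hΩ hx (fun y hy => hγ.sum_metric_raise hy e i) k,
      pd_sum _ fun j _ => (hdg i j).fun_mul (hdE j)]
    exact Finset.sum_congr rfl fun j _ => pd_mul (hdg i j) (hdE j) k
  have l : ∀ j, γ x j 0 * raise γ e 0 x + γ x j 1 * raise γ e 1 x + γ x j 2 * raise γ e 2 x
      = e j x := fun j => by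
    rw [← hγ.sum_metric_raise hx e j, Fin.sum_univ_three]
  have l' : ∀ j, γ x 0 j * raise γ e 0 x + γ x 1 j * raise γ e 1 x + γ x 2 j * raise γ e 2 x
      = e j x := fun j => by
    rw [← l j, hγ.symm hx 0 j, hγ.symm hx 1 j, hγ.symm hx 2 j]
  simp only [hγ.pd_metric hΩ hx, Fin.sum_univ_three, cov] at h1 h2 ⊢
  generalize raise γ e 0 = E0 at *
  generalize raise γ e 1 = E1 at *
  generalize raise γ e 2 = E2 at *
  linear_combination (1 / 2) * (h1 + E0 x * h2 0 + E1 x * h2 1 + E2 x * h2 2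
    + pd k E0 x * l' 0 + pd k E1 x * l' 1 + pd k E2 x * l' 2
    + (E0 x * christoffel γ 0 k 0 x + E1 x * christoffel γ 0 k 1 x + E2 x * christoffel γ 0 k 2 x)
      * (l 0 + l' 0)
    + (E0 x * christoffel γ 1 k 0 x + E1 x * christoffel γ 1 k 1 x + E2 x * christoffel γ 1 k 2 x)
      * (l 1 + l' 1)
    + (E0 x * christoffel γ 2 k 0 x + E1 x * christoffel γ 2 k 1 x + E2 x * christoffel γ 2 k 2 x)
      * (l 2 + l' 2))

/-- The right-hand side of the Ricci identity for an arbitrary covector: the curvature is replaced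
by its expression through $R=\alpha(\gamma-3e\otimes e)$. It is used for $w=dU$ and for $w=e$. -/
theorem sum_riemann_mul (hΩ : IsOpen Ω) (hγ : IsRiemannianMetricOn γ Ω)
    (he : IsAxisField γ Ω α e) (hx : x ∈ Ω) (w : Fin 3 → ℝ) (k j i : Fin 3) :
    ∑ m, riemann γ m i k j x * w m
      = α x * ((w k * (2 * γ x i j - 3 * (e i x * e j x)) - w j * (2 * γ x i k - 3 * (e i x * e k x)))
        - 3 * (∑ m, raise γ e m x * w m) * (γ x i j * e k x - γ x i k * e j x)) := by
  have hinv := hγ.inv_symm hx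
  set W : Fin 3 → ℝ := fun p => ∑ m, (γ x)⁻¹ p m * w m with hW
  have h1 : ∑ m, riemann γ m i k j x * w m = ∑ p, W p * riemannLow γ p i k j x := by
    simp only [hγ.riemann_eq_sum_low hx, hW, Finset.sum_mul]
    rw [Finset.sum_comm]
    refine Finset.sum_congr rfl fun p _ => Finset.sum_congr rfl fun m _ => ?_
    rw [hinv m p]; ring
  have h2 : ∑ m, raise γ e m x * w m = ∑ p, W p * e p x := by
    simp only [raise, hW, Finset.sum_mul]
    rw [Finset.sum_comm]
    refine Finset.sum_congr rfl fun p _ => Finset.sum_congr rfl fun m _ => ?_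
    rw [hinv m p]; ring
  have h3 : ∀ q, ∑ p, γ x p q * W p = w q := by
    intro q
    have : W = (γ x)⁻¹ *ᵥ w := rfl
    have h4 : γ x *ᵥ W = w := by
      rw [this, Matrix.mulVec_mulVec, hγ.mul_inv hx, Matrix.one_mulVec]
    rw [← congrFun h4 q, Matrix.mulVec, dotProduct]
    exact Finset.sum_congr rfl fun p _ => by rw [hγ.symm hx p q]
  rw [h1, h2]
  simp only [hγ.riemannLow_dim_three hΩ hx (he.trace_eq_zero x hx), he.ricci_eq x hx,
    Fin.sum_univ_three] at h3 ⊢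
  linear_combination (2 * α x * γ x i j - 3 * α x * (e i x * e j x)) * h3 k
    - (2 * α x * γ x i k - 3 * α x * (e i x * e k x)) * h3 j

/-- The derivative of a function along the axis. -/
noncomputable def axisDeriv (γ : (Fin 3 → ℝ) → Matrix (Fin 3) (Fin 3) ℝ)
    (e : Fin 3 → (Fin 3 → ℝ) → ℝ) (f : (Fin 3 → ℝ) → ℝ) (x : Fin 3 → ℝ) : ℝ :=
  ∑ i, raise γ e i x * pd i f x

/-- Half the expansion of the axis field. -/
noncomputable def halfExp (γ : (Fin 3 → ℝ) → Matrix (Fin 3) (Fin 3) ℝ) (α : (Fin 3 → ℝ) → ℝ)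
    (e : Fin 3 → (Fin 3 → ℝ) → ℝ) (x : Fin 3 → ℝ) : ℝ :=
  -axisDeriv γ e α x / (3 * α x)

theorem smooth_axisDeriv (hΩ : IsOpen Ω) (hγ : IsRiemannianMetricOn γ Ω)
    (he : IsAxisField γ Ω α e) {f : (Fin 3 → ℝ) → ℝ} (hf : ContDiffOn ℝ ∞ f Ω) :
    ContDiffOn ℝ ∞ (axisDeriv γ e f) Ω :=
  ContDiffOn.sum fun i _ => (hγ.smooth_raise he.smooth i).mul (smooth_pd hΩ hf i)

theorem smooth_halfExp (hΩ : IsOpen Ω) (hγ : IsRiemannianMetricOn γ Ω)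
    (he : IsAxisField γ Ω α e) : ContDiffOn ℝ ∞ (halfExp γ α e) Ω :=
  ((he.smooth_axisDeriv hΩ hγ he.smooth_eig).neg).div (contDiffOn_const.mul he.smooth_eig)
    fun y hy => mul_ne_zero three_ne_zero (he.eig_ne_zero y hy)

variable {U : (Fin 3 → ℝ) → ℝ}

theorem pointwise_relations (hγ : IsRiemannianMetricOn γ Ω) (he : IsAxisField γ Ω α e)
    (hx : x ∈ Ω) :
    (∀ k j, (γ x)⁻¹ 0 k * γ x j 0 + (γ x)⁻¹ 1 k * γ x j 1 + (γ x)⁻¹ 2 k * γ x j 2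
      = if k = j then 1 else 0) ∧
    (∀ k, (γ x)⁻¹ 0 k * e 0 x + (γ x)⁻¹ 1 k * e 1 x + (γ x)⁻¹ 2 k * e 2 x = raise γ e k x) ∧
    (∀ j, γ x j 0 * raise γ e 0 x + γ x j 1 * raise γ e 1 x + γ x j 2 * raise γ e 2 x = e j x) ∧
    e 0 x * raise γ e 0 x + e 1 x * raise γ e 1 x + e 2 x * raise γ e 2 x = 1 := by
  refine ⟨fun k j => ?_, fun k => ?_, fun j => ?_, ?_⟩
  · have h := congrFun (congrFun (hγ.mul_inv hx) j) k
    rw [Matrix.mul_apply, Fin.sum_univ_three, Matrix.one_apply] at h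
    simp only [eq_comm (a := k)]
    rw [← h]; ring
  · rw [raise, Fin.sum_univ_three, hγ.inv_symm hx 0, hγ.inv_symm hx 1, hγ.inv_symm hx 2]
  · rw [← hγ.sum_metric_raise hx e j, Fin.sum_univ_three]
  · rw [← he.unit x hx, Fin.sum_univ_three]

/-- The vacuum equation prescribes $\nabla dU$ algebraically, so the Ricci identity for $dU$ is its
integrability condition, of first order in $\alpha$ and $e$. -/
theorem first_derivatives (hΩ : IsOpen Ω) (hγ : IsRiemannianMetricOn γ Ω)
    (he : IsAxisField γ Ω α e) (hU : ContDiffOn ℝ ∞ U Ω)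
    (hR : ∀ y ∈ Ω, ricci γ y = lapse γ U y) (hx : x ∈ Ω) :
    (∀ i, pd i α x = axisDeriv γ e α x * e i x
      - 3 * α x * (pd i U x - axisDeriv γ e U x * e i x)) ∧
    (∀ k i, cov γ e k i x = -pd i U x * e k x
      + (axisDeriv γ e U x - halfExp γ α e x) * (e k x * e i x) + halfExp γ α e x * γ x k i) := by
  have hn : ∀ i, ContDiffOn ℝ ∞ (pd i U) Ω := smooth_pd hΩ hU
  have hdn : ∀ i, DifferentiableAt ℝ (pd i U) x := fun i => differentiableAt_of_smooth hΩ (hn i) hx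
  have hde : ∀ i, DifferentiableAt ℝ (e i) x := fun i =>
    differentiableAt_of_smooth hΩ (he.smooth i) hx
  have hdα : DifferentiableAt ℝ α x := differentiableAt_of_smooth hΩ he.smooth_eig hx
  have hdg : ∀ i j, DifferentiableAt ℝ (fun y => γ y i j) x := fun i j =>
    differentiableAt_of_smooth hΩ (hγ.smooth i j) hx
  -- The vacuum equation solved for $\nabla dU$, with each term written as a function times $\gamma$
  -- or times a product of covectors, ready for the Leibniz rules.
  have hH : ∀ j i, ∀ y ∈ Ω, cov γ (fun i => pd i U) j i y = α y * γ y j i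
      + -3 * α y * (e j y * e i y) + -1 * (pd j U y * pd i U y) := by
    intro j i y hy
    have h1 := he.ricci_eq y hy j i
    rw [hR y hy] at h1
    simp only [lapse, hessian, Matrix.of_apply] at h1
    rw [cov]; linarith
  have hcov2 : ∀ k j i, cov2 γ (cov γ fun i => pd i U) k j i x
      = pd k α x * γ x j i + (-3 * pd k α x * (e j x * e i x)
        + -3 * α x * (cov γ e k j x * e i x + e j x * cov γ e k i x))
        + (0 * (pd j U x * pd i U x) + -1 * (cov γ (fun i => pd i U) k j x * pd i U x
          + pd j U x * cov γ (fun i => pd i U) k i x)) := by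
    intro k j i
    have hd1 : ∀ j i, DifferentiableAt ℝ (fun y => α y * γ y j i) x := fun j i =>
      hdα.fun_mul (hdg j i)
    have hd3 : DifferentiableAt ℝ (fun y => -3 * α y) x := hdα.const_mul _
    have hd2 : ∀ j i, DifferentiableAt ℝ (fun y => -3 * α y * (e j y * e i y)) x := fun j i =>
      hd3.fun_mul ((hde j).fun_mul (hde i))
    have hd4 : ∀ j i, DifferentiableAt ℝ (fun y => -1 * (pd j U y * pd i U y)) x := fun j i =>
      ((hdn j).fun_mul (hdn i)).const_mul _
    rw [cov2_congr_on hΩ hx hH, cov2_add (fun j i => (hd1 j i).fun_add (hd2 j i)) hd4,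
      cov2_add hd1 hd2, hγ.cov2_metric hΩ hx hdα, cov2_outer hd3 hde hde,
      cov2_outer (differentiableAt_const _) hdn hdn, pd_const_mul _ hdα, pd_const]
  obtain ⟨hδ, hE, hgE, hu⟩ := he.pointwise_relations hγ hx
  have hα := he.eig_ne_zero x hx
  refine axis_derivatives (H := (γ x)⁻¹) (E := fun i => raise γ e i x) (hγ.symm hx) hδ hE hgE hu
    (fun k => ?_) ?_ ?_ ?_ hα (fun k j i => ?_)
  · have := he.sum_cov_mul_raise hΩ hγ hx k
    rwa [Fin.sum_univ_three] at this
  · rw [axisDeriv, Fin.sum_univ_three]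
  · rw [axisDeriv, Fin.sum_univ_three]
  · rw [halfExp]; field_simp
  · have hr := hγ.ricci_identity hΩ hx hn k j i
    rw [he.sum_riemann_mul hΩ hγ hx, hcov2, hcov2] at hr
    have hν : ∑ m, raise γ e m x * pd m U x = axisDeriv γ e U x := rfl
    rw [hν] at hr
    simp only [fun k j => hH k j x hx] at hr
    linear_combination hr + α x * pd k U x * hγ.symm hx i j - α x * pd j U x * hγ.symm hx i k
      - α x * pd i U x * hγ.symm hx j k

/-- The second integrability condition: $\nabla e$ is now known, and the Ricci identity for $e$
determines $d\mu$. -/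
theorem pd_halfExp (hΩ : IsOpen Ω) (hγ : IsRiemannianMetricOn γ Ω)
    (he : IsAxisField γ Ω α e) (hU : ContDiffOn ℝ ∞ U Ω)
    (hR : ∀ y ∈ Ω, ricci γ y = lapse γ U y) (hx : x ∈ Ω) (i : Fin 3) :
    pd i (halfExp γ α e) x
      = halfExp γ α e x * (axisDeriv γ e U x - halfExp γ α e x) * e i x := by
  have hn : ∀ i, ContDiffOn ℝ ∞ (pd i U) Ω := smooth_pd hΩ hU
  have hdn : ∀ i, DifferentiableAt ℝ (pd i U) x := fun i => differentiableAt_of_smooth hΩ (hn i) hx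
  have hde : ∀ i, DifferentiableAt ℝ (e i) x := fun i =>
    differentiableAt_of_smooth hΩ (he.smooth i) hx
  have hdμ : DifferentiableAt ℝ (halfExp γ α e) x :=
    differentiableAt_of_smooth hΩ (he.smooth_halfExp hΩ hγ) hx
  have hdl : DifferentiableAt ℝ (fun y => axisDeriv γ e U y - halfExp γ α e y) x :=
    (differentiableAt_of_smooth hΩ (he.smooth_axisDeriv hΩ hγ hU) hx).fun_sub hdμ
  have hdg : ∀ i j, DifferentiableAt ℝ (fun y => γ y i j) x := fun i j =>
    differentiableAt_of_smooth hΩ (hγ.smooth i j) hx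
  have hD := fun y (hy : y ∈ Ω) => (he.first_derivatives hΩ hγ hU hR hy).2
  have hD' : ∀ k i, ∀ y ∈ Ω, cov γ e k i y = -1 * (e k y * pd i U y)
      + (axisDeriv γ e U y - halfExp γ α e y) * (e k y * e i y)
      + halfExp γ α e y * γ y k i := fun k i y hy => by
    rw [hD y hy]; ring
  have hcov2 : ∀ k j i, cov2 γ (cov γ e) k j i x
      = (0 * (e j x * pd i U x) + -1 * (cov γ e k j x * pd i U x
          + e j x * cov γ (fun i => pd i U) k i x))
        + (pd k (fun y => axisDeriv γ e U y - halfExp γ α e y) x * (e j x * e i x)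
          + (axisDeriv γ e U x - halfExp γ α e x)
            * (cov γ e k j x * e i x + e j x * cov γ e k i x))
        + pd k (halfExp γ α e) x * γ x j i := by
    intro k j i
    have hd1 : ∀ j i, DifferentiableAt ℝ (fun y => -1 * (e j y * pd i U y)) x := fun j i =>
      ((hde j).fun_mul (hdn i)).const_mul _
    have hd2 : ∀ j i, DifferentiableAt ℝ (fun y =>
        (axisDeriv γ e U y - halfExp γ α e y) * (e j y * e i y)) x := fun j i =>
      hdl.fun_mul ((hde j).fun_mul (hde i))
    have hd3 : ∀ j i, DifferentiableAt ℝ (fun y => halfExp γ α e y * γ y j i) x := fun j i =>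
      hdμ.fun_mul (hdg j i)
    rw [cov2_congr_on hΩ hx hD', cov2_add (fun j i => (hd1 j i).fun_add (hd2 j i)) hd3,
      cov2_add hd1 hd2, hγ.cov2_metric hΩ hx hdμ, cov2_outer hdl hde hde,
      cov2_outer (differentiableAt_const _) hde hdn, pd_const]
  obtain ⟨hδ, hE, hgE, hu⟩ := he.pointwise_relations hγ hx
  refine axis_second_derivatives (H := (γ x)⁻¹) (E := fun i => raise γ e i x) (α := α x)
    (n := fun i => pd i U x) (D := fun k i => cov γ e k i x)
    (N := fun k i => cov γ (fun i => pd i U) k i x) (dm := fun i => pd i (halfExp γ α e) x)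
    (dl := fun k => pd k (fun y => axisDeriv γ e U y - halfExp γ α e y) x)
    (hγ.symm hx) hδ hE hgE hu (fun k i => hD x hx k i) (fun j i => ?_) (fun k j i => ?_) i
  · have h1 := he.ricci_eq x hx j i
    rw [hR x hx] at h1
    simp only [lapse, hessian, Matrix.of_apply] at h1
    rw [cov]; linarith
  · have hr := hγ.ricci_identity hΩ hx he.smooth k j i
    rw [he.sum_riemann_mul hΩ hγ hx, hcov2, hcov2] at hr
    have hν : ∑ m, raise γ e m x * e m x = 1 := by
      rw [← he.unit x hx]
      exact Finset.sum_congr rfl fun m _ => mul_comm _ _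
    rw [hν] at hr
    linear_combination hr

end IsAxisField

end AxisField

/-! ### The invariants $s$, $t$, $P$, $V$ in terms of the axis -/

section Invariants

variable {γ : (Fin 3 → ℝ) → Matrix (Fin 3) (Fin 3) ℝ} {Ω : Set (Fin 3 → ℝ)} {x : Fin 3 → ℝ}

theorem smooth_matMul {n m : ℕ} {S : Set (Fin n → ℝ)}
    {A B : (Fin n → ℝ) → Matrix (Fin m) (Fin m) ℝ}
    (hA : ∀ i j, ContDiffOn ℝ ∞ (fun y => A y i j) S)
    (hB : ∀ i j, ContDiffOn ℝ ∞ (fun y => B y i j) S) (i j : Fin m) :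
    ContDiffOn ℝ ∞ (fun y => (A y * B y) i j) S := by
  simp only [Matrix.mul_apply]
  exact ContDiffOn.sum fun k _ => (hA i k).mul (hB k j)

theorem smooth_trace {n m : ℕ} {S : Set (Fin n → ℝ)}
    {A : (Fin n → ℝ) → Matrix (Fin m) (Fin m) ℝ}
    (hA : ∀ i j, ContDiffOn ℝ ∞ (fun y => A y i j) S) :
    ContDiffOn ℝ ∞ (fun y => (A y).trace) S := by
  simp only [Matrix.trace, Matrix.diag_apply]
  exact ContDiffOn.sum fun k _ => hA k k

theorem smooth_ricciEndo (hΩ : IsOpen Ω) (hγ : IsRiemannianMetricOn γ Ω) (i j : Fin 3) :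
    ContDiffOn ℝ ∞ (fun y => ricciEndo γ y i j) Ω :=
  smooth_matMul hγ.smooth_inverse (hγ.smooth_ricci hΩ) i j

theorem smooth_ricciEndo_sq (hΩ : IsOpen Ω) (hγ : IsRiemannianMetricOn γ Ω) (i j : Fin 3) :
    ContDiffOn ℝ ∞ (fun y => (ricciEndo γ y ^ 2) i j) Ω := by
  simp only [pow_two]
  exact smooth_matMul (smooth_ricciEndo hΩ hγ) (smooth_ricciEndo hΩ hγ) i j

theorem smooth_sInv (hΩ : IsOpen Ω) (hγ : IsRiemannianMetricOn γ Ω) :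
    ContDiffOn ℝ ∞ (sInv γ) Ω :=
  smooth_trace (smooth_ricciEndo_sq hΩ hγ)

theorem smooth_tInv (hΩ : IsOpen Ω) (hγ : IsRiemannianMetricOn γ Ω) :
    ContDiffOn ℝ ∞ (tInv γ) Ω := by
  refine smooth_trace fun i j => ?_
  simp only [pow_succ _ 2]
  exact smooth_matMul (smooth_ricciEndo_sq hΩ hγ) (smooth_ricciEndo hΩ hγ) i j

/-- The double eigenvalue of a Ricci endomorphism of type D. -/
noncomputable def eig (γ : (Fin 3 → ℝ) → Matrix (Fin 3) (Fin 3) ℝ) (x : Fin 3 → ℝ) : ℝ :=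
  -tInv γ x / sInv γ x

/-- The Ricci endomorphism is trace-free, non-zero, and has a double eigenvalue. -/
def IsRicciTypeD (γ : (Fin 3 → ℝ) → Matrix (Fin 3) (Fin 3) ℝ) (x : Fin 3 → ℝ) : Prop :=
  (ricciEndo γ x).trace = 0 ∧ 6 * tInv γ x ^ 2 = sInv γ x ^ 3 ∧ sInv γ x ≠ 0

/-- `e` is a unit covector that spans the axis of the Ricci tensor at `x`. -/
def IsAxisAt (γ : (Fin 3 → ℝ) → Matrix (Fin 3) (Fin 3) ℝ) (x e : Fin 3 → ℝ) : Prop :=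
  ricci γ x = eig γ x • (γ x - (3 : ℝ) • Matrix.vecMulVec e e) ∧ e ⬝ᵥ ((γ x)⁻¹ *ᵥ e) = 1

theorem smooth_eig (hΩ : IsOpen Ω) (hγ : IsRiemannianMetricOn γ Ω)
    (hD : ∀ y ∈ Ω, IsRicciTypeD γ y) : ContDiffOn ℝ ∞ (eig γ) Ω :=
  (smooth_tInv hΩ hγ).neg.div (smooth_sInv hΩ hγ) fun y hy => (hD y hy).2.2

theorem exists_isAxisAt (hΩ : IsOpen Ω) (hγ : IsRiemannianMetricOn γ Ω) (hx : x ∈ Ω)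
    (hD : IsRicciTypeD γ x) : eig γ x ≠ 0 ∧ ∃ e, IsAxisAt γ x e :=
  exists_axis_of_discriminant (hγ.posDef x hx)
    (Matrix.ext fun i j => hγ.ricci_symm hΩ hx j i) hD.1 rfl rfl hD.2.1 hD.2.2 rfl

theorem IsAxisAt.sInv_eq (hγ : IsRiemannianMetricOn γ Ω) (hx : x ∈ Ω) {e : Fin 3 → ℝ}
    (he : IsAxisAt γ x e) : sInv γ x = 6 * eig γ x ^ 2 :=
  (invariants_of_axis (hγ.posDef x hx) he.1 he.2).1

theorem IsAxisAt.PUp_mulVec (hγ : IsRiemannianMetricOn γ Ω) (hx : x ∈ Ω) {e : Fin 3 → ℝ}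
    (he : IsAxisAt γ x e) (w : Fin 3 → ℝ) :
    PUp γ x *ᵥ w = (18 * eig γ x ^ 2 * (((γ x)⁻¹ *ᵥ e) ⬝ᵥ w)) • ((γ x)⁻¹ *ᵥ e) := by
  have h : PUp γ x = (18 * eig γ x ^ 2) • Matrix.vecMulVec ((γ x)⁻¹ *ᵥ e) ((γ x)⁻¹ *ᵥ e) := by
    rw [PUp, he.sInv_eq hγ hx]
    exact (invariants_of_axis (hγ.posDef x hx) he.1 he.2).2
  rw [h, Matrix.smul_mulVec, Matrix.vecMulVec_mulVec]
  ext i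
  simp
  ring

theorem sInv_eq_of_typeD (hΩ : IsOpen Ω) (hγ : IsRiemannianMetricOn γ Ω) (hx : x ∈ Ω)
    (hD : IsRicciTypeD γ x) : sInv γ x = 6 * eig γ x ^ 2 := by
  obtain ⟨-, e, he⟩ := exists_isAxisAt hΩ hγ hx hD
  exact he.sInv_eq hγ hx

theorem sInv_pos_of_typeD (hΩ : IsOpen Ω) (hγ : IsRiemannianMetricOn γ Ω) (hx : x ∈ Ω)
    (hD : IsRicciTypeD γ x) : 0 < sInv γ x := by
  have h := (exists_isAxisAt hΩ hγ hx hD).1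
  rw [sInv_eq_of_typeD hΩ hγ hx hD]; positivity

theorem pd_sInv (hΩ : IsOpen Ω) (hγ : IsRiemannianMetricOn γ Ω) (hx : x ∈ Ω)
    (hD : ∀ y ∈ Ω, IsRicciTypeD γ y) (i : Fin 3) :
    pd i (sInv γ) x = 12 * eig γ x * pd i (eig γ) x := by
  have hd := differentiableAt_of_smooth hΩ (smooth_eig hΩ hγ hD) hx
  rw [pd_congr_on hΩ hx (fun y hy => sInv_eq_of_typeD hΩ hγ hy (hD y hy)) i]
  have hφ : HasDerivAt (fun t : ℝ => 6 * t ^ 2) (12 * eig γ x) (eig γ x) :=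
    ((hasDerivAt_pow 2 (eig γ x)).const_mul 6).congr_deriv (by norm_num; ring)
  exact pd_comp hφ hd i

/-- Locally the axis of the Ricci tensor is spanned by a smooth field. -/
theorem exists_isAxisField (hΩ : IsOpen Ω) (hγ : IsRiemannianMetricOn γ Ω)
    (hD : ∀ y ∈ Ω, IsRicciTypeD γ y) (hx : x ∈ Ω) :
    ∃ Ω' : Set (Fin 3 → ℝ), IsOpen Ω' ∧ Ω' ⊆ Ω ∧ x ∈ Ω' ∧
      ∃ e : Fin 3 → (Fin 3 → ℝ) → ℝ, IsAxisField γ Ω' (eig γ) e := by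
  -- The tensor $p=\tfrac13(\gamma-R/\alpha)$ equals $e\otimes e$. Unlike $e$ it is free of a choice
  -- of sign, so it is smooth on all of $\Omega$.
  obtain ⟨p, hp⟩ : ∃ p : Fin 3 → Fin 3 → (Fin 3 → ℝ) → ℝ, p = fun i j y =>
    (1 / 3 : ℝ) * (γ y i j - ricci γ y i j / eig γ y) := ⟨_, rfl⟩
  have hα : ∀ y ∈ Ω, eig γ y ≠ 0 := fun y hy => (exists_isAxisAt hΩ hγ hy (hD y hy)).1
  have hps : ∀ i j, ContDiffOn ℝ ∞ (p i j) Ω := fun i j => by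
    rw [hp]
    exact contDiffOn_const.mul ((hγ.smooth i j).sub
      ((hγ.smooth_ricci hΩ i j).div (smooth_eig hΩ hγ hD) hα))
  have hpe : ∀ y ∈ Ω, ∀ f, IsAxisAt γ y f → ∀ i j, p i j y = f i * f j := by
    intro y hy f hf i j
    have h := congrFun (congrFun hf.1 i) j
    simp only [Matrix.smul_apply, Matrix.sub_apply, Matrix.vecMulVec_apply, smul_eq_mul] at h
    rw [hp]
    simp only [h]
    have := hα y hy
    field_simp
    ring
  obtain ⟨f, hf⟩ := (exists_isAxisAt hΩ hγ hx (hD x hx)).2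
  -- Where $p_{qq}=e_q^2>0$, the column $p_{iq}/\sqrt{p_{qq}}$ is the axis covector with the sign
  -- that makes $e_q>0$. This fixes the sign only locally.
  obtain ⟨q, hq⟩ : ∃ q, f q ≠ 0 := by
    by_contra! h
    have : f = 0 := funext h
    have h2 := hf.2
    rw [this] at h2
    simp at h2
  have hopen : IsOpen (Ω ∩ p q q ⁻¹' Set.Ioi 0) :=
    (hps q q).continuousOn.isOpen_inter_preimage hΩ isOpen_Ioi
  refine ⟨Ω ∩ p q q ⁻¹' Set.Ioi 0, hopen, Set.inter_subset_left, ⟨hx, ?_⟩,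
    fun i y => p i q y / Real.sqrt (p q q y), ?_⟩
  · show 0 < p q q x
    rw [hpe x hx f hf]
    exact mul_self_pos.2 hq
  have hprod : ∀ y ∈ Ω ∩ p q q ⁻¹' Set.Ioi 0, ∀ f, IsAxisAt γ y f → ∀ i j,
      p i q y / Real.sqrt (p q q y) * (p j q y / Real.sqrt (p q q y)) = f i * f j := by
    intro y hy f hf i j
    have hpos : 0 < p q q y := hy.2
    rw [div_mul_div_comm, Real.mul_self_sqrt hpos.le]
    rw [hpe y hy.1 f hf] at hpos
    simp only [hpe y hy.1 f hf]
    have : f q ≠ 0 := by rintro h; simp [h] at hpos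
    field_simp
  refine ⟨(smooth_eig hΩ hγ hD).mono Set.inter_subset_left, fun i => ?_, fun y hy => hα y hy.1,
    fun y hy i j => ?_, fun y hy => ?_, fun y hy => (hD y hy.1).1⟩
  · exact ((hps i q).mono Set.inter_subset_left).div
      (((hps q q).mono Set.inter_subset_left).sqrt fun y hy => (ne_of_gt hy.2))
      fun y hy => (Real.sqrt_pos.2 hy.2).ne'
  · obtain ⟨f, hf⟩ := (exists_isAxisAt hΩ hγ hy.1 (hD y hy.1)).2
    rw [hprod y hy f hf]
    have h := congrFun (congrFun hf.1 i) j
    simp only [Matrix.smul_apply, Matrix.sub_apply, Matrix.vecMulVec_apply, smul_eq_mul] at h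
    rw [h]; ring
  · obtain ⟨f, hf⟩ := (exists_isAxisAt hΩ hγ hy.1 (hD y hy.1)).2
    have h := hprod y hy f hf
    rw [← hf.2, dotProduct]
    refine Finset.sum_congr rfl fun i _ => ?_
    simp only [raise, Matrix.mulVec, dotProduct, Finset.mul_sum]
    refine Finset.sum_congr rfl fun j _ => ?_
    linear_combination (γ y)⁻¹ i j * h i j

theorem IsAxisField.isAxisAt {e : Fin 3 → (Fin 3 → ℝ) → ℝ}
    (he : IsAxisField γ Ω (eig γ) e) (hx : x ∈ Ω) : IsAxisAt γ x fun i => e i x := by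
  refine ⟨Matrix.ext fun i j => ?_, ?_⟩
  · rw [he.ricci_eq x hx]
    simp [Matrix.vecMulVec_apply]; ring
  · exact he.unit x hx

/-- The square of `V`. -/
noncomputable def VSq (γ : (Fin 3 → ℝ) → Matrix (Fin 3) (Fin 3) ℝ) (x : Fin 3 → ℝ) : ℝ :=
  diff (fun y => sInv γ y ^ (-(2 / 3) : ℝ)) x ⬝ᵥ
    (PUp γ x *ᵥ diff (fun y => sInv γ y ^ (-(2 / 3) : ℝ)) x)

theorem V_eq_sqrt : V γ x = Real.sqrt (VSq γ x) := rfl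

theorem diff_sInv_rpow (hΩ : IsOpen Ω) (hγ : IsRiemannianMetricOn γ Ω) (hx : x ∈ Ω)
    (hs : sInv γ x ≠ 0) : diff (fun y => sInv γ y ^ (-(2 / 3) : ℝ)) x
      = (-(2 / 3) * sInv γ x ^ (-(2 / 3) - 1 : ℝ)) • diff (sInv γ) x := by
  funext i
  simp only [diff, Pi.smul_apply, smul_eq_mul]
  exact pd_comp (Real.hasDerivAt_rpow_const (Or.inl hs))
    (differentiableAt_of_smooth hΩ (smooth_sInv hΩ hγ) hx) i

/-- $P=18\alpha^2E\otimes E$, and $ds^{-2/3}=-\tfrac23s^{-5/3}ds$ contributes the factor $\tfrac49$.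
-/
theorem IsAxisAt.VSq_eq (hΩ : IsOpen Ω) (hγ : IsRiemannianMetricOn γ Ω) (hx : x ∈ Ω)
    (hs : sInv γ x ≠ 0) {e : Fin 3 → ℝ} (he : IsAxisAt γ x e) :
    VSq γ x = 8 * eig γ x ^ 2 * (sInv γ x ^ (-(2 / 3) - 1 : ℝ)) ^ 2
      * (((γ x)⁻¹ *ᵥ e) ⬝ᵥ diff (sInv γ) x) ^ 2 := by
  rw [VSq, diff_sInv_rpow hΩ hγ hx hs, he.PUp_mulVec hγ hx, dotProduct_smul, dotProduct_smul,
    smul_dotProduct, dotProduct_comm (diff (sInv γ) x)]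
  simp only [smul_eq_mul]
  ring

theorem VSq_pos (hΩ : IsOpen Ω) (hγ : IsRiemannianMetricOn γ Ω) (hx : x ∈ Ω)
    (hD : IsRicciTypeD γ x) (hP : PUp γ x *ᵥ diff (sInv γ) x ≠ 0) : 0 < VSq γ x := by
  obtain ⟨hα, e, he⟩ := exists_isAxisAt hΩ hγ hx hD
  have hs := sInv_pos_of_typeD hΩ hγ hx hD
  rw [he.VSq_eq hΩ hγ hx hD.2.2]
  have hne : ((γ x)⁻¹ *ᵥ e) ⬝ᵥ diff (sInv γ) x ≠ 0 := by
    intro h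
    rw [he.PUp_mulVec hγ hx, h] at hP
    simp at hP
  have := Real.rpow_pos_of_pos hs (-(2 / 3) - 1)
  positivity

theorem smooth_VSq (hΩ : IsOpen Ω) (hγ : IsRiemannianMetricOn γ Ω)
    (hD : ∀ y ∈ Ω, IsRicciTypeD γ y) : ContDiffOn ℝ ∞ (VSq γ) Ω := by
  have h1 : ContDiffOn ℝ ∞ (fun y => sInv γ y ^ (-(2 / 3) : ℝ)) Ω :=
    (smooth_sInv hΩ hγ).rpow_const_of_ne fun y hy => (hD y hy).2.2
  have h2 : ∀ i j, ContDiffOn ℝ ∞ (fun y => PUp γ y i j) Ω := by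
    refine smooth_matMul (fun i j => ?_) hγ.smooth_inverse
    simp only [Matrix.sub_apply, Matrix.smul_apply, smul_eq_mul]
    exact (contDiffOn_const.mul (smooth_ricciEndo_sq hΩ hγ i j)).sub
      ((smooth_sInv hΩ hγ).mul contDiffOn_const)
  unfold VSq
  simp only [dotProduct, Matrix.mulVec, diff]
  exact ContDiffOn.sum fun i _ => (smooth_pd hΩ h1 i).mul
    (ContDiffOn.sum fun j _ => (h2 i j).mul (smooth_pd hΩ h1 j))

theorem V_pos (hΩ : IsOpen Ω) (hγ : IsRiemannianMetricOn γ Ω) (hx : x ∈ Ω)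
    (hD : IsRicciTypeD γ x) (hP : PUp γ x *ᵥ diff (sInv γ) x ≠ 0) : 0 < V γ x :=
  Real.sqrt_pos.2 (VSq_pos hΩ hγ hx hD hP)

theorem smooth_V (hΩ : IsOpen Ω) (hγ : IsRiemannianMetricOn γ Ω)
    (hD : ∀ y ∈ Ω, IsRicciTypeD γ y) (hP : ∀ y ∈ Ω, PUp γ y *ᵥ diff (sInv γ) y ≠ 0) :
    ContDiffOn ℝ ∞ (V γ) Ω :=
  (smooth_VSq hΩ hγ hD).sqrt fun y hy => (VSq_pos hΩ hγ hy (hD y hy) (hP y hy)).ne'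

/-- From $s=6\alpha^2$ one has $E(s)=12\alpha E(\alpha)=-36\alpha^2\mu$, and
$8\cdot36^2\alpha^6=48(6\alpha^2)^3=48s^3$. -/
theorem IsAxisField.VSq_eq (hΩ : IsOpen Ω) (hγ : IsRiemannianMetricOn γ Ω)
    (hD : ∀ y ∈ Ω, IsRicciTypeD γ y) {e : Fin 3 → (Fin 3 → ℝ) → ℝ}
    (he : IsAxisField γ Ω (eig γ) e) (hx : x ∈ Ω) :
    VSq γ x = 48 * sInv γ x ^ (-(1 / 3) : ℝ) * IsAxisField.halfExp γ (eig γ) e x ^ 2 := by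
  have hα := he.eig_ne_zero x hx
  have hs := sInv_pos_of_typeD hΩ hγ hx (hD x hx)
  have hs6 := sInv_eq_of_typeD hΩ hγ hx (hD x hx)
  have h1 : ((γ x)⁻¹ *ᵥ fun i => e i x) ⬝ᵥ diff (sInv γ) x
      = 12 * eig γ x * IsAxisField.axisDeriv γ e (eig γ) x := by
    rw [dotProduct, IsAxisField.axisDeriv, Finset.mul_sum]
    refine Finset.sum_congr rfl fun i _ => ?_
    rw [diff, pd_sInv hΩ hγ hx hD]
    simp only [raise, Matrix.mulVec, dotProduct]
    ring
  have h2 : IsAxisField.axisDeriv γ e (eig γ) x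
      = -3 * eig γ x * IsAxisField.halfExp γ (eig γ) e x := by
    rw [IsAxisField.halfExp]; field_simp
  have h3 : (sInv γ x ^ (-(2 / 3) - 1 : ℝ)) ^ 2 * sInv γ x ^ 3 = sInv γ x ^ (-(1 / 3) : ℝ) := by
    rw [← Real.rpow_natCast, ← Real.rpow_natCast, ← Real.rpow_mul hs.le, ← Real.rpow_add hs]
    norm_num
  rw [(he.isAxisAt hx).VSq_eq hΩ hγ hx hs.ne', h1, h2, ← h3]
  rw [show sInv γ x ^ 3 = (6 * eig γ x ^ 2) ^ 3 by rw [← hs6]]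
  ring

/-- Formally, $d\ln V^2=-\tfrac23\,d\alpha/\alpha+2\,d\mu/\mu=2\mu e+2(n-\nu e)+2(\nu-\mu)e=2n$. The
axis field exists only locally, but the conclusion does not mention it. The multiplied form needs no
assumption $\mu\ne0$. -/
theorem pd_VSq (hΩ : IsOpen Ω) (hγ : IsRiemannianMetricOn γ Ω)
    (hD : ∀ y ∈ Ω, IsRicciTypeD γ y) {U : (Fin 3 → ℝ) → ℝ} (hU : ContDiffOn ℝ ∞ U Ω)
    (hR : ∀ y ∈ Ω, ricci γ y = lapse γ U y) (hx : x ∈ Ω) (i : Fin 3) :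
    pd i (VSq γ) x = 2 * VSq γ x * pd i U x := by
  obtain ⟨Ω', hΩ', hsub, hx', e, he⟩ := exists_isAxisField hΩ hγ hD hx
  replace hγ := hγ.mono hsub
  replace hD : ∀ y ∈ Ω', IsRicciTypeD γ y := fun y hy => hD y (hsub hy)
  replace hU := hU.mono hsub
  replace hR : ∀ y ∈ Ω', ricci γ y = lapse γ U y := fun y hy => hR y (hsub hy)
  have hs := sInv_pos_of_typeD hΩ' hγ hx' (hD x hx')
  have hs6 := sInv_eq_of_typeD hΩ' hγ hx' (hD x hx')
  have hα := he.eig_ne_zero x hx'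
  have hdμ := differentiableAt_of_smooth hΩ' (he.smooth_halfExp hΩ' hγ) hx'
  have hds := differentiableAt_of_smooth hΩ' (smooth_sInv hΩ' hγ) hx'
  have hr : ContDiffOn ℝ ∞ (fun y => sInv γ y ^ (-(1 / 3) : ℝ)) Ω' :=
    (smooth_sInv hΩ' hγ).rpow_const_of_ne fun y hy => (hD y hy).2.2
  have hdr := differentiableAt_of_smooth hΩ' hr hx'
  have hdμ2 : DifferentiableAt ℝ (fun y => IsAxisField.halfExp γ (eig γ) e y ^ 2) x := hdμ.fun_pow 2
  have hμ2 : pd i (fun y => IsAxisField.halfExp γ (eig γ) e y ^ 2) x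
      = 2 * IsAxisField.halfExp γ (eig γ) e x * pd i (IsAxisField.halfExp γ (eig γ) e) x := by
    have hφ : HasDerivAt (fun t : ℝ => t ^ 2) (2 * IsAxisField.halfExp γ (eig γ) e x)
        (IsAxisField.halfExp γ (eig γ) e x) := by
      simpa using hasDerivAt_pow 2 (IsAxisField.halfExp γ (eig γ) e x)
    exact pd_comp hφ hdμ i
  have hr' : pd i (fun y => sInv γ y ^ (-(1 / 3) : ℝ)) x
      = -(1 / 3) * sInv γ x ^ (-(1 / 3) - 1 : ℝ) * pd i (sInv γ) x :=
    pd_comp (Real.hasDerivAt_rpow_const (Or.inl hs.ne')) hds i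
  have hrs : sInv γ x ^ (-(1 / 3) - 1 : ℝ) * (6 * eig γ x ^ 2) = sInv γ x ^ (-(1 / 3) : ℝ) := by
    rw [← hs6, Real.rpow_sub_one hs.ne']; field_simp
  rw [pd_congr_on hΩ' hx' (fun y hy => he.VSq_eq hΩ' hγ hD hy) i, he.VSq_eq hΩ' hγ hD hx',
    pd_mul (hdr.const_mul 48) hdμ2, pd_const_mul _ hdr, hμ2, hr',
    he.pd_halfExp hΩ' hγ hU hR hx', pd_sInv hΩ' hγ hx' hD,
    (he.first_derivatives hΩ' hγ hU hR hx').1 i]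
  have h2 : IsAxisField.axisDeriv γ e (eig γ) x
      = -3 * eig γ x * IsAxisField.halfExp γ (eig γ) e x := by
    rw [IsAxisField.halfExp]; field_simp
  rw [h2, ← hrs]
  ring

theorem pd_V (hΩ : IsOpen Ω) (hγ : IsRiemannianMetricOn γ Ω)
    (hD : ∀ y ∈ Ω, IsRicciTypeD γ y) {U : (Fin 3 → ℝ) → ℝ} (hU : ContDiffOn ℝ ∞ U Ω)
    (hR : ∀ y ∈ Ω, ricci γ y = lapse γ U y) (hx : x ∈ Ω)
    (hP : PUp γ x *ᵥ diff (sInv γ) x ≠ 0) (i : Fin 3) : pd i (V γ) x = V γ x * pd i U x := by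
  have hpos := VSq_pos hΩ hγ hx (hD x hx) hP
  have h1 : pd i (V γ) x = 1 / (2 * Real.sqrt (VSq γ x)) * pd i (VSq γ) x :=
    pd_comp (Real.hasDerivAt_sqrt hpos.ne')
      (differentiableAt_of_smooth hΩ (smooth_VSq hΩ hγ hD) hx) i
  rw [h1, pd_VSq hΩ hγ hD hU hR hx, V_eq_sqrt]
  have h2 := Real.mul_self_sqrt hpos.le
  have h3 := (Real.sqrt_pos.2 hpos).ne'
  field_simp
  linear_combination -pd i U x * h2

end Invariants

/-! ### Class A or C, vacuum potentials and their uniqueness -/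

section Potential

variable {γ : (Fin 3 → ℝ) → Matrix (Fin 3) (Fin 3) ℝ} {Ω : Set (Fin 3 → ℝ)} {x : Fin 3 → ℝ}
  {U : (Fin 3 → ℝ) → ℝ}

theorem fderiv_eq_dotProduct (f : (Fin 3 → ℝ) → ℝ) (x w : Fin 3 → ℝ) :
    fderiv ℝ f x w = w ⬝ᵥ diff f x := by
  have hw : w = ∑ i, w i • (Pi.single i 1 : Fin 3 → ℝ) := pi_eq_sum_univ' w
  conv_lhs => rw [hw]
  simp only [map_sum, map_smul, smul_eq_mul, dotProduct, diff, pd]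

theorem space_cons (w : Fin 3 → ℝ) : space (Fin.cons 0 w) = w := by
  funext i; simp [space]

theorem hessian_eq_smul_lapse (hΩ : IsOpen Ω) {W : (Fin 3 → ℝ) → ℝ}
    (hW : ContDiffOn ℝ ∞ W Ω) (hU : ContDiffOn ℝ ∞ U Ω)
    (h : ∀ y ∈ Ω, ∀ j, pd j W y = W y * pd j U y) (hx : x ∈ Ω) :
    hessian γ W x = W x • lapse γ U x := by
  ext i j
  have hdW := differentiableAt_of_smooth hΩ hW hx
  have hdU := differentiableAt_of_smooth hΩ (smooth_pd hΩ hU j) hx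
  simp only [hessian, lapse, Matrix.of_apply, Matrix.smul_apply, smul_eq_mul]
  rw [pd_congr_on hΩ hx (fun y hy => h y hy j) i, pd_mul hdW hdU, h x hx i]
  simp only [h x hx, Fin.sum_univ_three]
  ring

/-- Together the two classes are the complement of a gradient in the spacelike plane, the zero
gradient included. As $\alpha$ is static its derivative along $u$ vanishes, and only the derivative
along $e$ is left to decide. -/
theorem isClassA_or_isClassC_iff (hΩ : IsOpen Ω) {X : Fin 4 → ℝ} (hX : space X ∈ Ω)
    {f : (Fin 3 → ℝ) → ℝ} (hf : DifferentiableAt ℝ f (space X)) {α : (Fin 4 → ℝ) → ℂ}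
    (hα : ∀ Y, space Y ∈ Ω → α Y = (f (space Y) : ℂ)) {e : Fin 4 → ℝ} (he : e 0 = 0)
    (h1 : space e ⬝ᵥ (γ (space X) *ᵥ space e) = 1) :
    (IsClassA (staticMetric γ U) (staticObserver U X) e α X ∨
      IsClassC (staticMetric γ U) (staticObserver U X) e α X) ↔
      fderiv ℝ f (space X) (space e) ≠ 0 := by
  have key : ∀ v, fderiv ℝ α X v = ((fderiv ℝ f (space X) (space v) : ℝ) : ℂ) := by
    intro v
    have hc : HasFDerivAt (fun y => (f y : ℂ))
        (Complex.ofRealCLM.comp (fderiv ℝ f (space X))) (space X) :=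
      HasFDerivAt.comp (f := f) (space X) Complex.ofRealCLM.hasFDerivAt hf.hasFDerivAt
    have heq : α =ᶠ[nhds X] fun Y => (f (space Y) : ℂ) :=
      (eventually_space_mem hΩ hX).mono hα
    rw [heq.fderiv_eq, fderiv_comp_space (f := fun y => (f y : ℂ)) hc.differentiableAt, hc.fderiv]
    rfl
  constructor
  · rintro (⟨hT, hne⟩ | ⟨-, hS⟩) h0
    · refine hne (ContinuousLinearMap.ext fun v => ?_)
      obtain ⟨c, hc⟩ : ∃ c, c = space e ⬝ᵥ (γ (space X) *ᵥ space v) := ⟨_, rfl⟩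
      -- The part of $v$ orthogonal to $u$ and $e$; dropping the time component does not change the
      -- derivative of a static function.
      have h := hT (Fin.cons 0 (space v - c • space e))
        (by rw [staticObserver_dotProduct]; simp)
        (by
          rw [dotProduct_staticMetric he, space_cons, Matrix.mulVec_sub, dotProduct_sub,
            Matrix.mulVec_smul, dotProduct_smul, h1, hc]
          simp)
      rw [key, space_cons, map_sub, map_smul, h0, smul_zero, sub_zero] at h
      rw [key, h]
      rfl
    · refine hS ⟨?_, ?_⟩
      · rw [key, staticObserver, space_single_zero]; simp
      · rw [key, h0]; simp
  · intro h
    by_cases hT : GradInTimelikePlane (staticMetric γ U) (staticObserver U X) e α X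
    · refine Or.inl ⟨hT, fun h' => h ?_⟩
      have := key e
      rw [h'] at this
      simpa using this.symm
    · refine Or.inr ⟨hT, fun hS => h ?_⟩
      have := hS.2
      rw [key] at this
      exact_mod_cast this

theorem IsAxisAt.ricciEndo_mulVec (hγ : IsRiemannianMetricOn γ Ω) (hx : x ∈ Ω) {e : Fin 3 → ℝ}
    (he : IsAxisAt γ x e) (w : Fin 3 → ℝ) :
    ricciEndo γ x *ᵥ w = eig γ x • (w - (3 * (e ⬝ᵥ w)) • ((γ x)⁻¹ *ᵥ e)) := by
  rw [ricciEndo, he.1, ← Matrix.mulVec_mulVec, Matrix.smul_mulVec, Matrix.sub_mulVec,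
    Matrix.smul_mulVec, Matrix.vecMulVec_mulVec, Matrix.mulVec_smul, Matrix.mulVec_sub,
    Matrix.mulVec_mulVec, Matrix.nonsing_inv_mul _ (hγ.det_ne_zero hx).isUnit, Matrix.one_mulVec,
    Matrix.mulVec_smul, op_smul_eq_smul, Matrix.mulVec_smul, smul_smul]

theorem IsRiemannianMetricOn.mulVec_inv_mulVec (hγ : IsRiemannianMetricOn γ Ω) (hx : x ∈ Ω) (e : Fin 3 → ℝ) :
    γ x *ᵥ ((γ x)⁻¹ *ᵥ e) = e := by
  rw [Matrix.mulVec_mulVec, Matrix.mul_nonsing_inv _ (hγ.det_ne_zero hx).isUnit, Matrix.one_mulVec]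

/-- A principal direction is a non-zero multiple of the axis. -/
theorem IsAxisAt.eq_smul_of_eigenvector (hγ : IsRiemannianMetricOn γ Ω) (hx : x ∈ Ω)
    {e w : Fin 3 → ℝ} (he : IsAxisAt γ x e) (hα : eig γ x ≠ 0)
    (hw : ricciEndo γ x *ᵥ w = (-2 * eig γ x) • w) : w = (e ⬝ᵥ w) • ((γ x)⁻¹ *ᵥ e) := by
  rw [he.ricciEndo_mulVec hγ hx] at hw
  funext i
  have h := congrFun hw i
  simp only [Pi.smul_apply, Pi.sub_apply, smul_eq_mul] at h ⊢
  have h3 : (3 * eig γ x) * (w i - e ⬝ᵥ w * ((γ x)⁻¹ *ᵥ e) i) = 0 := by linear_combination h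
  have := (mul_eq_zero.1 h3).resolve_left (mul_ne_zero three_ne_zero hα)
  linarith

theorem IsAxisAt.PUp_diff_ne_zero_iff (hΩ : IsOpen Ω) (hγ : IsRiemannianMetricOn γ Ω) (hx : x ∈ Ω)
    (hD : ∀ y ∈ Ω, IsRicciTypeD γ y) {e : Fin 3 → ℝ} (he : IsAxisAt γ x e) :
    PUp γ x *ᵥ diff (sInv γ) x ≠ 0 ↔ fderiv ℝ (eig γ) x ((γ x)⁻¹ *ᵥ e) ≠ 0 := by
  have hα := (exists_isAxisAt hΩ hγ hx (hD x hx)).1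
  have hds : diff (sInv γ) x = (12 * eig γ x) • diff (eig γ) x :=
    funext fun i => pd_sInv hΩ hγ hx hD i
  have hE : (γ x)⁻¹ *ᵥ e ≠ 0 := by
    intro h
    have := he.2
    rw [h] at this
    simp at this
  rw [he.PUp_mulVec hγ hx, hds, dotProduct_smul, ← fderiv_eq_dotProduct]
  simp [hα, hE]

/-- That $s\ne0$ need not be assumed: if $s=0$ then $t=0$, so the Ricci endomorphism is nilpotent by
Cayley–Hamilton. Self-adjointness then makes its square vanish, and $P=0$. -/
theorem isRicciTypeD_of_PUp_ne_zero (hΩ : IsOpen Ω) (hγ : IsRiemannianMetricOn γ Ω) (hx : x ∈ Ω)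
    (htr : (ricciEndo γ x).trace = 0) (hst : 6 * tInv γ x ^ 2 = sInv γ x ^ 3)
    (hP : PUp γ x *ᵥ diff (sInv γ) x ≠ 0) : IsRicciTypeD γ x := by
  refine ⟨htr, hst, fun hs => hP ?_⟩
  have ht : tInv γ x = 0 := by
    rw [hs] at hst
    have : tInv γ x ^ 2 = 0 := by linarith
    exact pow_eq_zero_iff two_ne_zero |>.1 this
  have h3 : ricciEndo γ x ^ 3 = 0 := by
    have h := cayley_hamilton_of_trace_zero _ htr
    change _ = (sInv γ x / 2) • _ + (tInv γ x / 3) • _ at h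
    rw [h, hs, ht]; simp
  have hG := hγ.posDef x hx
  have hK : (ricci γ x)ᵀ = ricci γ x := Matrix.ext fun i j => hγ.ricci_symm hΩ hx j i
  have hA : (γ x)⁻¹ * (ricci γ x * (γ x)⁻¹ * ricci γ x) = ricciEndo γ x ^ 2 := by
    rw [pow_two, ricciEndo]; simp only [Matrix.mul_assoc]
  have h0 : ricci γ x * (γ x)⁻¹ * ricci γ x = 0 := by
    refine eq_zero_of_selfAdjoint_sq hG ?_ ?_
    · simp only [Matrix.transpose_mul, hK, transpose_eq_of_posDef hG.inv, Matrix.mul_assoc]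
    · have : ricci γ x * (γ x)⁻¹ * ricci γ x * (γ x)⁻¹ * (ricci γ x * (γ x)⁻¹ * ricci γ x)
          = ricci γ x * ricciEndo γ x ^ 3 := by
        simp only [pow_succ, pow_zero, one_mul, ricciEndo, Matrix.mul_assoc]
      rw [this, h3, mul_zero]
  have h2 : ricciEndo γ x ^ 2 = 0 := by rw [← hA, h0, mul_zero]
  simp [PUp, hs, h2]

theorem IsStaticVacuumPotential.ricci_eq (hΩ : IsOpen Ω) (hγ : IsRiemannianMetricOn γ Ω)
    (hU : IsStaticVacuumPotential Ω γ U) (hx : x ∈ Ω) :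
    ricci γ x = lapse γ U x ∧ (ricciEndo γ x).trace = 0 := by
  have hX : space (Fin.cons 0 x : Fin 4 → ℝ) = x := space_cons x
  have hX' : space (Fin.cons 0 x : Fin 4 → ℝ) ∈ Ω := by rwa [hX]
  have h := (ricci_static_eq_zero_iff hΩ hγ hU.smooth hX').1 (hU.vacuum _ hX')
  rwa [hX] at h

/-- The eigenvalue function and the direction in the hypothesis come without any regularity. The
traces force the former to be $-t/s$, which is smooth, and the latter is a multiple of the axis. -/
theorem IsACPotential.isRicciTypeD (hΩ : IsOpen Ω) (hγ : IsRiemannianMetricOn γ Ω)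
    (hU : IsACPotential Ω γ U) :
    (∀ x ∈ Ω, IsRicciTypeD γ x) ∧ ∀ x ∈ Ω, PUp γ x *ᵥ diff (sInv γ) x ≠ 0 := by
  obtain ⟨hV, α, e, h⟩ := hU
  have hinv : ∀ X, space X ∈ Ω →
      IsRicciTypeD γ (space X) ∧ α X = (eig γ (space X) : ℂ) := by
    intro X hX
    obtain ⟨h0, h1⟩ :=
      (isTypeDAt_static_iff hΩ hγ hV.smooth hX (hV.vacuum X hX) (α X)).1 (h X hX).1
    have htr := (hV.ricci_eq hΩ hγ hX).2
    obtain ⟨h2, h3, h4⟩ := invariants_of_typeD htr h0 h1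
    exact ⟨⟨htr, h2, h3⟩, h4⟩
  have hD : ∀ x ∈ Ω, IsRicciTypeD γ x := by
    intro x hx
    have hX : space (Fin.cons 0 x : Fin 4 → ℝ) = x := space_cons x
    have := (hinv (Fin.cons 0 x) (by rwa [hX])).1
    rwa [hX] at this
  refine ⟨hD, fun x hx => ?_⟩
  obtain ⟨X, hX⟩ : ∃ X : Fin 4 → ℝ, space X = x := ⟨Fin.cons 0 x, space_cons x⟩
  subst hX
  obtain ⟨-, hp, hc⟩ := h X hx
  rw [(hinv X hx).2, isPrincipalDir_static_iff hΩ hγ hV.smooth hx (hV.vacuum X hx)] at hp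
  obtain ⟨he0, he1, he2⟩ := hp
  rw [isClassA_or_isClassC_iff hΩ hx (differentiableAt_of_smooth hΩ (smooth_eig hΩ hγ hD) hx)
    (fun Y hY => (hinv Y hY).2) he0 he1] at hc
  obtain ⟨hα, f, hf⟩ := exists_isAxisAt hΩ hγ hx (hD _ hx)
  rw [hf.PUp_diff_ne_zero_iff hΩ hγ hx hD]
  intro h0
  rw [hf.eq_smul_of_eigenvector hγ hx hα he2, map_smul, h0, smul_zero] at hc
  exact hc rfl

/-- The axis may be chosen point by point without continuity, because only $\alpha$ is
differentiated in the definition of the classes. -/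
theorem IsStaticVacuumPotential.isACPotential (hΩ : IsOpen Ω) (hγ : IsRiemannianMetricOn γ Ω)
    (hU : IsStaticVacuumPotential Ω γ U) (hD : ∀ x ∈ Ω, IsRicciTypeD γ x)
    (hP : ∀ x ∈ Ω, PUp γ x *ᵥ diff (sInv γ) x ≠ 0) : IsACPotential Ω γ U := by
  classical
  have haxis : ∀ x, ∃ f, x ∈ Ω → IsAxisAt γ x f := by
    intro x
    by_cases hx : x ∈ Ω
    · obtain ⟨-, f, hf⟩ := exists_isAxisAt hΩ hγ hx (hD x hx)
      exact ⟨f, fun _ => hf⟩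
    · exact ⟨0, fun h => absurd h hx⟩
  choose f hf using haxis
  refine ⟨hU, fun X => (eig γ (space X) : ℂ),
    fun X => Fin.cons 0 ((γ (space X))⁻¹ *ᵥ f (space X)), fun X hX => ?_⟩
  have hfx := hf _ hX
  have hα := (exists_isAxisAt hΩ hγ hX (hD _ hX)).1
  have hunit : ((γ (space X))⁻¹ *ᵥ f (space X)) ⬝ᵥ
      (γ (space X) *ᵥ ((γ (space X))⁻¹ *ᵥ f (space X))) = 1 := by
    rw [hγ.mulVec_inv_mulVec hX, dotProduct_comm]
    exact hfx.2
  refine ⟨?_, ?_, ?_⟩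
  · rw [isTypeDAt_static_iff hΩ hγ hU.smooth hX (hU.vacuum X hX)]
    exact ⟨Complex.ofReal_ne_zero.2 hα, typeD_of_axis (hγ.posDef _ hX) hfx.1 hfx.2⟩
  · rw [isPrincipalDir_static_iff hΩ hγ hU.smooth hX (hU.vacuum X hX), space_cons]
    refine ⟨rfl, hunit, ?_⟩
    rw [hfx.ricciEndo_mulVec hγ hX, hfx.2]
    ext i
    simp only [Pi.smul_apply, Pi.sub_apply, smul_eq_mul]
    ring
  · rw [isClassA_or_isClassC_iff hΩ hX
      (differentiableAt_of_smooth hΩ (smooth_eig hΩ hγ hD) hX) (fun _ _ => rfl) rfl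
      (by rw [space_cons]; exact hunit), space_cons, ← hfx.PUp_diff_ne_zero_iff hΩ hγ hX hD]
    exact hP _ hX

/-- Smoothness of $U$ is not assumed, as $U=\ln(cW)$ on $\Omega$. Then $dW=W\,dU$ turns
$W^{-1}\nabla dW$ into $\nabla dU+dU\otimes dU$. -/
theorem isStaticVacuumPotential_of_exp_eq (hΩ : IsOpen Ω) (hγ : IsRiemannianMetricOn γ Ω)
    {W : (Fin 3 → ℝ) → ℝ} (hW : ContDiffOn ℝ ∞ W Ω) (hpos : ∀ x ∈ Ω, 0 < W x)
    (htr : ∀ x ∈ Ω, (ricciEndo γ x).trace = 0)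
    (hR : ∀ x ∈ Ω, ricci γ x = (W x)⁻¹ • hessian γ W x) {c : ℝ} (hc : 0 < c)
    (hU : ∀ x ∈ Ω, Real.exp (U x) = c * W x) : IsStaticVacuumPotential Ω γ U := by
  have hUl : ∀ x ∈ Ω, U x = Real.log (c * W x) := fun x hx => by rw [← hU x hx, Real.log_exp]
  have hUs : ContDiffOn ℝ ∞ U Ω :=
    ((contDiffOn_const.mul hW).log fun x hx => (mul_pos hc (hpos x hx)).ne').congr hUl
  have hpd : ∀ y ∈ Ω, ∀ j, pd j W y = W y * pd j U y := by
    intro y hy j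
    have h1 : pd j (fun z => Real.exp (U z)) y = Real.exp (U y) * pd j U y :=
      pd_comp (Real.hasDerivAt_exp _) (differentiableAt_of_smooth hΩ hUs hy) j
    rw [pd_congr_on hΩ hy hU, pd_const_mul c (differentiableAt_of_smooth hΩ hW hy), hU y hy] at h1
    refine mul_left_cancel₀ hc.ne' ?_
    rw [h1, mul_assoc]
  refine ⟨hUs, fun X hX => ?_⟩
  rw [ricci_static_eq_zero_iff hΩ hγ hUs hX, hR _ hX, hessian_eq_smul_lapse hΩ hW hUs hpd hX,
    smul_smul, inv_mul_cancel₀ (hpos _ hX).ne', one_smul]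
  exact ⟨rfl, htr _ hX⟩

theorem IsStaticVacuumPotential.ricci_eq_hessian_V (hΩ : IsOpen Ω)
    (hγ : IsRiemannianMetricOn γ Ω) (hU : IsStaticVacuumPotential Ω γ U)
    (hD : ∀ x ∈ Ω, IsRicciTypeD γ x) (hP : ∀ x ∈ Ω, PUp γ x *ᵥ diff (sInv γ) x ≠ 0)
    (hx : x ∈ Ω) : ricci γ x = (V γ x)⁻¹ • hessian γ (V γ) x := by
  have hR : ∀ y ∈ Ω, ricci γ y = lapse γ U y := fun y hy => (hU.ricci_eq hΩ hγ hy).1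
  rw [hessian_eq_smul_lapse hΩ (smooth_V hΩ hγ hD hP) hU.smooth
    (fun y hy => pd_V hΩ hγ hD hU.smooth hR hy (hP y hy)) hx, smul_smul,
    inv_mul_cancel₀ (V_pos hΩ hγ hx (hD x hx) (hP x hx)).ne', one_smul, hR x hx]

/-- Since $dV=V\,dU$, the function $U-\ln V$ has zero differential; the constant is the exponential
of its value. -/
theorem IsStaticVacuumPotential.exp_eq_const_mul_V (hΩ : IsOpen Ω)
    (hγ : IsRiemannianMetricOn γ Ω) (hU : IsStaticVacuumPotential Ω γ U)
    (hD : ∀ x ∈ Ω, IsRicciTypeD γ x) (hP : ∀ x ∈ Ω, PUp γ x *ᵥ diff (sInv γ) x ≠ 0)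
    (hc : IsPreconnected Ω) : ∃ c : ℝ, 0 < c ∧ ∀ x ∈ Ω, Real.exp (U x) = c * V γ x := by
  have hR : ∀ y ∈ Ω, ricci γ y = lapse γ U y := fun y hy => (hU.ricci_eq hΩ hγ hy).1
  have hpos : ∀ y ∈ Ω, 0 < V γ y := fun y hy => V_pos hΩ hγ hy (hD y hy) (hP y hy)
  have hdU : ∀ y ∈ Ω, DifferentiableAt ℝ U y := fun y hy =>
    differentiableAt_of_smooth hΩ hU.smooth hy
  have hdV : ∀ y ∈ Ω, DifferentiableAt ℝ (V γ) y := fun y hy =>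
    differentiableAt_of_smooth hΩ (smooth_V hΩ hγ hD hP) hy
  have hdL : ∀ y ∈ Ω, DifferentiableAt ℝ (fun z => Real.log (V γ z)) y := fun y hy =>
    (hdV y hy).log (hpos y hy).ne'
  obtain ⟨a, ha⟩ := hΩ.exists_is_const_of_fderiv_eq_zero (𝕜 := ℝ) hc
    (f := fun y => U y - Real.log (V γ y))
    (fun y hy => ((hdU y hy).fun_sub (hdL y hy)).differentiableWithinAt) (by
      intro y hy
      refine ContinuousLinearMap.ext fun w => ?_
      have h0 : diff (fun y => U y - Real.log (V γ y)) y = 0 := by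
        funext i
        have h1 : pd i (fun z => Real.log (V γ z)) y = (V γ y)⁻¹ * pd i (V γ) y :=
          pd_comp (Real.hasDerivAt_log (hpos y hy).ne') (hdV y hy) i
        rw [diff, pd_sub (hdU y hy) (hdL y hy), h1, pd_V hΩ hγ hD hU.smooth hR hy (hP y hy),
          inv_mul_cancel_left₀ (hpos y hy).ne', sub_self]
        rfl
      rw [fderiv_eq_dotProduct, h0, dotProduct_zero]
      rfl)
  refine ⟨Real.exp a, Real.exp_pos a, fun x hx => ?_⟩
  rw [← ha x hx, Real.exp_sub, Real.exp_log (hpos x hx), div_mul_cancel₀ _ (hpos x hx).ne']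

end Potential

end StaticVacuum

/-! ### The theorem -/

theorem mainTheorem1 (Ω : Set (Fin 3 → ℝ)) (hΩ : IsOpen Ω)
    (γ : (Fin 3 → ℝ) → Matrix (Fin 3) (Fin 3) ℝ)
    (hγ : StaticVacuum.IsRiemannianMetricOn γ Ω) :
    (StaticVacuum.IsSpatialMetricOfAC Ω γ ↔
      ∀ x ∈ Ω,
        (StaticVacuum.ricciEndo γ x).trace = 0 ∧
        6 * StaticVacuum.tInv γ x ^ 2 = StaticVacuum.sInv γ x ^ 3 ∧
        StaticVacuum.PUp γ x *ᵥ StaticVacuum.diff (StaticVacuum.sInv γ) x ≠ 0 ∧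
        StaticVacuum.ricci γ x =
          (StaticVacuum.V γ x)⁻¹ • StaticVacuum.hessian γ (StaticVacuum.V γ) x) ∧
    (StaticVacuum.IsSpatialMetricOfAC Ω γ →
      (∀ x ∈ Ω, 0 < StaticVacuum.V γ x) ∧
      (∀ (U : (Fin 3 → ℝ) → ℝ) (c : ℝ), 0 < c →
        (∀ x ∈ Ω, Real.exp (U x) = c * StaticVacuum.V γ x) →
        StaticVacuum.IsACPotential Ω γ U) ∧
      (IsPreconnected Ω →
        ∀ U : (Fin 3 → ℝ) → ℝ, StaticVacuum.IsStaticVacuumPotential Ω γ U →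
          ∃ c : ℝ, 0 < c ∧ ∀ x ∈ Ω, Real.exp (U x) = c * StaticVacuum.V γ x)) := by
  have key : StaticVacuum.IsSpatialMetricOfAC Ω γ → (∀ x ∈ Ω, StaticVacuum.IsRicciTypeD γ x) ∧
      (∀ x ∈ Ω, StaticVacuum.PUp γ x *ᵥ StaticVacuum.diff (StaticVacuum.sInv γ) x ≠ 0) ∧
      ∀ x ∈ Ω, StaticVacuum.ricci γ x =
        (StaticVacuum.V γ x)⁻¹ • StaticVacuum.hessian γ (StaticVacuum.V γ) x := by
    rintro ⟨U, hU⟩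
    obtain ⟨hD, hP⟩ := hU.isRicciTypeD hΩ hγ
    exact ⟨hD, hP, fun x hx => hU.1.ricci_eq_hessian_V hΩ hγ hD hP hx⟩
  have potential : (∀ x ∈ Ω, StaticVacuum.IsRicciTypeD γ x) →
      (∀ x ∈ Ω, StaticVacuum.PUp γ x *ᵥ StaticVacuum.diff (StaticVacuum.sInv γ) x ≠ 0) →
      (∀ x ∈ Ω, StaticVacuum.ricci γ x =
        (StaticVacuum.V γ x)⁻¹ • StaticVacuum.hessian γ (StaticVacuum.V γ) x) →
      ∀ (U : (Fin 3 → ℝ) → ℝ) (c : ℝ), 0 < c →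
        (∀ x ∈ Ω, Real.exp (U x) = c * StaticVacuum.V γ x) →
        StaticVacuum.IsACPotential Ω γ U := by
    intro hD hP hR U c hc hU
    exact (StaticVacuum.isStaticVacuumPotential_of_exp_eq hΩ hγ
      (StaticVacuum.smooth_V hΩ hγ hD hP)
      (fun x hx => StaticVacuum.V_pos hΩ hγ hx (hD x hx) (hP x hx))
      (fun x hx => (hD x hx).1) hR hc hU).isACPotential hΩ hγ hD hP
  refine ⟨⟨fun h => ?_, fun h => ?_⟩, fun h => ?_⟩
  · obtain ⟨hD, hP, hR⟩ := key h
    exact fun x hx => ⟨(hD x hx).1, (hD x hx).2.1, hP x hx, hR x hx⟩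
  · have hP := fun x hx => (h x hx).2.2.1
    have hD : ∀ x ∈ Ω, StaticVacuum.IsRicciTypeD γ x := fun x hx =>
      StaticVacuum.isRicciTypeD_of_PUp_ne_zero hΩ hγ hx (h x hx).1 (h x hx).2.1 (hP x hx)
    -- The potential $\ln V$ is the case $c=1$; positivity of $V$ makes $e^{\ln V}=V$ on $\Omega$.
    refine ⟨fun x => Real.log (StaticVacuum.V γ x),
      potential hD hP (fun x hx => (h x hx).2.2.2) _ 1 one_pos fun x hx => ?_⟩
    rw [Real.exp_log (StaticVacuum.V_pos hΩ hγ hx (hD x hx) (hP x hx)), one_mul]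
  · obtain ⟨hD, hP, hR⟩ := key h
    exact ⟨fun x hx => StaticVacuum.V_pos hΩ hγ hx (hD x hx) (hP x hx), potential hD hP hR,
      fun hc U hU => hU.exp_eq_const_mul_V hΩ hγ hD hP hc⟩
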